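/- Let $b>0$ and $a,\alpha\in\mathbb R$. Consider, for $(\rho_1,x_1,y_1)$ with $\rho_1\ge 0$ and $1+a\rho_1^2y_1>0$, the system \begin{align*} \dot\rho_1&=\rho_1(x_1-1)B,\\ \dot x_1&=y_1\left(1+\alpha\rho_1^2y_1+\rho_1^2x_1(x_1-1)\right)-x_1(x_1-1)B,\\ \dot y_1&=-y_1(x_1-1)\left(2B-\rho_1^2y_1\right), \end{align*} where $B=b+\dfrac{a\rho_1^4y_1^2}{1+a\rho_1^2y_1}$. $1^\circ$ The origin is a hyperbolic equilibrium, the linearization having eigenvalues $-b$, $b$, $2b$, with $(0,1,b)$ an eigenvector for $2b$. Let $W^s(0)$, $W^u(0)$ be the sets of points whose forward, respectively backward, orbit converges to $0$, and let $W^{uu}(0)$ be the set of points whose backward orbit converges to $0$ at an exponential rate larger than $b$. Then $W^u(0)\subset\{\rho_1=0\}$, and there is an open neighborhood $U_1$ of the origin such that \begin{align*} W^s(0)\cap U_1&=\{(\rho_1,x_1,y_1)\in U_1 : x_1=y_1=0,\ \rho_1\ge 0\},\\ W^u(0)\cap U_1&=\{(\rho_1,x_1,y_1)\in U_1 : \rho_1=0\},\\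 W^{uu}(0)\cap U_1&=\{(\rho_1,x_1,y_1)\in U_1 : \rho_1=0,\ y_1=\varphi(x_1)\}, \end{align*} where $\varphi$ is $C^\infty$ and $\varphi(x_1)=bx_1+\mathcal O(x_1^2)$. It is unique: every locally invariant $C^1$ curve $y_1=\psi(x_1)$ in $\{\rho_1=0\}$ with $\psi(0)=0$, $\psi'(0)=b$ coincides with $y_1=\varphi(x_1)$ near the origin. $2^\circ$ The part of $W^{uu}(0)\setminus\{0\}$ in $\{y_1\ge 0\}$ is a single orbit, defined for all times. It lies in $\{\rho_1=0,\ x_1>0,\ y_1>0\}$, it leaves the origin along the direction of $(0,1,b)$, and it is forward asymptotic to the equilibrium $L_1=(0,1,0)$, approaching $L_1$ along the direction of $(0,1,b)$. $3^\circ$ The linearization at the equilibrium $L_1$ has eigenvalues $0$, $0$, $-b$. There are an open box $V_1=\{|\rho_1|<r,\ |x_1-1|<\delta,\ |y_1|<\chi\}$ around $L_1$ and a $C^\infty$ function $m_1:[0,r)\times[0,\chi)\to\mathbb R$ with $m_1(\rho_1,y_1)=b^{-1}+\mathcal O(y_1)$ uniformly in $\rho_1$ such that, within $V_1\cap\{\rho_1\ge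 0,\ y_1\ge 0\}$, the surface $$S_1:\quad x_1=1+y_1m_1(\rho_1,y_1)$$ is an attracting center manifold of $L_1$: it is locally invariant, it is tangent at $L_1$ to the center subspace, and $|x_1-1-y_1m_1(\rho_1,y_1)|$ decays at a uniform exponential rate along orbits as long as they stay in $V_1\cap\{\rho_1\ge 0,\ y_1\ge 0\}$. The set $C_1=\{\rho_1>0,\ x_1=1,\ y_1=0\}$ consists of equilibria and $C_1\cap V_1\subset S_1$. Moreover $$D_1:=W^{uu}(0)\cap V_1=S_1\cap\{\rho_1=0,\ y_1>0\},$$ and $D_1$ is geometrically unique as a center submanifold, in the following sense: if $x_1=g(y_1)$, $0\le y_1<\eta$, with $g\in C^1$, $g(0)=1$, $g'(0)=b^{-1}$, is a locally invariant curve in $\{\rho_1=0\}$ (a center manifold of $L_1$ in this plane) containing a point with $y_1>0$ whose backward orbit tends to the origin along the direction of $(0,1,b)$, then $g(y_1)=1+y_1m_1(0,y_1)$ for all sufficiently small $y_1>0$. -/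

import Mathlib

open Set Filter Topology Asymptotics
open scoped ContDiff

noncomputable section

/-! ### Notions from dynamical systems, for an autonomous equation `γ' = F γ` -/

section General

variable {E : Type*} [NormedAddCommGroup E] [NormedSpace ℝ E]

/-- `γ` solves `γ' = F γ` on the time interval `J` and stays in the phase space `P` there. -/
def IsSolutionOn (F : E → E) (P : Set E) (γ : ℝ → E) (J : Set ℝ) : Prop :=
  ∀ t ∈ J, γ t ∈ P ∧ HasDerivWithinAt γ (F (γ t)) J t

/-- The eigenvalues of the linearization of `F` at `p`, with algebraic multiplicity. -/
def linearizationEigenvalues (F : E → E) (p : E) [FiniteDimensional ℝ E] : Multiset ℝ :=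
  ((fderiv ℝ F p : E →L[ℝ] E) : E →ₗ[ℝ] E).charpoly.roots

/-- `p` is a hyperbolic equilibrium of `F`: the linearization has no complex eigenvalue on the
imaginary axis. -/
def IsHyperbolicEquilibrium (F : E → E) (p : E) [FiniteDimensional ℝ E] : Prop :=
  F p = 0 ∧ DifferentiableAt ℝ F p ∧
    ∀ z : ℂ, ((((fderiv ℝ F p : E →L[ℝ] E) : E →ₗ[ℝ] E).charpoly).map
      (algebraMap ℝ ℂ)).IsRoot z → z.re ≠ 0

/-- The stable manifold of `p`: the points of `P` whose forward orbit exists in `P` for all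
positive times and converges to `p`. -/
def stableManifold (F : E → E) (P : Set E) (p : E) : Set E :=
  {z | ∃ γ : ℝ → E, IsSolutionOn F P γ (Ici 0) ∧ γ 0 = z ∧ Tendsto γ atTop (𝓝 p)}

/-- The unstable manifold of `p`: the points of `P` whose backward orbit exists in `P` for all
negative times and converges to `p`. -/
def unstableManifold (F : E → E) (P : Set E) (p : E) : Set E :=
  {z | ∃ γ : ℝ → E, IsSolutionOn F P γ (Iic 0) ∧ γ 0 = z ∧ Tendsto γ atBot (𝓝 p)}

/-- The strong unstable manifold of `p` above the rate `μ`: the points whose backward orbit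
converges to `p` at an exponential rate strictly larger than `μ`. Here `μ` is the weak unstable
eigenvalue. -/
def strongUnstableManifold (F : E → E) (P : Set E) (p : E) (μ : ℝ) : Set E :=
  {z | ∃ γ : ℝ → E, IsSolutionOn F P γ (Iic 0) ∧ γ 0 = z ∧ Tendsto γ atBot (𝓝 p) ∧
    ∃ ν : ℝ, μ < ν ∧ (fun t => γ t - p) =O[atBot] (fun t => Real.exp (ν * t))}

/-- `M` is invariant relative to `V`: an orbit segment in `P ∩ V` which meets `M` lies in `M`. -/
def IsLocallyInvariant (F : E → E) (P V M : Set E) : Prop :=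
  ∀ (γ : ℝ → E) (t₀ t₁ : ℝ), IsSolutionOn F (P ∩ V) γ (Icc t₀ t₁) →
    ∀ s ∈ Icc t₀ t₁, γ s ∈ M → ∀ t ∈ Icc t₀ t₁, γ t ∈ M

/-- `γ` converges to `p` along `l`, and the direction from `p` to `γ t` converges to the
direction of `v`. -/
def ApproachesAlong (γ : ℝ → E) (l : Filter ℝ) (p v : E) : Prop :=
  Tendsto γ l (𝓝 p) ∧
    Tendsto (fun t => ‖γ t - p‖⁻¹ • (γ t - p)) l (𝓝 (‖v‖⁻¹ • v))

/-- The center subspace of a linear map all of whose eigenvalues are real: the generalized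
eigenspace of the eigenvalue zero. -/
def centerSubspace (A : E →L[ℝ] E) : Submodule ℝ E :=
  Module.End.maxGenEigenspace (A : E →ₗ[ℝ] E) 0

end General

/-! ### The system in the chart `κ₁`

A point of `ℝ × ℝ × ℝ` is `(ρ₁, x₁, y₁)`. -/

/-- The bracket `b + a ρ⁴ y² / (1 + a ρ² y)`. -/
def kappa1Bracket (a b ρ y : ℝ) : ℝ :=
  b + a * ρ ^ 4 * y ^ 2 / (1 + a * ρ ^ 2 * y)

/-- The right hand side of the equations in the chart `κ₁`. -/
def kappa1Field (a b α : ℝ) (p : ℝ × ℝ × ℝ) : ℝ × ℝ × ℝ :=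
  let ρ := p.1
  let x := p.2.1
  let y := p.2.2
  (ρ * (x - 1) * kappa1Bracket a b ρ y,
    y * (1 + α * ρ ^ 2 * y + ρ ^ 2 * x * (x - 1)) - x * (x - 1) * kappa1Bracket a b ρ y,
    -y * (x - 1) * (2 * kappa1Bracket a b ρ y - y * ρ ^ 2))

/-- The phase space of the chart: `ρ₁ ≥ 0`, within the domain of the vector field. -/
def kappa1Space (a : ℝ) : Set (ℝ × ℝ × ℝ) :=
  {p | 0 ≤ p.1 ∧ 0 < 1 + a * p.1 ^ 2 * p.2.2}

/-- The part `y₁ ≥ 0` of the phase space, which carries the dynamics of the original system. -/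
def kappa1SpacePos (a : ℝ) : Set (ℝ × ℝ × ℝ) :=
  kappa1Space a ∩ {p | 0 ≤ p.2.2}

/-- The equilibrium `L₁`. -/
def pointL1 : ℝ × ℝ × ℝ := (0, 1, 0)

/-- The line `C₁`. -/
def lineC1 : Set (ℝ × ℝ × ℝ) := {p | 0 < p.1 ∧ p.2.1 = 1 ∧ p.2.2 = 0}

/-- The strong unstable manifold of the origin (the weak unstable eigenvalue is `b`). -/
def kappa1Wuu (a b α : ℝ) : Set (ℝ × ℝ × ℝ) :=
  strongUnstableManifold (kappa1Field a b α) (kappa1Space a) 0 b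

/-- The open box around `L₁` with half side lengths `r`, `δ`, `χ`. -/
def boxL1 (r δ χ : ℝ) : Set (ℝ × ℝ × ℝ) :=
  {p | |p.1| < r ∧ |p.2.1 - 1| < δ ∧ |p.2.2| < χ}

/-- The parametrization `(ρ₁, y₁) ↦ (ρ₁, 1 + y₁ m(ρ₁, y₁), y₁)`. -/
def graphMap (m : ℝ × ℝ → ℝ) (u : ℝ × ℝ) : ℝ × ℝ × ℝ :=
  (u.1, 1 + u.2 * m u, u.2)

/-- The surface `x₁ = 1 + y₁ m(ρ₁, y₁)` within `V`, over `ρ₁ ≥ 0`, `y₁ ≥ 0`. -/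
def graphSurface (m : ℝ × ℝ → ℝ) (V : Set (ℝ × ℝ × ℝ)) : Set (ℝ × ℝ × ℝ) :=
  {p | p ∈ V ∧ 0 ≤ p.1 ∧ 0 ≤ p.2.2 ∧ p.2.1 = 1 + p.2.2 * m (p.1, p.2.2)}

/-- The planar curve `x₁ = g(y₁)`, `0 ≤ y₁ < χ`, within `{ρ₁ = 0}`. -/
def planarCurve (g : ℝ → ℝ) (χ : ℝ) : Set (ℝ × ℝ × ℝ) :=
  {p | p.1 = 0 ∧ 0 ≤ p.2.2 ∧ p.2.2 < χ ∧ p.2.1 = g p.2.2}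

end

/-! Write ρ, x, y for the variables. In the invariant plane ρ = 0 the system is x' = y + b x (1 -
x), y' = 2 b (1 - x) y, and for y > 0 it can be integrated. With q = √(y/b) and W = x/q one has W' =
b q, and q e^{W²/2} e^{-bt} = k and `expInt 1 W` - k e^{bt} = c are constant. Backward orbits leave
the origin at the weak rate b unless c = 0, and c = 0 is the single curve (0, w D(w), b D(w)²),
where D is Dawson's function, D' = 1 - w D. Since D(w) is w times a smooth function of w², the curve
is a smooth graph over x at the origin; since w² (w D - 1) → 1, it reaches L₁ along (0, 1, b). The
other statements about the origin follow from linear equations for ρ, y and y - φ(x): a solution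
which decays backwards faster than its asymptotic rate vanishes (`eq_zero_of_isBigO_atBot`).

For the center manifold put x = 1 + y n. After division of time by x - 1 the pair (ρ, y) follows
`reducedField`, which does not depend on n. There ε = ρ² y satisfies ε' = ε², so this flow is
explicit, and n solves the scalar equation y n' = `flowRate` along its orbits. For small y the box
|b n - 1| ≤ 1/4 is forward invariant. A constant value of n on a line y = χ, continued along
characteristics, therefore gives an invariant graph over y > 0 (`exists_invariant_graph`); its
smoothness is the smooth dependence of an integral equation on parameters, proved by the implicit
function theorem in C([0,1]) (`exists_smooth_solution`). Center manifolds are not unique. The right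
one is selected by starting at χ = b D(w₁)² with the slope (x - 1)/y of the Dawson curve at w₁: by
uniqueness the graph then contains the end of the connecting orbit (`exists_matchedGraph`).

Smoothness at y = 0 comes from the transport equation Dm · Y = H(u, m), where Y = y `reducedField`
and ∂H/∂m ≤ -b²/2. Each differentiation adds a commutator of size ‖DY‖, which is O(l) on the strip 0
< y < l after rescaling y by l. For every order N a small l thus keeps the equation dissipative up
to that order (`bddDerivs_of_semilinear`), and bounded derivatives allow an extension to the closure
(`contDiffOn_extendFrom`). The strip may shrink with N, because smoothness at y = 0 is local.

Attraction and local invariance hold because x - 1 - y m solves a linear equation with rate between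
-2b and -b/2 (`IsInvariantGraph.graphDefect_deriv`). Uniqueness in the plane holds because a
competing curve contains a point of the Dawson curve, hence its forward orbit, which runs through
all small y > 0. -/

/-! ### Superposition operators on `C(K, E)` -/

section Superposition

universe u

variable {K : Type*} [TopologicalSpace K]

/-- The superposition operator `g ↦ f ∘ g`. -/
noncomputable def superposition {E F : Type*} [TopologicalSpace E] [TopologicalSpace F]
    (f : E → F) (hf : Continuous f) (g : C(K, E)) : C(K, F) :=
  (⟨f, hf⟩ : C(E, F)).comp g

@[simp] lemma superposition_apply {E F : Type*} [TopologicalSpace E] [TopologicalSpace F]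
    (f : E → F) (hf : Continuous f) (g : C(K, E)) (x : K) :
    superposition f hf g x = f (g x) := rfl

lemma continuous_superposition {E F : Type*} [TopologicalSpace E] [TopologicalSpace F]
    (f : E → F) (hf : Continuous f) : Continuous (superposition (K := K) f hf) :=
  ContinuousMap.continuous_postcomp _

variable [CompactSpace K] {E F : Type u} [NormedAddCommGroup E] [NormedSpace ℝ E]
  [NormedAddCommGroup F] [NormedSpace ℝ F]

/-- Pointwise application of a continuous family of continuous linear maps. -/
noncomputable def pointwiseApply : C(K, E →L[ℝ] F) →L[ℝ] C(K, E) →L[ℝ] C(K, F) :=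
  LinearMap.mkContinuous₂
    (LinearMap.mk₂ ℝ (fun (A : C(K, E →L[ℝ] F)) (h : C(K, E)) =>
        (⟨fun x => A x (h x), by fun_prop⟩ : C(K, F)))
      (fun _ _ _ => by ext; simp) (fun _ _ _ => by ext; simp)
      (fun _ _ _ => by ext; simp) (fun _ _ _ => by ext; simp)) 1
    (fun A h => by
      rw [one_mul]
      refine (ContinuousMap.norm_le _ (by positivity)).2 fun x => ?_
      exact ((A x).le_opNorm _).trans (mul_le_mul (A.norm_coe_le_norm x) (h.norm_coe_le_norm x)
        (norm_nonneg _) (norm_nonneg A)))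

@[simp] lemma pointwiseApply_apply (A : C(K, E →L[ℝ] F)) (h : C(K, E)) (x : K) :
    pointwiseApply A h x = A x (h x) := rfl

/-- The mean value inequality is applied on the segment from g x to g x + h x for each x. The
superposition operator of the derivative is continuous in the sup norm, so one δ serves all x. -/
lemma hasFDerivAt_superposition {f : E → F} (hf : ContDiff ℝ 1 f) (g : C(K, E)) :
    HasFDerivAt (superposition (K := K) f hf.continuous)
      (pointwiseApply (superposition (fderiv ℝ f) (hf.continuous_fderiv one_ne_zero) g)) g := by
  rw [hasFDerivAt_iff_isLittleO_nhds_zero, Asymptotics.isLittleO_iff]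
  intro ε hε
  obtain ⟨δ, hδ, H⟩ := (Metric.continuousAt_iff (α := C(K, E)) (β := C(K, E →L[ℝ] F))).1
    (continuous_superposition (K := K) (fderiv ℝ f)
      (hf.continuous_fderiv one_ne_zero)).continuousAt ε hε
  filter_upwards [Metric.ball_mem_nhds (0 : C(K, E)) hδ] with h hh
  rw [mem_ball_zero_iff] at hh
  refine (ContinuousMap.norm_le _ (by positivity)).2 fun x => ?_
  have key : ∀ z ∈ segment ℝ (g x) (g x + h x), ‖fderiv ℝ f z - fderiv ℝ f (g x)‖ ≤ ε := by
    intro z hz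
    rw [segment_eq_image'] at hz
    obtain ⟨t, ht, rfl⟩ := hz
    have h1 : dist (g + t • h) g < δ := by
      rw [dist_eq_norm, add_sub_cancel_left, norm_smul, Real.norm_eq_abs, abs_of_nonneg ht.1]
      exact (mul_le_of_le_one_left (norm_nonneg _) ht.2).trans_lt hh
    have h2 := (ContinuousMap.dist_apply_le_dist x).trans_lt (H h1)
    rw [dist_eq_norm] at h2
    simpa using h2.le
  have := (convex_segment (𝕜 := ℝ) (g x) (g x + h x)).norm_image_sub_le_of_norm_hasFDerivWithin_le'
    (f := f) (f' := fderiv ℝ f) (φ := fderiv ℝ f (g x)) (C := ε)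
    (fun z _ => ((hf.differentiable one_ne_zero) z).hasFDerivAt.hasFDerivWithinAt) key
    (left_mem_segment ℝ _ _) (right_mem_segment ℝ _ _)
  simp only [add_sub_cancel_left] at this
  simpa using this.trans (mul_le_mul_of_nonneg_left (h.norm_coe_le_norm x) hε.le)

/-- The derivative is `pointwiseApply` after superposition with `fderiv ℝ f`, an operator of the
same kind with one derivative less. The spaces are quantified inside the induction because `fderiv ℝ
f` takes values in a space of linear maps. -/
lemma contDiff_nat_superposition (n : ℕ) : ∀ {E F : Type u} [NormedAddCommGroup E]
    [NormedSpace ℝ E] [NormedAddCommGroup F] [NormedSpace ℝ F] {f : E → F}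
    (hf : ContDiff ℝ n f), ContDiff ℝ n (superposition (K := K) f hf.continuous) := by
  induction n with
  | zero =>
    intro E F _ _ _ _ f hf
    exact contDiff_zero.2 (continuous_superposition _ _)
  | succ n ih =>
    intro E F _ _ _ _ f hf
    have h1 : ContDiff ℝ 1 f := hf.of_le (by norm_cast; omega)
    have h2 : ContDiff ℝ n (fderiv ℝ f) := hf.fderiv_right (by norm_cast)
    have h3 : ContDiff ℝ n (pointwiseApply (K := K) (E := E) (F := F)) :=
      ContinuousLinearMap.contDiff _
    have h4 : ContDiff ℝ n fun g : C(K, E) => pointwiseApply (superposition (fderiv ℝ f)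
        (h1.continuous_fderiv one_ne_zero) g) := h3.comp (ih h2)
    exact contDiff_succ_iff_hasFDerivAt.2 ⟨_, h4, fun g => hasFDerivAt_superposition h1 g⟩

/-- The superposition operator of a smooth map is smooth. -/
theorem contDiff_superposition {f : E → F} (hf : ContDiff ℝ ∞ f) :
    ContDiff ℝ ∞ (superposition (K := K) f hf.continuous) :=
  contDiff_infty.2 fun n => contDiff_nat_superposition n (hf.of_le (by exact_mod_cast le_top))

end Superposition

/-! ### The Volterra operator -/

section Volterra

open unitInterval

/-- The extension of a function on the unit interval which is constant outside. -/
noncomputable def unitExtend (g : C(I, ℝ)) : ℝ → ℝ := IccExtend zero_le_one g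

lemma continuous_unitExtend (g : C(I, ℝ)) : Continuous (unitExtend g) :=
  g.continuous.Icc_extend'

lemma unitExtend_coe (g : C(I, ℝ)) (t : I) : unitExtend g t = g t :=
  IccExtend_val zero_le_one g t

lemma unitExtend_of_mem (g : C(I, ℝ)) {t : ℝ} (ht : t ∈ Icc (0 : ℝ) 1) :
    unitExtend g t = g ⟨t, ht⟩ := unitExtend_coe g ⟨t, ht⟩

lemma norm_unitExtend_le (g : C(I, ℝ)) (t : ℝ) : ‖unitExtend g t‖ ≤ ‖g‖ := g.norm_coe_le_norm _

/-- Integration from `0`, on continuous functions on the unit interval. -/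
noncomputable def volterra : C(I, ℝ) →L[ℝ] C(I, ℝ) :=
  LinearMap.mkContinuous
    { toFun := fun g => ⟨fun t => ∫ s in (0 : ℝ)..t, unitExtend g s,
        (intervalIntegral.continuous_primitive
          (fun _ _ => (continuous_unitExtend g).intervalIntegrable _ _) 0).comp
            continuous_subtype_val⟩
      map_add' := fun g h => by
        ext t
        exact intervalIntegral.integral_add ((continuous_unitExtend g).intervalIntegrable _ _)
          ((continuous_unitExtend h).intervalIntegrable _ _)
      map_smul' := fun c g => by
        ext t
        exact intervalIntegral.integral_const_mul c _ } 1
    (fun g => by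
      refine (ContinuousMap.norm_le _ (by positivity)).2 fun t => ?_
      refine (intervalIntegral.norm_integral_le_of_norm_le_const
        (fun s _ => norm_unitExtend_le g s)).trans ?_
      rw [sub_zero, abs_of_nonneg t.2.1, one_mul]
      exact mul_le_of_le_one_right (norm_nonneg _) t.2.2)

lemma volterra_apply (g : C(I, ℝ)) (t : I) :
    volterra g t = ∫ s in (0 : ℝ)..t, unitExtend g s := rfl

lemma unitExtend_mul (g h : C(I, ℝ)) (s : ℝ) :
    unitExtend (g * h) s = unitExtend g s * unitExtend h s := rfl

lemma unitExtend_add (g h : C(I, ℝ)) (s : ℝ) :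
    unitExtend (g + h) s = unitExtend g s + unitExtend h s := rfl

/-- The equation N - V(gN) = h is a linear differential equation for V(gN) with initial value 0, so
an integrating factor solves it uniquely. -/
lemma volterra_bijective (g : C(I, ℝ)) :
    Function.Bijective (fun N : C(I, ℝ) => N - volterra (g * N)) := by
  set G := unitExtend g with hG
  have hGc : Continuous G := continuous_unitExtend g
  set A : ℝ → ℝ := fun t => ∫ s in (0 : ℝ)..t, G s with hA
  have hA' : ∀ t, HasDerivAt A (G t) t := fun t => (hGc.integral_hasStrictDerivAt 0 t).hasDerivAt
  have hAc : Continuous A := continuous_iff_continuousAt.2 fun t => (hA' t).continuousAt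
  constructor
  · intro N₁ N₂ h
    have h0 : (N₁ - N₂) = volterra (g * (N₁ - N₂)) := by
      rw [mul_sub, map_sub]
      have h : N₁ - volterra (g * N₁) = N₂ - volterra (g * N₂) := h
      linear_combination (exp := 1) h
    set N := N₁ - N₂
    set ν : ℝ → ℝ := fun t => ∫ s in (0 : ℝ)..t, unitExtend (g * N) s with hν
    have hν' : ∀ t, HasDerivAt ν (unitExtend (g * N) t) t := fun t =>
      ((continuous_unitExtend (g * N)).integral_hasStrictDerivAt 0 t).hasDerivAt
    have hνN : ∀ t (ht : t ∈ Icc (0 : ℝ) 1), ν t = N ⟨t, ht⟩ := by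
      intro t ht
      conv_rhs => rw [h0]
      rfl
    have hd : ∀ t ∈ Icc (0 : ℝ) 1,
        HasDerivAt (fun t => ν t * Real.exp (-A t)) 0 t := by
      intro t ht
      have := (hν' t).mul ((hA' t).neg.exp)
      refine this.congr_deriv ?_
      rw [unitExtend_mul, unitExtend_of_mem N ht, hνN t ht]
      ring
    have hconst := constant_of_has_deriv_right_zero (f := fun t => ν t * Real.exp (-A t))
      (a := 0) (b := 1) (fun t ht => (hd t ht).continuousAt.continuousWithinAt)
      (fun t ht => (hd t (Ico_subset_Icc_self ht)).hasDerivWithinAt)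
    have hN : N = 0 := by
      ext ⟨t, ht⟩
      have := hconst t ht
      simp only [hν, intervalIntegral.integral_same, zero_mul, mul_eq_zero,
        (Real.exp_pos _).ne', or_false] at this
      rw [← hνN t ht]
      exact this
    exact sub_eq_zero.1 hN
  · intro h
    set q : ℝ → ℝ := fun t => ∫ s in (0 : ℝ)..t, Real.exp (-A s) * (G s * unitExtend h s) with hq
    have hqc : Continuous fun s => Real.exp (-A s) * (G s * unitExtend h s) :=
      (Real.continuous_exp.comp hAc.neg).mul (hGc.mul (continuous_unitExtend h))
    have hq' : ∀ t, HasDerivAt q (Real.exp (-A t) * (G t * unitExtend h t)) t := fun t =>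
      (hqc.integral_hasStrictDerivAt 0 t).hasDerivAt
    have hQ' : ∀ t, HasDerivAt (fun t => Real.exp (A t) * q t)
        (G t * (Real.exp (A t) * q t) + G t * unitExtend h t) t := by
      intro t
      refine ((hA' t).exp.mul (hq' t)).congr_deriv ?_
      have : Real.exp (A t) * Real.exp (-A t) = 1 := by rw [← Real.exp_add]; simp
      linear_combination (G t * unitExtend h t) * this
    have hQc : Continuous fun t => Real.exp (A t) * q t :=
      continuous_iff_continuousAt.2 fun t => (hQ' t).continuousAt
    -- Variation of constants: Q = e^A q solves Q' = G (Q + h), Q(0) = 0, hence N = h + Q.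
    refine ⟨h + ⟨fun t : I => Real.exp (A t) * q t, hQc.comp continuous_subtype_val⟩, ?_⟩
    ext t
    simp only [ContinuousMap.sub_apply, ContinuousMap.add_apply, ContinuousMap.coe_mk,
      volterra_apply]
    have : ∫ s in (0 : ℝ)..t, unitExtend (g * (h + ⟨fun t : I => Real.exp (A t) * q t,
        hQc.comp continuous_subtype_val⟩)) s =
        ∫ s in (0 : ℝ)..t, (G s * (Real.exp (A s) * q s) + G s * unitExtend h s) := by
      refine intervalIntegral.integral_congr fun s hs => ?_
      rw [uIcc_of_le t.2.1] at hs
      have hs' : s ∈ Icc (0 : ℝ) 1 := ⟨hs.1, hs.2.trans t.2.2⟩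
      simp only [unitExtend_mul, unitExtend_add]
      rw [unitExtend_of_mem ⟨fun t : I => Real.exp (A t) * q t, _⟩ hs']
      simp only [ContinuousMap.coe_mk, ← hG]
      ring
    rw [this, intervalIntegral.integral_eq_sub_of_hasDerivAt (fun s _ => hQ' s)
      (((hGc.mul hQc).add (hGc.mul (continuous_unitExtend h))).intervalIntegrable _ _)]
    simp [hq]

end Volterra

/-! ### Smooth dependence on parameters for a scalar differential equation -/

section SmoothDependence

open unitInterval

variable {P : Type} [NormedAddCommGroup P] [NormedSpace ℝ P]

/-- The map which sends `(p, N)` to the curve `s ↦ (p, 0, N s)`. -/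
noncomputable def parameterCurve : P × C(I, ℝ) →L[ℝ] C(I, P × ℝ × ℝ) :=
  LinearMap.mkContinuous
    { toFun := fun q => ⟨fun s => (q.1, 0, q.2 s), by fun_prop⟩
      map_add' := fun _ _ => by ext <;> simp
      map_smul' := fun _ _ => by ext <;> simp } 1
    (fun q => by
      rw [one_mul]
      refine (ContinuousMap.norm_le _ (by positivity)).2 fun s => ?_
      simp only [LinearMap.coe_mk, AddHom.coe_mk, ContinuousMap.coe_mk, Prod.norm_mk, norm_zero]
      refine max_le (le_max_left _ _) (max_le (norm_nonneg _) ?_)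
      exact (q.2.norm_coe_le_norm s).trans (le_max_right _ _))

@[simp] lemma parameterCurve_apply (q : P × C(I, ℝ)) (s : I) :
    parameterCurve q s = (q.1, 0, q.2 s) := rfl

/-- The curve `s ↦ (0, s, 0)`. -/
noncomputable def timeCurve : C(I, P × ℝ × ℝ) := ⟨fun s => (0, s, 0), by fun_prop⟩

/-- The defect of `N` in the integral equation `N t = c + ∫₀ᵗ f (p, s, N s) ds`. -/
noncomputable def integralDefect (f : P × ℝ × ℝ → ℝ) (hf : Continuous f) (c : ℝ)
    (q : P × C(I, ℝ)) : C(I, ℝ) :=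
  q.2 - ContinuousMap.const I c - volterra (superposition f hf (parameterCurve q + timeCurve))

lemma contDiff_integralDefect {f : P × ℝ × ℝ → ℝ} (hf : ContDiff ℝ ∞ f) (c : ℝ) :
    ContDiff ℝ ∞ (integralDefect f hf.continuous c) := by
  have h1 : ContDiff ℝ ∞ fun q : P × C(I, ℝ) => parameterCurve q + timeCurve :=
    (ContinuousLinearMap.contDiff (parameterCurve (P := P))).add contDiff_const
  exact (contDiff_snd.sub contDiff_const).sub
    (volterra.contDiff.comp ((contDiff_superposition hf).comp h1))

/-- The partial derivative in N is N ↦ N - V(gN), with g the state derivative of f along the curve.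
It is bijective by `volterra_bijective`, hence an isomorphism by the open mapping theorem; this is
the hypothesis of the implicit function theorem. -/
lemma fderiv_integralDefect {f : P × ℝ × ℝ → ℝ} (hf : ContDiff ℝ ∞ f) (c : ℝ)
    (q : P × C(I, ℝ)) : (fderiv ℝ (integralDefect f hf.continuous c) q ∘L .inr ℝ P C(I, ℝ)).IsInvertible := by
  have hf1 : ContDiff ℝ 1 f := hf.of_le (by exact_mod_cast le_top)
  set g : C(I, ℝ) := ⟨fun s => fderiv ℝ f ((parameterCurve q + timeCurve : C(I, P × ℝ × ℝ)) s) (0, 0, 1), by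
    have := hf1.continuous_fderiv one_ne_zero
    fun_prop⟩
  have h1 : HasFDerivAt (fun q : P × C(I, ℝ) => parameterCurve q + timeCurve) parameterCurve q :=
    (ContinuousLinearMap.hasFDerivAt (parameterCurve (P := P))).add_const _
  have h2 := (hasFDerivAt_superposition hf1 (parameterCurve q + timeCurve)).comp q h1
  have h3 : HasFDerivAt (integralDefect f hf.continuous c) _ q :=
    (hasFDerivAt_snd.sub_const (ContinuousMap.const I c)).sub
      (volterra.hasFDerivAt.comp q h2)
  rw [h3.fderiv]
  have hfun : ∀ N : C(I, ℝ), ((ContinuousLinearMap.snd ℝ P C(I, ℝ) - volterra ∘L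
      ((pointwiseApply (superposition (fderiv ℝ f) (hf1.continuous_fderiv one_ne_zero)
        (parameterCurve q + timeCurve))) ∘L parameterCurve)) ∘L .inr ℝ P C(I, ℝ)) N =
      N - volterra (g * N) := by
    intro N
    simp only [ContinuousLinearMap.comp_apply, _root_.sub_apply,
      ContinuousLinearMap.inr_apply, ContinuousLinearMap.coe_snd']
    congr 2
    ext s
    simp only [pointwiseApply_apply, superposition_apply, parameterCurve_apply,
      ContinuousMap.mul_apply]
    have : ((0, 0, N s) : P × ℝ × ℝ) = N s • ((0, 0, 1) : P × ℝ × ℝ) := by simp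
    rw [this, map_smul, smul_eq_mul, mul_comm]
    rfl
  set Φ := (ContinuousLinearMap.snd ℝ P C(I, ℝ) - volterra ∘L
      ((pointwiseApply (superposition (fderiv ℝ f) (hf1.continuous_fderiv one_ne_zero)
        (parameterCurve q + timeCurve))) ∘L parameterCurve)) ∘L .inr ℝ P C(I, ℝ) with hΦ
  have hbij : Function.Bijective Φ := by
    have : (Φ : C(I, ℝ) → C(I, ℝ)) = fun N => N - volterra (g * N) := funext hfun
    rw [this]
    exact volterra_bijective g
  exact ⟨ContinuousLinearEquiv.ofBijective Φ (LinearMap.ker_eq_bot.2 hbij.1)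
    (LinearMap.range_eq_top.2 hbij.2), ContinuousLinearEquiv.coe_ofBijective _ _ _⟩

lemma hasDerivWithinAt_of_integralDefect_eq_zero {f : P × ℝ × ℝ → ℝ} (hf : Continuous f) {c : ℝ}
    {p : P} {N : C(I, ℝ)} (h : integralDefect f hf c (p, N) = 0) :
    unitExtend N 0 = c ∧ ∀ s ∈ Icc (0 : ℝ) 1,
      HasDerivWithinAt (unitExtend N) (f (p, s, unitExtend N s)) (Icc 0 1) s := by
  set g : C(I, ℝ) := superposition f hf (parameterCurve (p, N) + timeCurve) with hg
  have hN : N = ContinuousMap.const I c + volterra g := by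
    have h : N - ContinuousMap.const I c - volterra g = 0 := h
    rw [sub_sub, sub_eq_zero] at h
    exact h
  have hval : ∀ t ∈ Icc (0 : ℝ) 1, unitExtend N t = c + ∫ s in (0 : ℝ)..t, unitExtend g s := by
    intro t ht
    rw [unitExtend_of_mem N ht, hN]
    rfl
  refine ⟨by rw [hval 0 (by simp)]; simp, fun s hs => ?_⟩
  have h1 : HasDerivAt (fun t => c + ∫ s in (0 : ℝ)..t, unitExtend g s) (unitExtend g s) s :=
    ((continuous_unitExtend g).integral_hasStrictDerivAt 0 s).hasDerivAt.const_add c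
  refine (h1.hasDerivWithinAt.congr hval (hval s hs)).congr_deriv ?_
  rw [unitExtend_of_mem g hs, unitExtend_of_mem N hs, hg]
  simp [timeCurve]

lemma integralDefect_eq_zero {f : P × ℝ × ℝ → ℝ} (hf : Continuous f) {c : ℝ} {p : P}
    {n : ℝ → ℝ} (h0 : n 0 = c)
    (hn : ∀ s ∈ Icc (0 : ℝ) 1, HasDerivWithinAt n (f (p, s, n s)) (Icc 0 1) s)
    {N : C(I, ℝ)} (hN : ∀ t : I, N t = n t) : integralDefect f hf c (p, N) = 0 := by
  have hc : ContinuousOn n (Icc 0 1) := fun s hs => (hn s hs).continuousWithinAt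
  set g : C(I, ℝ) := superposition f hf (parameterCurve (p, N) + timeCurve) with hg
  have hgs : ∀ s (hs : s ∈ Icc (0 : ℝ) 1), unitExtend g s = f (p, s, n s) := by
    intro s hs
    rw [unitExtend_of_mem g hs, hg]
    simp [timeCurve, hN]
  ext t
  have hsub : Icc (0 : ℝ) t ⊆ Icc 0 1 := Icc_subset_Icc_right t.2.2
  have h1 : ∫ s in (0 : ℝ)..t, unitExtend g s = n t - n 0 := by
    refine intervalIntegral.integral_eq_sub_of_hasDeriv_right_of_le t.2.1 (hc.mono hsub) ?_
      ((continuous_unitExtend g).intervalIntegrable _ _)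
    intro s hs
    have hs1 : s ∈ Ioo (0 : ℝ) 1 := ⟨hs.1, hs.2.trans_le t.2.2⟩
    rw [hgs s (Ioo_subset_Icc_self hs1)]
    exact ((hn s (Ioo_subset_Icc_self hs1)).hasDerivAt (Icc_mem_nhds hs1.1 hs1.2)).hasDerivWithinAt
  change N t - c - ∫ s in (0 : ℝ)..t, unitExtend g s = 0
  rw [h1, hN, h0]
  ring

/-- A scalar differential equation on the unit interval whose right hand side depends smoothly on
time, state and a parameter, and is bounded and Lipschitz in the state, has solutions which depend
smoothly on the parameter. -/
theorem exists_smooth_solution [CompleteSpace P] {f : P × ℝ × ℝ → ℝ} (hf : ContDiff ℝ ∞ f) (c : ℝ)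
    (hb : ∀ p, ∃ C : NNReal, ∀ s ∈ Icc (0 : ℝ) 1, ∀ n, ‖f (p, s, n)‖ ≤ C)
    (hL : ∀ p, ∃ C : NNReal, ∀ s ∈ Icc (0 : ℝ) 1, LipschitzWith C (fun n => f (p, s, n))) :
    ∃ N : P → ℝ → ℝ, (∀ p, N p 0 = c) ∧
      (∀ p, ∀ s ∈ Icc (0 : ℝ) 1, HasDerivWithinAt (N p) (f (p, s, N p s)) (Icc 0 1) s) ∧
      ContDiff ℝ ∞ (fun p => N p 1) := by
  have hfc := hf.continuous
  -- The Picard–Lindelöf ball gets the bound C itself as radius: the time interval has length one,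
  -- so solutions cannot leave the ball.
  have hex : ∀ p, ∃ n : ℝ → ℝ, n 0 = c ∧
      ∀ s ∈ Icc (0 : ℝ) 1, HasDerivWithinAt n (f (p, s, n s)) (Icc 0 1) s := by
    intro p
    obtain ⟨C, hC⟩ := hb p
    obtain ⟨C', hC'⟩ := hL p
    have : IsPicardLindelof (fun s n => f (p, s, n)) (⟨0, by simp⟩ : Icc (0 : ℝ) 1) c C 0 C C' :=
      { lipschitzOnWith := fun s hs => (hC' s hs).lipschitzOnWith
        continuousOn := fun n _ => by fun_prop
        norm_le := fun s hs n _ => hC s hs n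
        mul_max_le := by simp }
    exact this.exists_eq_forall_mem_Icc_hasDerivWithinAt₀
  choose N hN0 hN using hex
  have hNc : ∀ p, Continuous fun t : I => N p t := fun p =>
    ContinuousOn.domRestrict fun s hs => (hN p s hs).continuousWithinAt
  refine ⟨N, hN0, hN, ?_⟩
  -- The whole solution is shown to be smooth in p as an element of C([0,1]); evaluation at 1 is
  -- linear.
  suffices h : ContDiff ℝ ∞ fun p => (⟨fun t : I => N p t, hNc p⟩ : C(I, ℝ)) from
    (ContinuousLinearMap.contDiff (ContinuousMap.evalCLM ℝ (1 : I) : C(I, ℝ) →L[ℝ] ℝ)).comp h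
  rw [contDiff_iff_contDiffAt]
  intro p
  have hinf : (∞ : WithTop ℕ∞) ≠ 0 := by simp
  have hcd := (contDiff_integralDefect hf c).contDiffAt
    (x := (p, (⟨fun t : I => N p t, hNc p⟩ : C(I, ℝ))))
  have hinv := fderiv_integralDefect hf c (p, (⟨fun t : I => N p t, hNc p⟩ : C(I, ℝ)))
  -- Near p the implicit function keeps the defect at its value 0, so it solves the differential
  -- equation and uniqueness identifies it with N.
  refine (hcd.contDiffAt_implicitFunction hinf hinv).congr_of_eventuallyEq ?_
  filter_upwards [hcd.eventually_apply_implicitFunction hinf hinv] with q hq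
  rw [integralDefect_eq_zero hfc (hN0 p) (hN p) fun t => rfl] at hq
  obtain ⟨h1, h2⟩ := hasDerivWithinAt_of_integralDefect_eq_zero hfc hq
  obtain ⟨C', hC'⟩ := hL q
  set ψ := hcd.implicitFunction hinf hinv q
  have huniq : EqOn (N q) (unitExtend ψ) (Icc 0 1) := by
    refine ODE_solution_unique_of_mem_Icc_right (v := fun s n => f (q, s, n)) (s := fun _ => univ)
      (K := C') (fun s hs => (hC' s (Ico_subset_Icc_self hs)).lipschitzOnWith)
      (fun s hs => (hN q s hs).continuousWithinAt) (fun s hs => ?_) (fun _ _ => trivial)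
      (fun s hs => (h2 s hs).continuousWithinAt) (fun s hs => ?_) (fun _ _ => trivial)
      (by rw [hN0, h1])
    · exact (hN q s (Ico_subset_Icc_self hs)).mono_of_mem_nhdsWithin (Icc_mem_nhdsGE_of_mem hs)
    · exact (h2 s (Ico_subset_Icc_self hs)).mono_of_mem_nhdsWithin (Icc_mem_nhdsGE_of_mem hs)
  ext t
  exact (huniq t.2).trans (unitExtend_coe ψ t)

end SmoothDependence

/-! ### Functions with bounded derivatives -/

section BddDerivs

variable {U E F G : Type*} [NormedAddCommGroup U] [NormedSpace ℝ U]
  [NormedAddCommGroup E] [NormedSpace ℝ E] [NormedAddCommGroup F] [NormedSpace ℝ F]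
  [NormedAddCommGroup G] [NormedSpace ℝ G] {S : Set U} {n : ℕ}

/-- The derivatives of `f` of order at most `n`, within `S`, are bounded on `T`. -/
def BddDerivs (n : ℕ) (f : U → E) (S T : Set U) : Prop :=
  ∀ j ≤ n, ∃ C, ∀ x ∈ T, ‖iteratedFDerivWithin ℝ j f S x‖ ≤ C

lemma BddDerivs.of_le {m : ℕ} {f : U → E} {T : Set U} (h : BddDerivs n f S T) (hm : m ≤ n) :
    BddDerivs m f S T := fun j hj => h j (hj.trans hm)

lemma BddDerivs.bound {f : U → E} {T : Set U} (h : BddDerivs n f S T) :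
    ∃ C, ∀ x ∈ T, ‖f x‖ ≤ C := by
  obtain ⟨C, hC⟩ := h 0 (Nat.zero_le _)
  exact ⟨C, fun x hx => by simpa using hC x hx⟩

lemma bddDerivs_zero {f : U → E} {T : Set U} :
    BddDerivs 0 f S T ↔ ∃ C, ∀ x ∈ T, ‖f x‖ ≤ C := by
  refine ⟨fun h => h.bound, fun ⟨C, hC⟩ j hj => ⟨C, fun x hx => ?_⟩⟩
  obtain rfl : j = 0 := by omega
  simpa using hC x hx

lemma norm_iteratedFDerivWithin_succ_of_isOpen (hS : IsOpen S) (f : U → E) (j : ℕ) {x : U}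
    (hx : x ∈ S) : ‖iteratedFDerivWithin ℝ (j + 1) f S x‖ =
      ‖iteratedFDerivWithin ℝ j (fderiv ℝ f) S x‖ := by
  rw [← norm_iteratedFDerivWithin_fderivWithin hS.uniqueDiffOn hx]
  congr 1
  exact iteratedFDerivWithin_congr (fun y hy => fderivWithin_of_isOpen hS hy) hx _

lemma bddDerivs_succ (hS : IsOpen S) {f : U → E} {T : Set U} (hT : T ⊆ S) :
    BddDerivs (n + 1) f S T ↔ BddDerivs 0 f S T ∧ BddDerivs n (fderiv ℝ f) S T := by
  constructor
  · refine fun h => ⟨h.of_le (Nat.zero_le _), fun j hj => ?_⟩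
    obtain ⟨C, hC⟩ := h (j + 1) (by omega)
    exact ⟨C, fun x hx => by
      rw [← norm_iteratedFDerivWithin_succ_of_isOpen hS f j (hT hx)]; exact hC x hx⟩
  · rintro ⟨h0, h1⟩ j hj
    rcases j with - | j
    · exact h0 0 le_rfl
    · obtain ⟨C, hC⟩ := h1 j (by omega)
      exact ⟨C, fun x hx => by
        rw [norm_iteratedFDerivWithin_succ_of_isOpen hS f j (hT hx)]; exact hC x hx⟩

lemma BddDerivs.congr {f g : U → E} {T : Set U} (h : BddDerivs n f S T) (hT : T ⊆ S)
    (hfg : EqOn g f S) : BddDerivs n g S T := fun j hj => by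
  obtain ⟨C, hC⟩ := h j hj
  exact ⟨C, fun x hx => by rw [iteratedFDerivWithin_congr hfg (hT hx)]; exact hC x hx⟩

/-- On open sets the derivatives within the set are the full ones, so those within S agree with
those within O, which are continuous on the compact K. -/
lemma bddDerivs_of_isCompact {f : U → E} {O K : Set U} (hO : IsOpen O) (hf : ContDiffOn ℝ ∞ f O)
    (hK : IsCompact K) (hKO : K ⊆ O) (hS : IsOpen S) (hSK : S ⊆ O) {T : Set U} (hTS : T ⊆ S)
    (hTK : T ⊆ K) : BddDerivs n f S T := fun j _ => by
  have hc : ContinuousOn (fun x => ‖iteratedFDerivWithin ℝ j f O x‖) K :=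
    ((hf.continuousOn_iteratedFDerivWithin (by exact_mod_cast le_top) hO.uniqueDiffOn).mono
      hKO).norm
  obtain ⟨C, hC⟩ := hK.bddAbove_image hc
  refine ⟨C, fun x hx => ?_⟩
  have h1 := iteratedFDerivWithin_of_isOpen (𝕜 := ℝ) (f := f) j hS (hTS hx)
  have h2 := iteratedFDerivWithin_of_isOpen (𝕜 := ℝ) (f := f) j hO (hSK (hTS hx))
  rw [h1, ← h2]
  exact hC ⟨x, hTK hx, rfl⟩

lemma BddDerivs.bilinear (hS : IsOpen S) (L : E →L[ℝ] F →L[ℝ] G) {f : U → E} {g : U → F}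
    (hf : ContDiffOn ℝ ∞ f S) (hg : ContDiffOn ℝ ∞ g S) {T : Set U} (hT : T ⊆ S)
    (bf : BddDerivs n f S T) (bg : BddDerivs n g S T) :
    BddDerivs n (fun x => L (f x) (g x)) S T := fun j hj => by
  choose! C hC using bf
  choose! D hD using bg
  refine ⟨‖L‖ * ∑ i ∈ Finset.range (j + 1), (j.choose i : ℝ) * C i * D (j - i), fun x hx => ?_⟩
  refine (L.norm_iteratedFDerivWithin_le_of_bilinear hf hg hS.uniqueDiffOn (hT hx)
    (n := j) (by exact_mod_cast le_top)).trans ?_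
  refine mul_le_mul_of_nonneg_left (Finset.sum_le_sum fun i hi => ?_) (norm_nonneg L)
  have hi' : i ≤ n := (Finset.mem_range_succ_iff.1 hi).trans hj
  have h1 := hC i hi' x hx
  have h2 := hD (j - i) (by omega) x hx
  have : 0 ≤ C i := (norm_nonneg _).trans h1
  gcongr

lemma BddDerivs.clm_comp (hS : IsOpen S) (L : E →L[ℝ] F) {f : U → E}
    (hf : ContDiffOn ℝ ∞ f S) {T : Set U} (hT : T ⊆ S) (bf : BddDerivs n f S T) :
    BddDerivs n (fun x => L (f x)) S T := fun j hj => by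
  obtain ⟨C, hC⟩ := bf j hj
  refine ⟨‖L‖ * C, fun x hx => ?_⟩
  exact (L.norm_iteratedFDerivWithin_comp_left ((hf.of_le (by exact_mod_cast le_top)) x (hT hx))
    hS.uniqueDiffOn (hT hx) le_rfl).trans
      (mul_le_mul_of_nonneg_left (hC x hx) (norm_nonneg _))

lemma BddDerivs.add (hS : IsOpen S) {f g : U → E} (hf : ContDiffOn ℝ ∞ f S)
    (hg : ContDiffOn ℝ ∞ g S) {T : Set U} (hT : T ⊆ S) (bf : BddDerivs n f S T)
    (bg : BddDerivs n g S T) : BddDerivs n (fun x => f x + g x) S T := fun j hj => by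
  obtain ⟨C, hC⟩ := bf j hj
  obtain ⟨D, hD⟩ := bg j hj
  refine ⟨C + D, fun x hx => ?_⟩
  have h1 : ContDiffWithinAt ℝ j f S x := (hf.of_le (by exact_mod_cast le_top)) x (hT hx)
  have h2 : ContDiffWithinAt ℝ j g S x := (hg.of_le (by exact_mod_cast le_top)) x (hT hx)
  have := iteratedFDerivWithin_add_apply h1 h2 hS.uniqueDiffOn (hT hx)
  change ‖iteratedFDerivWithin ℝ j (f + g) S x‖ ≤ _
  rw [this]
  exact (norm_add_le _ _).trans (add_le_add (hC x hx) (hD x hx))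

lemma BddDerivs.neg (hS : IsOpen S) {f : U → E} {T : Set U} (hT : T ⊆ S)
    (bf : BddDerivs n f S T) : BddDerivs n (fun x => -f x) S T := fun j hj => by
  obtain ⟨C, hC⟩ := bf j hj
  refine ⟨C, fun x hx => ?_⟩
  have := iteratedFDerivWithin_neg_apply (𝕜 := ℝ) (i := j) (f := f) hS.uniqueDiffOn (hT hx)
  change ‖iteratedFDerivWithin ℝ j (-f) S x‖ ≤ _
  rw [this, norm_neg]
  exact hC x hx

lemma BddDerivs.prodMk (hS : IsOpen S) {f : U → E} {g : U → F} (hf : ContDiffOn ℝ ∞ f S)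
    (hg : ContDiffOn ℝ ∞ g S) {T : Set U} (hT : T ⊆ S) (bf : BddDerivs n f S T)
    (bg : BddDerivs n g S T) : BddDerivs n (fun x => (f x, g x)) S T := by
  have h1 := BddDerivs.clm_comp hS (.inl ℝ E F) hf hT bf
  have h2 := BddDerivs.clm_comp hS (.inr ℝ E F) hg hT bg
  have h3 : ContDiffOn ℝ ∞ (fun x => ContinuousLinearMap.inl ℝ E F (f x)) S :=
    (ContinuousLinearMap.contDiff _).comp_contDiffOn hf
  have h4 : ContDiffOn ℝ ∞ (fun x => ContinuousLinearMap.inr ℝ E F (g x)) S :=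
    (ContinuousLinearMap.contDiff _).comp_contDiffOn hg
  refine (BddDerivs.add hS h3 h4 hT h1 h2).congr hT fun x _ => ?_
  simp

lemma BddDerivs.comp (hS : IsOpen S) {f : U → E} {g : E → F} {O K : Set E} (hO : IsOpen O)
    (hK : IsCompact K) (hKO : K ⊆ O) (hg : ContDiffOn ℝ ∞ g O) (hf : ContDiffOn ℝ ∞ f S)
    (hfO : MapsTo f S O) {T : Set U} (hT : T ⊆ S) (hfK : MapsTo f T K)
    (bf : BddDerivs n f S T) : BddDerivs n (fun x => g (f x)) S T := by
  have bg : BddDerivs n g O K := bddDerivs_of_isCompact hO hg hK hKO hO subset_rfl hKO subset_rfl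
  choose! C hC using bf
  choose! D hD using bg
  intro j hj
  -- One constant C' ≥ 1 for all orders, so that C' ≤ C'^i for i ≥ 1; the bound for iterated
  -- derivatives of a composition asks for this geometric form.
  set C' := 1 + ∑ i ∈ Finset.range (n + 1), |C i| with hC'
  set D' := ∑ i ∈ Finset.range (n + 1), |D i| with hD'
  have hC1 : ∀ i ≤ n, |C i| ≤ C' := fun i hi => by
    have := Finset.single_le_sum (f := fun i => |C i|) (fun i _ => abs_nonneg _)
      (Finset.mem_range_succ_iff.2 hi)
    simp only [hC']
    linarith
  have hC0 : 1 ≤ C' := by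
    have : 0 ≤ ∑ i ∈ Finset.range (n + 1), |C i| := Finset.sum_nonneg fun i _ => abs_nonneg _
    linarith
  refine ⟨j.factorial * D' * C' ^ j, fun x hx => ?_⟩
  refine norm_iteratedFDerivWithin_comp_le hg hf (n := j) (by exact_mod_cast le_top)
    hO.uniqueDiffOn hS.uniqueDiffOn hfO (hT hx) (fun i hi => ?_) fun i hi hij => ?_
  · exact ((hD i (hi.trans hj) (f x) (hfK hx)).trans (le_abs_self _)).trans
      (Finset.single_le_sum (f := fun i => |D i|) (fun i _ => abs_nonneg _)
        (Finset.mem_range_succ_iff.2 (hi.trans hj)))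
  · refine ((hC i (hij.trans hj) x hx).trans (le_abs_self _)).trans
      ((hC1 i (hij.trans hj)).trans ?_)
    exact le_self_pow₀ hC0 (by omega)

end BddDerivs

/-! ### Extension to the closure -/

section Extension

variable {U : Type} [NormedAddCommGroup U] [NormedSpace ℝ U] {S : Set U}

/-- A bounded derivative on a convex set gives a Lipschitz, hence uniformly continuous function,
which sends the Cauchy filter at a boundary point to a Cauchy filter. -/
lemma exists_tendsto_of_bddDerivs {E : Type*} [NormedAddCommGroup E] [NormedSpace ℝ E]
    [CompleteSpace E] (hS : IsOpen S) (hconv : Convex ℝ S) {f : U → E}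
    (hf : ContDiffOn ℝ ∞ f S) (bf : BddDerivs 1 f S S) {x : U} (hx : x ∈ closure S) :
    ∃ y, Tendsto f (𝓝[S] x) (𝓝 y) := by
  obtain ⟨C, hC⟩ := ((bddDerivs_succ (n := 0) hS subset_rfl).1 bf).2.bound
  have hlip : LipschitzOnWith C.toNNReal f S :=
    hconv.lipschitzOnWith_of_nnnorm_fderiv_le
      (fun y hy => ((hf.contDiffAt (hS.mem_nhds hy)).differentiableAt (by simp)))
      (fun y hy => by
        rw [← NNReal.coe_le_coe, coe_nnnorm]
        exact (hC y hy).trans (Real.le_coe_toNNReal C))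
  have := mem_closure_iff_nhdsWithin_neBot.1 hx
  have hcauchy : Cauchy (𝓝[S] x) := cauchy_nhds.mono nhdsWithin_le_nhds
  refine cauchy_map_iff_exists_tendsto.1 (cauchy_map_iff.2 ⟨this, ?_⟩)
  refine Tendsto.mono_left hlip.uniformContinuousOn (le_inf hcauchy.2 (le_principal_iff.2 ?_))
  exact prod_mem_prod self_mem_nhdsWithin self_mem_nhdsWithin

lemma extendFrom_eqOn {X Y : Type*} [TopologicalSpace X] [TopologicalSpace Y] [T2Space Y]
    {f : X → Y} {S : Set X} (hf : ContinuousOn f S) :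
    EqOn (extendFrom S f) f S := fun x hx =>
  extendFrom_eq (subset_closure hx) (hf x hx)

/-- A smooth function on an open convex set whose derivatives up to order `n + 1` are bounded
extends to a `C^n` function on the closure. -/
theorem contDiffOn_extendFrom (hS : IsOpen S) (hconv : Convex ℝ S) (n : ℕ) :
    ∀ {E : Type} [NormedAddCommGroup E] [NormedSpace ℝ E] [CompleteSpace E] {f : U → E},
      ContDiffOn ℝ ∞ f S → BddDerivs (n + 1) f S S →
      ContDiffOn ℝ n (extendFrom S f) (closure S) := by
  induction n with
  | zero =>
    intro E _ _ _ f hf bf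
    exact contDiffOn_zero.2 (continuousOn_extendFrom subset_rfl
      fun x hx => exists_tendsto_of_bddDerivs hS hconv hf bf hx)
  | succ n ih =>
    intro E _ _ _ f hf bf
    have hcl : ContinuousOn (extendFrom S f) (closure S) :=
      continuousOn_extendFrom subset_rfl fun x hx =>
        exists_tendsto_of_bddDerivs hS hconv hf (bf.of_le (by omega)) hx
    have bf' := ((bddDerivs_succ (n := n + 1) hS subset_rfl).1 bf).2
    have hf' : ContDiffOn ℝ ∞ (fderiv ℝ f) S := hf.fderiv_of_isOpen hS (by simp)
    have heq := extendFrom_eqOn hf.continuousOn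
    -- The derivative of the extension at a boundary point is the limit of the derivatives from
    -- inside. That limit exists by the bound of one order more, which explains the loss of one
    -- derivative.
    have key : ∀ x ∈ closure S, HasFDerivWithinAt (extendFrom S f)
        (extendFrom S (fderiv ℝ f) x) (closure S) x := by
      intro x hx
      refine hasFDerivWithinAt_closure_of_tendsto_fderiv ?_ hconv hS
        (fun y hy => (hcl y hy).mono subset_closure) ?_
      · exact (hf.differentiableOn (by simp)).congr heq
      · refine (tendsto_extendFrom (exists_tendsto_of_bddDerivs hS hconv hf'
          (bf'.of_le (by omega)) hx)).congr' ?_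
        filter_upwards [self_mem_nhdsWithin] with y hy
        exact ((heq.eventuallyEq_of_mem (hS.mem_nhds hy)).fderiv_eq).symm
    have h2 := ih hf' bf'
    rw [Nat.cast_add, Nat.cast_one, contDiffOn_succ_iff_hasFDerivWithinAt (by simp)]
    intro x hx
    refine ⟨closure S, by rw [insert_eq_of_mem hx]; exact self_mem_nhdsWithin, by simp, _, key, h2⟩

end Extension

/-! ### Transport equations -/

section Transport

/-- A continuous function on an interval has a primitive. -/
lemma exists_primitive {c : ℝ → ℝ} {s t : ℝ} (hst : s ≤ t) (hc : ContinuousOn c (Icc s t)) :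
    ∃ A : ℝ → ℝ, A s = 0 ∧ Continuous A ∧ ∀ x ∈ Icc s t, HasDerivAt A (IccExtend hst
      (domRestrict (Icc s t) c) x) x ∧ IccExtend hst (domRestrict (Icc s t) c) x = c x := by
  have h : Continuous (IccExtend hst (domRestrict (Icc s t) c)) := hc.domRestrict.Icc_extend'
  have hd := fun x => (h.integral_hasStrictDerivAt s x).hasDerivAt
  exact ⟨fun x => ∫ y in s..x, IccExtend hst (domRestrict (Icc s t) c) y, by simp,
    continuous_iff_continuousAt.2 fun x => (hd x).continuousAt,
    fun x hx => ⟨hd x, by rw [IccExtend_of_mem hst _ hx]; rfl⟩⟩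

variable {U : Type} [NormedAddCommGroup U] [NormedSpace ℝ U] {S K : Set U} {Y : U → U}

/-- Every point of `S` is reached, within `S`, from a point of `K` along a curve which is up to
parametrization an integral curve of `Y`. -/
def ReachedFrom (Y : U → U) (S K : Set U) : Prop :=
  ∀ u ∈ S, ∃ (τ : ℝ) (c : ℝ → U) (κ : ℝ → ℝ), 0 ≤ τ ∧ c τ = u ∧ c 0 ∈ K ∧
    ContinuousOn κ (Icc 0 τ) ∧ ∀ t ∈ Icc 0 τ, c t ∈ S ∧ 0 < κ t ∧
      HasDerivWithinAt c (κ t • Y (c t)) (Icc 0 τ) t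

variable {E : Type} [NormedAddCommGroup E] [NormedSpace ℝ E]

/-- Along a curve from K the norm of v cannot cross a large level R: half of the damping β absorbs
Λ, the other half dominates s. The factor e^A with A' = κ β removes β from the comparison. -/
lemma bounded_of_transport (hS : IsOpen S) (hreach : ReachedFrom Y S K) {β₀ q C₀ C₁ : ℝ}
    (hβ₀ : 0 < β₀) (hq : q ≤ β₀ / 2) {v : U → E} {β : U → ℝ} {Λ : U → E →L[ℝ] E} {s : U → E}
    (hv : DifferentiableOn ℝ v S) (hβc : ContinuousOn β S)
    (heq : ∀ u ∈ S, fderiv ℝ v u (Y u) = -(β u • v u) + Λ u (v u) + s u)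
    (hβ : ∀ u ∈ S, β₀ ≤ β u) (hΛ : ∀ u ∈ S, ‖Λ u‖ ≤ q) (hs : ∀ u ∈ S, ‖s u‖ ≤ C₁)
    (hvK : ∀ u ∈ K, ‖v u‖ ≤ C₀) : ∃ C, ∀ u ∈ S, ‖v u‖ ≤ C := by
  -- R exceeds the bound on K, and β₀/2 · R > C₁.
  set R := max (max C₀ 0) (2 * C₁ / β₀ + 1) with hR
  have hR0 : 0 ≤ R := (le_max_right _ _).trans (le_max_left _ _)
  have hR1 : C₁ < β₀ / 2 * R := by
    have : 2 * C₁ / β₀ < R := (lt_add_one _).trans_le (le_max_right _ _)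
    rw [div_lt_iff₀ hβ₀] at this
    linarith
  refine ⟨R, fun u hu => ?_⟩
  obtain ⟨τ, c, κ, hτ, rfl, hc0, hκ, hc⟩ := hreach u hu
  have hcc : ContinuousOn c (Icc 0 τ) := fun t ht => (hc t ht).2.2.continuousWithinAt
  have hκβ : ContinuousOn (fun t => κ t * β (c t)) (Icc 0 τ) :=
    hκ.mul (hβc.comp hcc fun t ht => (hc t ht).1)
  obtain ⟨A, hA0, hAc, hA⟩ := exists_primitive hτ hκβ
  have hA' : ∀ t ∈ Icc 0 τ, HasDerivAt A (κ t * β (c t)) t := fun t ht => by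
    have := (hA t ht).1
    rwa [(hA t ht).2] at this
  have hφ : ∀ t ∈ Icc 0 τ, HasDerivWithinAt (fun t => v (c t))
      (κ t • (-(β (c t) • v (c t)) + Λ (c t) (v (c t)) + s (c t))) (Icc 0 τ) t := by
    intro t ht
    have h1 := ((hv _ (hc t ht).1).differentiableAt (hS.mem_nhds (hc t ht).1)).hasFDerivAt
    have h2 := h1.comp_hasDerivWithinAt t (hc t ht).2.2
    rwa [map_smul, heq _ (hc t ht).1] at h2
  have hψ : ∀ t ∈ Icc 0 τ, HasDerivWithinAt (fun t => Real.exp (A t) • v (c t))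
      ((Real.exp (A t) * κ t) • (Λ (c t) (v (c t)) + s (c t))) (Icc 0 τ) t := by
    intro t ht
    refine ((hA' t ht).exp.hasDerivWithinAt.smul (hφ t ht)).congr_deriv ?_
    module
  have key := image_norm_le_of_norm_deriv_right_lt_deriv_boundary' (a := 0) (b := τ)
    (f := fun t => Real.exp (A t) • v (c t)) (B := fun t => Real.exp (A t) * R)
    (B' := fun t => Real.exp (A t) * (κ t * β (c t)) * R)
    (fun t ht => (hψ t ht).continuousWithinAt)
    (fun t ht => (hψ t (Ico_subset_Icc_self ht)).mono_of_mem_nhdsWithin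
      (Icc_mem_nhdsGE_of_mem ht)) ?_ ?_ ?_ ?_ (right_mem_Icc.2 hτ)
  · simp only [norm_smul, Real.norm_eq_abs, Real.abs_exp] at key
    exact le_of_mul_le_mul_left key (Real.exp_pos _)
  · simp only [hA0, Real.exp_zero, one_smul, one_mul]
    exact (hvK _ hc0).trans ((le_max_left _ _).trans (le_max_left _ _))
  · exact (Real.continuous_exp.comp hAc).continuousOn.mul continuousOn_const
  · intro t ht
    exact ((hA' t (Ico_subset_Icc_self ht)).exp.mul_const R).hasDerivWithinAt
  · intro t ht h
    have ht' := Ico_subset_Icc_self ht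
    obtain ⟨htS, hκt, -⟩ := hc t ht'
    simp only [norm_smul, Real.norm_eq_abs, Real.abs_exp, mul_eq_mul_left_iff,
      (Real.exp_pos _).ne', or_false, abs_mul, abs_of_pos hκt] at h ⊢
    have h1 : ‖Λ (c t) (v (c t)) + s (c t)‖ < β (c t) * R := by
      calc ‖Λ (c t) (v (c t)) + s (c t)‖ ≤ ‖Λ (c t)‖ * ‖v (c t)‖ + ‖s (c t)‖ :=
            (norm_add_le _ _).trans (add_le_add ((Λ (c t)).le_opNorm _) le_rfl)
        _ ≤ β₀ / 2 * R + C₁ := by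
            rw [h]
            exact add_le_add (mul_le_mul_of_nonneg_right ((hΛ _ htS).trans hq) hR0) (hs _ htS)
        _ < β₀ * R := by linarith
        _ ≤ β (c t) * R := mul_le_mul_of_nonneg_right (hβ _ htS) hR0
    calc Real.exp (A t) * κ t * ‖Λ (c t) (v (c t)) + s (c t)‖
        < Real.exp (A t) * κ t * (β (c t) * R) :=
          mul_lt_mul_of_pos_left h1 (mul_pos (Real.exp_pos _) hκt)
      _ = Real.exp (A t) * (κ t * β (c t)) * R := by ring

end Transport

/-! ### Bounds on derivatives of solutions of transport equations. -/

section TransportDerivatives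

variable {U : Type} [NormedAddCommGroup U] [NormedSpace ℝ U] {S K : Set U} {Y : U → U}

lemma contDiffOn_bilinear {E F G : Type*} [NormedAddCommGroup E] [NormedSpace ℝ E]
    [NormedAddCommGroup F] [NormedSpace ℝ F] [NormedAddCommGroup G] [NormedSpace ℝ G]
    (L : E →L[ℝ] F →L[ℝ] G) {f : U → E} {g : U → F} (hf : ContDiffOn ℝ ∞ f S)
    (hg : ContDiffOn ℝ ∞ g S) : ContDiffOn ℝ ∞ (fun x => L (f x) (g x)) S := by
  have h1 : ContDiffOn ℝ ∞ (fun x => L (f x)) S :=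
    (ContinuousLinearMap.contDiff L).comp_contDiffOn hf
  exact h1.clm_apply hg

/-- The map `(A, v) ↦ (h ↦ A h v)`. -/
noncomputable def flipBilinear (U E : Type) [NormedAddCommGroup U] [NormedSpace ℝ U]
    [NormedAddCommGroup E] [NormedSpace ℝ E] :
    (U →L[ℝ] E →L[ℝ] E) →L[ℝ] (E →L[ℝ] U →L[ℝ] E) :=
  (ContinuousLinearMap.flipₗᵢ ℝ U E E).toContinuousLinearEquiv

lemma flipBilinear_apply {E : Type} [NormedAddCommGroup E] [NormedSpace ℝ E]
    (A : U →L[ℝ] E →L[ℝ] E) (v : E) (h : U) : flipBilinear U E A v h = A h v := rfl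

/-- The commutator term in the equation for the derivative of a solution of a transport equation
along `Y`, and the zeroth order term of the original equation. -/
noncomputable def derivativeCoefficient {E : Type} [NormedAddCommGroup E] [NormedSpace ℝ E]
    (Y : U → U) (Λ : U → E →L[ℝ] E) (u : U) : (U →L[ℝ] E) →L[ℝ] (U →L[ℝ] E) :=
  ContinuousLinearMap.compL ℝ U E E (Λ u) +
    -(ContinuousLinearMap.compL ℝ U U E).flip (fderiv ℝ Y u)

lemma norm_derivativeCoefficient_le {E : Type} [NormedAddCommGroup E] [NormedSpace ℝ E]
    {Λ : U → E →L[ℝ] E} {u : U} {q q₁ : ℝ} (hΛ : ‖Λ u‖ ≤ q) (hY : ‖fderiv ℝ Y u‖ ≤ q₁) :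
    ‖derivativeCoefficient Y Λ u‖ ≤ q + q₁ := by
  have hq : 0 ≤ q := (norm_nonneg _).trans hΛ
  have hq₁ : 0 ≤ q₁ := (norm_nonneg _).trans hY
  refine ContinuousLinearMap.opNorm_le_bound _ (by positivity) fun w => ?_
  have h1 : derivativeCoefficient Y Λ u w = Λ u ∘L w + -(w ∘L fderiv ℝ Y u) := rfl
  have h2 : ‖Λ u ∘L w‖ ≤ q * ‖w‖ := (ContinuousLinearMap.opNorm_comp_le _ _).trans
    (mul_le_mul_of_nonneg_right hΛ (norm_nonneg _))
  have h3 : ‖w ∘L fderiv ℝ Y u‖ ≤ q₁ * ‖w‖ := by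
    rw [mul_comm]
    exact (ContinuousLinearMap.opNorm_comp_le _ _).trans
      (mul_le_mul_of_nonneg_left hY (norm_nonneg _))
  rw [h1, add_mul]
  exact (norm_add_le _ _).trans (add_le_add h2 ((norm_neg _).trans_le h3))

/-- The inhomogeneity in the equation for the derivative of a solution of a transport equation. -/
noncomputable def derivativeSource {E : Type} [NormedAddCommGroup E] [NormedSpace ℝ E]
    (v : U → E) (β : U → ℝ) (Λ : U → E →L[ℝ] E) (s : U → E) (u : U) : U →L[ℝ] E :=
  -ContinuousLinearMap.smulRightL ℝ U E (fderiv ℝ β u) (v u) +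
    flipBilinear U E (fderiv ℝ Λ u) (v u) + fderiv ℝ s u

/-- By symmetry of the second derivative, the differentiated equation is again a transport equation
along Y. Its new zeroth order term is the commutator -w ∘ DY, and its source contains v but no
derivative of v. -/
lemma fderiv_transport {E : Type} [NormedAddCommGroup E] [NormedSpace ℝ E] (hS : IsOpen S)
    (hY : ContDiffOn ℝ ∞ Y S) {v : U → E} {β : U → ℝ} {Λ : U → E →L[ℝ] E} {s : U → E}
    (hv : ContDiffOn ℝ ∞ v S) (hβ : ContDiffOn ℝ ∞ β S) (hΛ : ContDiffOn ℝ ∞ Λ S)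
    (hs : ContDiffOn ℝ ∞ s S)
    (heq : ∀ u ∈ S, fderiv ℝ v u (Y u) = -(β u • v u) + Λ u (v u) + s u) {u : U} (hu : u ∈ S) :
    fderiv ℝ (fderiv ℝ v) u (Y u) = -(β u • fderiv ℝ v u) +
      derivativeCoefficient Y Λ u (fderiv ℝ v u) + derivativeSource v β Λ s u := by
  have hn := hS.mem_nhds hu
  have hd : ∀ {F : Type} [NormedAddCommGroup F] [NormedSpace ℝ F] {f : U → F},
      ContDiffOn ℝ ∞ f S → HasFDerivAt f (fderiv ℝ f u) u := fun hf =>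
    ((hf.contDiffAt hn).differentiableAt (by simp)).hasFDerivAt
  have hv' : ContDiffOn ℝ ∞ (fderiv ℝ v) S := hv.fderiv_of_isOpen hS (by simp)
  have h1 := (hd hv').clm_apply (hd hY)
  have h2 := (((hd hβ).smul (hd hv)).neg.add ((hd hΛ).clm_apply (hd hv))).add (hd hs)
  have h3 := h1.unique (h2.congr_of_eventuallyEq (by
    filter_upwards [hn] with x hx using heq x hx))
  have hsymm : IsSymmSndFDerivAt ℝ v u := (hv.contDiffAt hn).isSymmSndFDerivAt (by
    simp only [minSmoothness_of_isRCLikeNormedField]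
    exact WithTop.coe_le_coe.2 (le_top : (2 : ℕ∞) ≤ ⊤))
  ext h
  have h4 := DFunLike.congr_fun h3 h
  simp only [_root_.add_apply, _root_.neg_apply, ContinuousLinearMap.comp_apply,
    ContinuousLinearMap.flip_apply, _root_.smul_apply,
    ContinuousLinearMap.smulRight_apply] at h4
  simp only [derivativeCoefficient, derivativeSource, _root_.add_apply, _root_.neg_apply,
    ContinuousLinearMap.comp_apply, ContinuousLinearMap.compL_apply,
    ContinuousLinearMap.flip_apply, _root_.smul_apply, ContinuousLinearMap.smulRightL_apply_apply,
    ContinuousLinearMap.smulRight_apply, flipBilinear_apply]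
  rw [hsymm (Y u) h, eq_sub_of_add_eq' h4]
  abel

set_option maxHeartbeats 1000000 in
/-- Bounds on the derivatives of solutions of a dissipative transport equation. -/
theorem bddDerivs_of_transport (hS : IsOpen S) (hK : K ⊆ S) (hreach : ReachedFrom Y S K)
    (hY : ContDiffOn ℝ ∞ Y S) {β₀ q₁ : ℝ} (hβ₀ : 0 < β₀) (hq₁ : 0 ≤ q₁)
    (hYq : ∀ u ∈ S, ‖fderiv ℝ Y u‖ ≤ q₁) {β : U → ℝ} (hβ : ContDiffOn ℝ ∞ β S)
    (hβ' : ∀ u ∈ S, β₀ ≤ β u) (n : ℕ) :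
    ∀ {E : Type} [NormedAddCommGroup E] [NormedSpace ℝ E] {q : ℝ} {v : U → E} {Λ : U → E →L[ℝ] E}
      {s : U → E}, q + n * q₁ ≤ β₀ / 2 → BddDerivs n (fderiv ℝ Y) S S → BddDerivs n β S S →
      ContDiffOn ℝ ∞ v S → ContDiffOn ℝ ∞ Λ S → ContDiffOn ℝ ∞ s S →
      (∀ u ∈ S, fderiv ℝ v u (Y u) = -(β u • v u) + Λ u (v u) + s u) →
      (∀ u ∈ S, ‖Λ u‖ ≤ q) → BddDerivs n Λ S S → BddDerivs n s S S → BddDerivs n v S K →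
      BddDerivs n v S S := by
  induction n with
  | zero =>
    intro E _ _ q v Λ s hq bY bβ hv hΛ hs heq hΛq bΛ bs bv
    obtain ⟨C₁, hC₁⟩ := bs.bound
    obtain ⟨C₀, hC₀⟩ := bv.bound
    exact bddDerivs_zero.2 (bounded_of_transport hS hreach hβ₀ (by simpa using hq)
      (hv.differentiableOn (by simp)) hβ.continuousOn heq hβ' hΛq hC₁ hC₀)
  | succ n ih =>
    intro E _ _ q v Λ s hq bY bβ hv hΛ hs heq hΛq bΛ bs bv
    have hn : n ≤ n + 1 := n.le_succ
    have hq' : q + q₁ + n * q₁ ≤ β₀ / 2 := by push_cast at hq; linarith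
    -- The source of the equation for Dv contains v, so v is bounded to order n first.
    have h1 : BddDerivs n v S S := ih (by linarith) (bY.of_le hn) (bβ.of_le hn) hv hΛ hs heq hΛq
      (bΛ.of_le hn) (bs.of_le hn) (bv.of_le hn)
    have hY' : ContDiffOn ℝ ∞ (fderiv ℝ Y) S := hY.fderiv_of_isOpen hS (by simp)
    have hv' : ContDiffOn ℝ ∞ (fderiv ℝ v) S := hv.fderiv_of_isOpen hS (by simp)
    have hβ1 : ContDiffOn ℝ ∞ (fderiv ℝ β) S := hβ.fderiv_of_isOpen hS (by simp)
    have hΛ1 : ContDiffOn ℝ ∞ (fderiv ℝ Λ) S := hΛ.fderiv_of_isOpen hS (by simp)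
    have hs1 : ContDiffOn ℝ ∞ (fderiv ℝ s) S := hs.fderiv_of_isOpen hS (by simp)
    have bβ1 := ((bddDerivs_succ hS subset_rfl).1 bβ).2
    have bΛ1 := ((bddDerivs_succ hS subset_rfl).1 bΛ).2
    have bs1 := ((bddDerivs_succ hS subset_rfl).1 bs).2
    refine (bddDerivs_succ hS subset_rfl).2 ⟨h1.of_le (Nat.zero_le _), ?_⟩
    have c1 : ContDiffOn ℝ ∞ (fun u => ContinuousLinearMap.compL ℝ U E E (Λ u)) S :=
      (ContinuousLinearMap.contDiff _).comp_contDiffOn hΛ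
    have c2 : ContDiffOn ℝ ∞
        (fun u => (ContinuousLinearMap.compL ℝ U U E).flip (fderiv ℝ Y u)) S :=
      (ContinuousLinearMap.contDiff _).comp_contDiffOn hY'
    have c3 := contDiffOn_bilinear (ContinuousLinearMap.smulRightL ℝ U E) (f := fderiv ℝ β)
      (g := v) hβ1 hv
    have c4 := contDiffOn_bilinear (flipBilinear U E) (f := fderiv ℝ Λ) (g := v) hΛ1 hv
    -- Each differentiation enlarges the bound of the zeroth order term by q₁; the budget q + (n +
    -- 1) q₁ is split as (q + q₁) + n q₁.
    refine ih (q := q + q₁) (Λ := derivativeCoefficient Y Λ) (s := derivativeSource v β Λ s)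
      hq' (bY.of_le hn) (bβ.of_le hn) hv' (c1.add c2.neg) ((c3.neg.add c4).add hs1)
      (fun u hu => fderiv_transport hS hY hv hβ hΛ hs heq hu) (fun u hu => ?_) ?_ ?_
      ((bddDerivs_succ hS hK).1 bv).2
    · exact norm_derivativeCoefficient_le (hΛq u hu) (hYq u hu)
    · exact BddDerivs.add hS c1 c2.neg subset_rfl
        (BddDerivs.clm_comp hS _ hΛ subset_rfl (bΛ.of_le hn))
        (BddDerivs.neg hS subset_rfl (BddDerivs.clm_comp hS _ hY' subset_rfl (bY.of_le hn)))
    · have b3 := BddDerivs.neg hS subset_rfl (BddDerivs.bilinear hS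
        (ContinuousLinearMap.smulRightL ℝ U E) (f := fderiv ℝ β) (g := v) hβ1 hv subset_rfl bβ1 h1)
      have b4 := BddDerivs.bilinear hS (flipBilinear U E) (f := fderiv ℝ Λ) (g := v) hΛ1 hv
        subset_rfl bΛ1 h1
      exact BddDerivs.add hS (c3.neg.add c4) hs1 subset_rfl
        (BddDerivs.add hS c3.neg c4 subset_rfl b3 b4) bs1

/-- A bounded solution of a nonlinear dissipative transport equation `Dm · Y = H (u, m)` has bounded
derivatives. -/
theorem bddDerivs_of_semilinear (hS : IsOpen S) (hK : K ⊆ S) (hreach : ReachedFrom Y S K)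
    (hY : ContDiffOn ℝ ∞ Y S) {β₀ q₁ : ℝ} (hβ₀ : 0 < β₀) (hq₁ : 0 ≤ q₁)
    (hYq : ∀ u ∈ S, ‖fderiv ℝ Y u‖ ≤ q₁) {m : U → ℝ} (hm : ContDiffOn ℝ ∞ m S)
    {H : U × ℝ → ℝ} {O C : Set (U × ℝ)} (hO : IsOpen O) (hC : IsCompact C) (hCO : C ⊆ O)
    (hH : ContDiffOn ℝ ∞ H O) (hmC : ∀ u ∈ S, (u, m u) ∈ C)
    (heq : ∀ u ∈ S, fderiv ℝ m u (Y u) = H (u, m u))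
    (hβ : ∀ u ∈ S, fderiv ℝ H (u, m u) (0, 1) ≤ -β₀)
    {N : ℕ} (hN : (N + 1) * q₁ ≤ β₀ / 2) (bY : BddDerivs N (fderiv ℝ Y) S S)
    (bid : BddDerivs N (id : U → U) S S) (bmK : BddDerivs (N + 1) m S K) :
    BddDerivs (N + 1) m S S := by
  have hH' : ContDiffOn ℝ ∞ (fderiv ℝ H) O := hH.fderiv_of_isOpen hO (by simp)
  have hmO : MapsTo (fun u => (u, m u)) S O := fun u hu => hCO (hmC u hu)
  have hgr : ContDiffOn ℝ ∞ (fun u => (u, m u)) S := contDiffOn_id.prodMk hm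
  have hm' : ContDiffOn ℝ ∞ (fderiv ℝ m) S := hm.fderiv_of_isOpen hS (by simp)
  have hY' : ContDiffOn ℝ ∞ (fderiv ℝ Y) S := hY.fderiv_of_isOpen hS (by simp)
  have hG : ContDiffOn ℝ ∞ (fun u => fderiv ℝ H (u, m u)) S := hH'.comp hgr hmO
  -- One differentiation makes the equation linear in Dm: the damping is -∂H/∂m, the source is
  -- ∂H/∂u, and Λ is the commutator with DY.
  set β : U → ℝ := fun u => -fderiv ℝ H (u, m u) (0, 1) with hβdef
  set s : U → U →L[ℝ] ℝ := fun u => (fderiv ℝ H (u, m u)) ∘L .inl ℝ U ℝ with hsdef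
  set Λ : U → (U →L[ℝ] ℝ) →L[ℝ] (U →L[ℝ] ℝ) := fun u =>
    -(ContinuousLinearMap.compL ℝ U U ℝ).flip (fderiv ℝ Y u) with hΛdef
  set Lβ : (U × ℝ →L[ℝ] ℝ) →L[ℝ] ℝ := -ContinuousLinearMap.apply ℝ ℝ ((0, 1) : U × ℝ) with hLβ
  set Ls : (U × ℝ →L[ℝ] ℝ) →L[ℝ] (U →L[ℝ] ℝ) :=
    (ContinuousLinearMap.compL ℝ U (U × ℝ) ℝ).flip (.inl ℝ U ℝ) with hLs
  have cβ : ContDiffOn ℝ ∞ β S := (ContinuousLinearMap.contDiff Lβ).comp_contDiffOn hG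
  have cs : ContDiffOn ℝ ∞ s S := (ContinuousLinearMap.contDiff Ls).comp_contDiffOn hG
  have cΛ0 : ContDiffOn ℝ ∞
      (fun u => (ContinuousLinearMap.compL ℝ U U ℝ).flip (fderiv ℝ Y u)) S :=
    (ContinuousLinearMap.contDiff _).comp_contDiffOn hY'
  have hlin : ∀ u ∈ S, fderiv ℝ (fderiv ℝ m) u (Y u) =
      -(β u • fderiv ℝ m u) + Λ u (fderiv ℝ m u) + s u := by
    intro u hu
    have hn := hS.mem_nhds hu
    have hd : ∀ {F : Type} [NormedAddCommGroup F] [NormedSpace ℝ F] {f : U → F},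
        ContDiffOn ℝ ∞ f S → HasFDerivAt f (fderiv ℝ f u) u := fun hf =>
      ((hf.contDiffAt hn).differentiableAt (by simp)).hasFDerivAt
    have h1 := (hd hm').clm_apply (hd hY)
    have hHd : HasFDerivAt H (fderiv ℝ H (u, m u)) (u, m u) :=
      ((hH.contDiffAt (hO.mem_nhds (hmO hu))).differentiableAt (by simp)).hasFDerivAt
    have h2 : HasFDerivAt (fun u => H (u, m u)) _ u :=
      hHd.comp u ((hasFDerivAt_id u).prodMk (hd hm))
    have h3 := h1.unique (h2.congr_of_eventuallyEq (by
      filter_upwards [hn] with x hx using heq x hx))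
    have hsymm : IsSymmSndFDerivAt ℝ m u := (hm.contDiffAt hn).isSymmSndFDerivAt (by
      simp only [minSmoothness_of_isRCLikeNormedField]
      exact WithTop.coe_le_coe.2 (le_top : (2 : ℕ∞) ≤ ⊤))
    ext h
    have h4 := DFunLike.congr_fun h3 h
    simp only [_root_.add_apply, ContinuousLinearMap.comp_apply, ContinuousLinearMap.flip_apply,
      ContinuousLinearMap.prod_apply, ContinuousLinearMap.id_apply] at h4
    simp only [hβdef, hΛdef, hsdef, _root_.add_apply, _root_.neg_apply,
      ContinuousLinearMap.comp_apply, ContinuousLinearMap.flip_apply, _root_.smul_apply,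
      ContinuousLinearMap.compL_apply, ContinuousLinearMap.inl_apply, smul_eq_mul]
    rw [hsymm (Y u) h, eq_sub_of_add_eq' h4]
    have h5 : ((h, fderiv ℝ m u h) : U × ℝ) = (h, 0) + fderiv ℝ m u h • ((0, 1) : U × ℝ) := by
      simp
    rw [h5, map_add, map_smul, smul_eq_mul]
    ring
  have hΛq : ∀ u ∈ S, ‖Λ u‖ ≤ q₁ := fun u hu => by
    change ‖-(ContinuousLinearMap.compL ℝ U U ℝ).flip (fderiv ℝ Y u)‖ ≤ q₁
    rw [norm_neg]
    refine ContinuousLinearMap.opNorm_le_bound _ hq₁ fun w => ?_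
    refine (ContinuousLinearMap.opNorm_comp_le w (fderiv ℝ Y u)).trans ?_
    rw [mul_comm]
    exact mul_le_mul_of_nonneg_right (hYq u hu) (norm_nonneg _)
  -- Bootstrap: bounds on m to order k bound the coefficients to order k, and the linear theorem
  -- then bounds Dm to order k.
  have main : ∀ k ≤ N + 1, BddDerivs k m S S := by
    intro k
    induction k with
    | zero =>
      intro _
      obtain ⟨R, hR⟩ := hC.isBounded.exists_norm_le
      exact bddDerivs_zero.2 ⟨R, fun u hu => (le_max_right _ _).trans (hR _ (hmC u hu))⟩
    | succ k ih =>
      intro hk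
      have hkN : k ≤ N := by omega
      have bm : BddDerivs k m S S := ih (by omega)
      have bgr : BddDerivs k (fun u => (u, m u)) S S :=
        BddDerivs.prodMk hS contDiffOn_id hm subset_rfl (bid.of_le hkN) bm
      have bG : BddDerivs k (fun u => fderiv ℝ H (u, m u)) S S :=
        BddDerivs.comp hS hO hC hCO hH' hgr hmO subset_rfl hmC bgr
      refine (bddDerivs_succ hS subset_rfl).2 ⟨bm.of_le (Nat.zero_le _), ?_⟩
      refine bddDerivs_of_transport hS hK hreach hY hβ₀ hq₁ hYq cβ
        (fun u hu => by have := hβ u hu; simp only [hβdef]; linarith) k (q := q₁) (Λ := Λ) (s := s)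
        ?_ (bY.of_le hkN) (BddDerivs.clm_comp hS Lβ hG subset_rfl bG) hm' cΛ0.neg cs hlin hΛq
        (BddDerivs.neg hS subset_rfl (BddDerivs.clm_comp hS _ hY' subset_rfl (bY.of_le hkN)))
        (BddDerivs.clm_comp hS Ls hG subset_rfl bG)
        (((bddDerivs_succ hS hK).1 (bmK.of_le hk)).2)
      have : (k : ℝ) ≤ N := by exact_mod_cast hkN
      nlinarith
  exact main (N + 1) le_rfl

end TransportDerivatives

noncomputable section

/-! ### The reduced flow in the coordinates `(ρ₁, y₁)` -/

section ReducedFlow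

/-- The bracket as a function of `ε = ρ² y`. -/
def bracket (a b ε : ℝ) : ℝ := b + a * ε ^ 2 / (1 + a * ε)

/-- The backward evolution of `ε = ρ² y` under the reduced flow. -/
def backEps (ε t : ℝ) : ℝ := ε / (1 + ε * t)

/-- The backward evolution of `ρ` under the reduced flow. -/
def backRho (a b : ℝ) (u : ℝ × ℝ) (t : ℝ) : ℝ :=
  u.1 * Real.exp (-(b * t)) * ((1 + a * backEps (u.1 ^ 2 * u.2) t) / (1 + a * (u.1 ^ 2 * u.2)))

/-- The backward evolution of `y` under the reduced flow. -/
def backY (a b : ℝ) (u : ℝ × ℝ) (t : ℝ) : ℝ :=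
  u.2 * Real.exp (2 * b * t) / (1 + u.1 ^ 2 * u.2 * t) *
    ((1 + a * (u.1 ^ 2 * u.2)) / (1 + a * backEps (u.1 ^ 2 * u.2) t)) ^ 2

/-- Smallness of the range of `y` in terms of the parameters. -/
structure IsSmall (a b α χ : ℝ) : Prop where
  b_pos : 0 < b
  pos : 0 < χ
  a_le : 4 * χ * |a| ≤ 1 / 2
  α_le : 4 * χ * |α| ≤ 1 / 8
  le_b : 256 * χ ≤ b

variable {a b α χ ε t : ℝ}

lemma one_add_mul_ge (h : |a| * ε ≤ 1 / 2) (hε : 0 ≤ ε) : 1 / 2 ≤ 1 + a * ε := by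
  have : -|a| * ε ≤ a * ε := mul_le_mul_of_nonneg_right (neg_abs_le a) hε
  linarith

lemma IsSmall.a_mul_le (h : IsSmall a b α χ) (hε' : ε ≤ 4 * χ) :
    |a| * ε ≤ 1 / 2 := by
  have := mul_le_mul_of_nonneg_left hε' (abs_nonneg a)
  have := h.a_le
  linarith

lemma IsSmall.one_add (h : IsSmall a b α χ) (hε : 0 ≤ ε) (hε' : ε ≤ 4 * χ) :
    1 / 2 ≤ 1 + a * ε := one_add_mul_ge (h.a_mul_le hε') hε

lemma IsSmall.abs_bracket_sub_le (h : IsSmall a b α χ) (hε : 0 ≤ ε) (hε' : ε ≤ 4 * χ) :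
    |bracket a b ε - b| ≤ ε := by
  have h1 := h.one_add hε hε'
  have h2 := h.a_mul_le hε'
  rw [bracket, add_sub_cancel_left, abs_div, abs_mul, abs_of_nonneg (sq_nonneg ε),
    abs_of_pos (by linarith : 0 < 1 + a * ε), div_le_iff₀ (by linarith)]
  nlinarith

lemma IsSmall.bracket_mem (h : IsSmall a b α χ) (hε : 0 ≤ ε) (hε' : ε ≤ 4 * χ) :
    63 / 64 * b ≤ bracket a b ε ∧ bracket a b ε ≤ 65 / 64 * b ∧ ε ≤ b / 64 := by
  have h1 := abs_le.1 (h.abs_bracket_sub_le hε hε')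
  have h2 := h.le_b
  constructor
  · linarith
  · constructor <;> linarith

lemma IsSmall.α_mem (h : IsSmall a b α χ) (hε : 0 ≤ ε) (hε' : ε ≤ 4 * χ) :
    7 / 8 ≤ 1 + α * ε ∧ 1 + α * ε ≤ 9 / 8 := by
  have h1 : |α * ε| ≤ 1 / 8 := by
    rw [abs_mul, abs_of_nonneg hε]
    have := mul_le_mul_of_nonneg_left hε' (abs_nonneg α)
    have := h.α_le
    linarith
  have := abs_le.1 h1
  constructor <;> linarith

lemma backEps_nonneg (hε : 0 ≤ ε) (ht : 0 ≤ t) : 0 ≤ backEps ε t := by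
  unfold backEps; positivity

lemma backEps_le (hε : 0 ≤ ε) (ht : 0 ≤ t) : backEps ε t ≤ ε :=
  div_le_self hε (by nlinarith [mul_nonneg hε ht])

lemma backEps_zero : backEps ε 0 = ε := by simp [backEps]

/-- In ε = ρ² y the bracket contributions of ρ² and y cancel, and a Riccati equation for ε alone
remains. This makes the whole reduced flow explicit. -/
lemma hasDerivAt_backEps (hε : 0 ≤ ε) (ht : 0 ≤ t) :
    HasDerivAt (backEps ε) (-(backEps ε t) ^ 2) t := by
  have hpos : 1 + ε * t ≠ 0 := by positivity
  have h1 : HasDerivAt (fun t => 1 + ε * t) ε t := by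
    simpa using ((hasDerivAt_id t).const_mul ε).const_add 1
  refine ((hasDerivAt_const t ε).div h1 hpos).congr_deriv ?_
  unfold backEps
  field_simp
  ring

lemma backEps_add {s : ℝ} (hε : 0 ≤ ε) (hs : 0 ≤ s) (ht : 0 ≤ t) :
    backEps (backEps ε s) t = backEps ε (s + t) := by
  have h1 : 1 + ε * s ≠ 0 := by positivity
  have h2 : 1 + ε * (s + t) ≠ 0 := by positivity
  have h3 : 1 + ε / (1 + ε * s) * t ≠ 0 := by positivity
  unfold backEps
  field_simp
  ring

/-- The data of a point in the domain of the reduced flow. -/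
structure ReducedPoint (a b α χ : ℝ) (u : ℝ × ℝ) : Prop where
  small : IsSmall a b α χ
  rho : |u.1| ≤ 2
  y_pos : 0 < u.2
  y_le : u.2 ≤ χ

variable {u : ℝ × ℝ}

lemma ReducedPoint.eps_nonneg (h : ReducedPoint a b α χ u) : 0 ≤ u.1 ^ 2 * u.2 :=
  mul_nonneg (sq_nonneg _) h.y_pos.le

lemma ReducedPoint.eps_le (h : ReducedPoint a b α χ u) : u.1 ^ 2 * u.2 ≤ 4 * χ := by
  have h1 : u.1 ^ 2 ≤ 4 := by
    have := abs_le.1 h.rho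
    nlinarith
  exact mul_le_mul h1 h.y_le h.y_pos.le (by norm_num)

lemma ReducedPoint.one_add_ne (h : ReducedPoint a b α χ u) : 1 / 2 ≤ 1 + a * (u.1 ^ 2 * u.2) :=
  h.small.one_add h.eps_nonneg h.eps_le

lemma ReducedPoint.backEps_mem (h : ReducedPoint a b α χ u) (ht : 0 ≤ t) :
    0 ≤ backEps (u.1 ^ 2 * u.2) t ∧ backEps (u.1 ^ 2 * u.2) t ≤ 4 * χ :=
  ⟨backEps_nonneg h.eps_nonneg ht, (backEps_le h.eps_nonneg ht).trans h.eps_le⟩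

lemma ReducedPoint.one_add_back (h : ReducedPoint a b α χ u) (ht : 0 ≤ t) :
    1 / 2 ≤ 1 + a * backEps (u.1 ^ 2 * u.2) t :=
  h.small.one_add (h.backEps_mem ht).1 (h.backEps_mem ht).2

lemma ReducedPoint.backY_pos (h : ReducedPoint a b α χ u) (ht : 0 ≤ t) : 0 < backY a b u t := by
  have h1 := h.one_add_ne
  have h2 := h.one_add_back ht
  have h3 : 0 < 1 + a * (u.1 ^ 2 * u.2) := by linarith
  have h4 : 0 < 1 + a * backEps (u.1 ^ 2 * u.2) t := by linarith
  have h5 : 0 < 1 + u.1 ^ 2 * u.2 * t := by have := mul_nonneg h.eps_nonneg ht; linarith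
  have h6 := h.y_pos
  unfold backY
  positivity

lemma ReducedPoint.backRho_sq_mul (h : ReducedPoint a b α χ u) (ht : 0 ≤ t) :
    backRho a b u t ^ 2 * backY a b u t = backEps (u.1 ^ 2 * u.2) t := by
  have h1 := h.one_add_ne
  have h2 := h.one_add_back ht
  have h3 : 1 + a * (u.1 ^ 2 * u.2) ≠ 0 := by linarith
  have h4 : 1 + a * backEps (u.1 ^ 2 * u.2) t ≠ 0 := by linarith
  have h5 : 1 + u.1 ^ 2 * u.2 * t ≠ 0 := by have := mul_nonneg h.eps_nonneg ht; linarith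
  have h6 : Real.exp (-(b * t)) ^ 2 * Real.exp (2 * b * t) = 1 := by
    rw [← Real.exp_nat_mul, ← Real.exp_add]
    simp
    ring
  unfold backRho backY
  set e := backEps (u.1 ^ 2 * u.2) t with he
  calc _ = (Real.exp (-(b * t)) ^ 2 * Real.exp (2 * b * t)) * (u.1 ^ 2 * u.2 / (1 + u.1 ^ 2 * u.2 * t))
      * (((1 + a * e) / (1 + a * (u.1 ^ 2 * u.2))) * ((1 + a * (u.1 ^ 2 * u.2)) / (1 + a * e))) ^ 2 := by
        ring
    _ = e := by
        rw [h6, div_mul_div_cancel₀ h3, div_self h4, he, backEps]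
        ring

/-- The equation ε' = -ε² gives (log (1 + aε))' = -aε²/(1 + aε), so the factor 1 + aε accounts
exactly for the part of the bracket beyond b. -/
lemma ReducedPoint.hasDerivAt_backRho (h : ReducedPoint a b α χ u) (ht : 0 ≤ t) :
    HasDerivAt (backRho a b u)
      (-(backRho a b u t * bracket a b (backEps (u.1 ^ 2 * u.2) t))) t := by
  have h2 := h.one_add_back ht
  have h4 : 1 + a * backEps (u.1 ^ 2 * u.2) t ≠ 0 := by linarith
  have hE := hasDerivAt_backEps h.eps_nonneg ht
  have hexp : HasDerivAt (fun t => Real.exp (-(b * t))) (Real.exp (-(b * t)) * (-b)) t := by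
    simpa using (((hasDerivAt_id t).const_mul b).neg).exp
  have := (hexp.const_mul u.1).mul (((hE.const_mul a).const_add 1).div_const
    (1 + a * (u.1 ^ 2 * u.2)))
  refine this.congr_deriv ?_
  unfold backRho bracket
  field_simp
  ring

lemma ReducedPoint.hasDerivAt_backY (h : ReducedPoint a b α χ u) (ht : 0 ≤ t) :
    HasDerivAt (backY a b u) (backY a b u t * (2 * bracket a b (backEps (u.1 ^ 2 * u.2) t) -
      backEps (u.1 ^ 2 * u.2) t)) t := by
  have h2 := h.one_add_back ht
  have h4 : 1 + a * backEps (u.1 ^ 2 * u.2) t ≠ 0 := by linarith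
  have h5 : 1 + u.1 ^ 2 * u.2 * t ≠ 0 := by have := mul_nonneg h.eps_nonneg ht; linarith
  have hE := hasDerivAt_backEps h.eps_nonneg ht
  have hexp : HasDerivAt (fun t => Real.exp (2 * b * t)) (Real.exp (2 * b * t) * (2 * b)) t := by
    simpa using ((hasDerivAt_id t).const_mul (2 * b)).exp
  have hden : HasDerivAt (fun t => 1 + u.1 ^ 2 * u.2 * t) (u.1 ^ 2 * u.2) t := by
    simpa using ((hasDerivAt_id t).const_mul (u.1 ^ 2 * u.2)).const_add 1
  have h7 : HasDerivAt (fun t => (1 + a * (u.1 ^ 2 * u.2)) / (1 + a * backEps (u.1 ^ 2 * u.2) t))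
      _ t := (hasDerivAt_const t (1 + a * (u.1 ^ 2 * u.2))).div ((hE.const_mul a).const_add 1) h4
  have := ((hexp.const_mul u.2).div hden h5).mul (h7.pow 2)
  refine this.congr_deriv ?_
  have he : u.1 ^ 2 * u.2 = backEps (u.1 ^ 2 * u.2) t * (1 + u.1 ^ 2 * u.2 * t) := by
    rw [backEps, div_mul_cancel₀ _ h5]
  unfold backY bracket
  simp only [Pi.pow_apply, Pi.div_apply]
  clear this h7 hden hexp hE h2 h
  generalize backEps (u.1 ^ 2 * u.2) t = e at *
  generalize u.1 ^ 2 * u.2 = E at *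
  generalize hA : 1 + E * t = A at *
  generalize Real.exp (2 * b * t) = X at *
  generalize hF : 1 + a * E = F
  subst he
  field_simp
  ring

lemma ReducedPoint.rate_ge (h : ReducedPoint a b α χ u) (ht : 0 ≤ t) :
    b ≤ 2 * bracket a b (backEps (u.1 ^ 2 * u.2) t) - backEps (u.1 ^ 2 * u.2) t := by
  obtain ⟨h1, -, h2⟩ := h.small.bracket_mem (h.backEps_mem ht).1 (h.backEps_mem ht).2
  have := h.small.b_pos
  linarith

lemma backY_zero (h : ReducedPoint a b α χ u) : backY a b u 0 = u.2 := by
  have h1 : 1 + a * (u.1 ^ 2 * u.2) ≠ 0 := by have := h.one_add_ne; linarith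
  simp [backY, backEps_zero, div_self h1]

lemma backRho_zero (h : ReducedPoint a b α χ u) : backRho a b u 0 = u.1 := by
  have h1 : 1 + a * (u.1 ^ 2 * u.2) ≠ 0 := by have := h.one_add_ne; linarith
  simp [backRho, backEps_zero, div_self h1]

lemma ReducedPoint.strictMonoOn_backY (h : ReducedPoint a b α χ u) :
    StrictMonoOn (backY a b u) (Ici 0) := by
  refine strictMonoOn_of_deriv_pos (convex_Ici 0)
    (fun t ht => (h.hasDerivAt_backY ht).continuousAt.continuousWithinAt) fun t ht => ?_
  rw [interior_Ici] at ht
  have ht' : 0 ≤ t := le_of_lt ht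
  rw [(h.hasDerivAt_backY ht').deriv]
  exact mul_pos (h.backY_pos ht') (h.small.b_pos.trans_le (h.rate_ge ht'))

lemma ReducedPoint.backY_ge (h : ReducedPoint a b α χ u) (ht : 0 ≤ t) :
    u.2 * Real.exp (b * t) ≤ backY a b u t := by
  have hd : ∀ s, 0 ≤ s → HasDerivAt (fun s => backY a b u s * Real.exp (-(b * s)))
      (backY a b u s * (2 * bracket a b (backEps (u.1 ^ 2 * u.2) s) -
      backEps (u.1 ^ 2 * u.2) s - b) * Real.exp (-(b * s))) s := by
    intro s hs
    have hexp : HasDerivAt (fun t => Real.exp (-(b * t))) (Real.exp (-(b * s)) * (-b)) s := by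
      simpa using (((hasDerivAt_id s).const_mul b).neg).exp
    refine ((h.hasDerivAt_backY hs).mul hexp).congr_deriv ?_
    ring
  have hmono : MonotoneOn (fun s => backY a b u s * Real.exp (-(b * s))) (Ici 0) := by
    refine monotoneOn_of_deriv_nonneg (convex_Ici 0)
      (fun s hs => (hd s hs).continuousAt.continuousWithinAt)
      (fun s hs => ((hd s (interior_subset hs)).differentiableAt).differentiableWithinAt)
      fun s hs => ?_
    have hs' : 0 ≤ s := interior_subset hs
    rw [(hd s hs').deriv]
    exact mul_nonneg (mul_nonneg (h.backY_pos hs').le (by linarith [h.rate_ge hs']))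
      (Real.exp_pos _).le
  have h1 := hmono ((self_mem_Ici : (0 : ℝ) ∈ Ici 0)) ht ht
  simp only [backY_zero h, mul_zero, neg_zero, Real.exp_zero, mul_one] at h1
  have h2 : Real.exp (-(b * t)) * Real.exp (b * t) = 1 := by rw [← Real.exp_add]; simp
  calc u.2 * Real.exp (b * t) ≤ backY a b u t * Real.exp (-(b * t)) * Real.exp (b * t) :=
        mul_le_mul_of_nonneg_right h1 (Real.exp_pos _).le
    _ = backY a b u t := by rw [mul_assoc, h2, mul_one]

lemma ReducedPoint.exists_backY_eq (h : ReducedPoint a b α χ u) {c : ℝ} (hc : u.2 ≤ c) :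
    ∃ T, 0 ≤ T ∧ backY a b u T = c := by
  have hb := h.small.b_pos
  -- With e^z ≥ 1 + z this time gives y e^{bT₀} ≥ y + c.
  set T₀ := c / (u.2 * b) with hT₀
  have hc0 : 0 < c := h.y_pos.trans_le hc
  have hT₀' : 0 ≤ T₀ := div_nonneg hc0.le (mul_pos h.y_pos hb).le
  have hbig : c ≤ backY a b u T₀ := by
    refine le_trans ?_ (h.backY_ge hT₀')
    have h1 : b * T₀ + 1 ≤ Real.exp (b * T₀) := Real.add_one_le_exp _
    have h2 : b * T₀ = c / u.2 := by rw [hT₀]; field_simp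
    have h3 : c = u.2 * (c / u.2) := by field_simp [h.y_pos.ne']
    have := mul_le_mul_of_nonneg_left h1 h.y_pos.le
    rw [h2] at this ⊢
    nlinarith [h.y_pos]
  have hcont : ContinuousOn (backY a b u) (Icc 0 T₀) := fun t ht =>
    (h.hasDerivAt_backY ht.1).continuousAt.continuousWithinAt
  obtain ⟨T, hT, hTc⟩ := intermediate_value_Icc hT₀' hcont ⟨by rwa [backY_zero h], hbig⟩
  exact ⟨T, hT.1, hTc⟩

lemma ReducedPoint.abs_backRho_le (h : ReducedPoint a b α χ u) (ht : 0 ≤ t) :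
    |backRho a b u t| ≤ |u.1| := by
  have hd : ∀ s, 0 ≤ s → HasDerivAt (fun s => backRho a b u s ^ 2)
      (-(2 * bracket a b (backEps (u.1 ^ 2 * u.2) s) * backRho a b u s ^ 2)) s := by
    intro s hs
    refine ((h.hasDerivAt_backRho hs).pow 2).congr_deriv ?_
    push_cast
    ring
  have hanti : AntitoneOn (fun s => backRho a b u s ^ 2) (Ici 0) := by
    refine antitoneOn_of_deriv_nonpos (convex_Ici 0)
      (fun s hs => (hd s hs).continuousAt.continuousWithinAt)
      (fun s hs => ((hd s (interior_subset hs)).differentiableAt).differentiableWithinAt)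
      fun s hs => ?_
    have hs' : 0 ≤ s := interior_subset hs
    rw [(hd s hs').deriv]
    have := (h.small.bracket_mem (h.backEps_mem hs').1 (h.backEps_mem hs').2).1
    have hb := h.small.b_pos
    have : 0 ≤ 2 * bracket a b (backEps (u.1 ^ 2 * u.2) s) := by linarith
    have := mul_nonneg this (sq_nonneg (backRho a b u s))
    linarith
  have h1 := hanti ((self_mem_Ici : (0 : ℝ) ∈ Ici 0)) ht ht
  simp only [backRho_zero h] at h1
  exact sq_le_sq.1 h1

lemma ReducedPoint.back (h : ReducedPoint a b α χ u) (ht : 0 ≤ t) (hy : backY a b u t ≤ χ) :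
    ReducedPoint a b α χ (backRho a b u t, backY a b u t) :=
  ⟨h.small, (h.abs_backRho_le ht).trans h.rho, h.backY_pos ht, hy⟩

/-- The flow property of the explicit formula; it lets characteristics of different points on one
reduced orbit be compared. -/
lemma ReducedPoint.backY_add (h : ReducedPoint a b α χ u) {s : ℝ} (hs : 0 ≤ s) (ht : 0 ≤ t)
    (hy : backY a b u s ≤ χ) :
    backY a b (backRho a b u s, backY a b u s) t = backY a b u (s + t) := by
  have h' := h.back hs hy
  have hs2 := h.one_add_back hs
  have hE := h.eps_nonneg
  have key : (1 + u.1 ^ 2 * u.2 * s) * (1 + backEps (u.1 ^ 2 * u.2) s * t) =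
      1 + u.1 ^ 2 * u.2 * (s + t) := by
    have h5 : 1 + u.1 ^ 2 * u.2 * s ≠ 0 := by have := mul_nonneg h.eps_nonneg hs; linarith
    unfold backEps
    field_simp
    ring
  have h4 : 1 + a * backEps (u.1 ^ 2 * u.2) s ≠ 0 := by linarith
  rw [backY]
  simp only [h.backRho_sq_mul hs, backEps_add hE hs ht]
  unfold backY
  rw [mul_add (2 * b), Real.exp_add, ← key]
  have h5 : 1 + u.1 ^ 2 * u.2 * s ≠ 0 := by have := mul_nonneg hE hs; linarith
  have h6 : 1 + backEps (u.1 ^ 2 * u.2) s * t ≠ 0 := by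
    have := mul_nonneg (h.backEps_mem hs).1 ht; linarith
  have h7 : 1 + a * backEps (u.1 ^ 2 * u.2) (s + t) ≠ 0 := by
    have := h.one_add_back (add_nonneg hs ht); linarith
  generalize 1 + backEps (u.1 ^ 2 * u.2) s * t = A at *
  generalize 1 + a * backEps (u.1 ^ 2 * u.2) s = B at *
  generalize 1 + a * backEps (u.1 ^ 2 * u.2) (s + t) = C at *
  generalize 1 + u.1 ^ 2 * u.2 * s = D at *
  field_simp

end ReducedFlow

end

noncomputable section

/-! ### Characteristics of the invariance equation -/

section Characteristics

/-- A smooth function which agrees with `x⁻¹` for `x ≥ 1 / 2`. -/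
def cutInv (x : ℝ) : ℝ :=
  (Real.smoothTransition (4 * x - 1) * x + (1 - Real.smoothTransition (4 * x - 1)))⁻¹

lemma cutInv_eq {x : ℝ} (hx : 1 / 2 ≤ x) : cutInv x = x⁻¹ := by
  rw [cutInv, Real.smoothTransition.one_of_one_le (by linarith)]
  simp

lemma contDiff_cutInv : ContDiff ℝ ∞ cutInv := by
  have h1 : ContDiff ℝ ∞ fun x : ℝ => Real.smoothTransition (4 * x - 1) :=
    Real.smoothTransition.contDiff.comp (by fun_prop)
  refine ((h1.mul contDiff_id).add (contDiff_const.sub h1)).inv fun x => ne_of_gt ?_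
  have h2 := Real.smoothTransition.nonneg (4 * x - 1)
  have h3 := Real.smoothTransition.le_one (4 * x - 1)
  simp only [id]
  rcases le_or_gt x (1 / 4) with hx | hx
  · rw [Real.smoothTransition.zero_of_nonpos (by linarith)]
    norm_num
  · nlinarith

/-- Compactly supported replacements of 1/n and n are bounded and Lipschitz, so the characteristic
equation is solvable on the whole interval. They change nothing in the box |b n - 1| ≤ 1/4, which
solutions never leave. -/
lemma exists_cutoff {b : ℝ} (hb : 0 < b) : ∃ J₁ J₂ : ℝ → ℝ, ContDiff ℝ ∞ J₁ ∧ ContDiff ℝ ∞ J₂ ∧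
    HasCompactSupport J₁ ∧ HasCompactSupport J₂ ∧
    ∀ n, |b * n - 1| ≤ 1 / 4 → J₁ n = n⁻¹ ∧ J₂ n = n := by
  let g : ContDiffBump (1 : ℝ) := ⟨1 / 4, 1 / 2, by norm_num, by norm_num⟩
  have hg : HasCompactSupport fun n : ℝ => g (b * n) := by
    have := g.hasCompactSupport.comp_homeomorph (Homeomorph.mulLeft₀ b hb.ne')
    exact this
  have hgc : ContDiff ℝ ∞ fun n : ℝ => g (b * n) := g.contDiff.comp (by fun_prop)
  have hj : ContDiff ℝ ∞ fun n : ℝ => b * cutInv (b * n) :=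
    contDiff_const.mul (contDiff_cutInv.comp (by fun_prop))
  refine ⟨fun n => g (b * n) * (b * cutInv (b * n)), fun n => g (b * n) * n, hgc.mul hj,
    hgc.mul contDiff_id, hg.mul_right, hg.mul_right, fun n hn => ?_⟩
  have h1 : g (b * n) = 1 := g.one_of_mem_closedBall (by
    rw [Metric.mem_closedBall, Real.dist_eq]; exact hn)
  have h2 := abs_le.1 hn
  simp only [h1, one_mul, and_true]
  rw [cutInv_eq (by linarith), mul_inv, ← mul_assoc, mul_inv_cancel₀ hb.ne', one_mul]

variable {P : Type} [NormedAddCommGroup P] [NormedSpace ℝ P]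

lemma exists_smooth_solution_of_affine [CompleteSpace P] {A B C : P × ℝ → ℝ}
    (hA : ContDiff ℝ ∞ A) (hB : ContDiff ℝ ∞ B) (hC : ContDiff ℝ ∞ C) {J₁ J₂ : ℝ → ℝ}
    (hJ₁ : ContDiff ℝ ∞ J₁) (hJ₂ : ContDiff ℝ ∞ J₂) (cJ₁ : HasCompactSupport J₁)
    (cJ₂ : HasCompactSupport J₂) (c : ℝ) :
    ∃ N : P → ℝ → ℝ, (∀ p, N p 0 = c) ∧
      (∀ p, ∀ s ∈ Icc (0 : ℝ) 1, HasDerivWithinAt (N p)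
        (A (p, s) * J₁ (N p s) + B (p, s) + C (p, s) * J₂ (N p s)) (Icc 0 1) s) ∧
      ContDiff ℝ ∞ (fun p => N p 1) := by
  obtain ⟨M₁, hM₁⟩ := cJ₁.exists_bound_of_continuous hJ₁.continuous
  obtain ⟨M₂, hM₂⟩ := cJ₂.exists_bound_of_continuous hJ₂.continuous
  obtain ⟨L₁, hL₁⟩ := hJ₁.lipschitzWith_of_hasCompactSupport cJ₁ (by simp)
  obtain ⟨L₂, hL₂⟩ := hJ₂.lipschitzWith_of_hasCompactSupport cJ₂ (by simp)
  have bound : ∀ F : P × ℝ → ℝ, ContDiff ℝ ∞ F → ∀ p, ∃ K, ∀ s ∈ Icc (0 : ℝ) 1,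
      ‖F (p, s)‖ ≤ K := fun F hF p =>
    isCompact_Icc.exists_bound_of_continuousOn
      (hF.continuous.comp (Continuous.prodMk_right p)).continuousOn
  let f : P × ℝ × ℝ → ℝ := fun q =>
    A (q.1, q.2.1) * J₁ q.2.2 + B (q.1, q.2.1) + C (q.1, q.2.1) * J₂ q.2.2
  have hproj : ContDiff ℝ ∞ fun q : P × ℝ × ℝ => (q.1, q.2.1) := by fun_prop
  have hf : ContDiff ℝ ∞ f :=
    (((hA.comp hproj).mul (hJ₁.comp (by fun_prop : ContDiff ℝ ∞ fun q : P × ℝ × ℝ => q.2.2))).add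
      (hB.comp hproj)).add
      ((hC.comp hproj).mul (hJ₂.comp (by fun_prop : ContDiff ℝ ∞ fun q : P × ℝ × ℝ => q.2.2)))
  refine exists_smooth_solution hf c (fun p => ?_) (fun p => ?_)
  · obtain ⟨KA, hKA⟩ := bound A hA p
    obtain ⟨KB, hKB⟩ := bound B hB p
    obtain ⟨KC, hKC⟩ := bound C hC p
    have h0 : (0 : ℝ) ∈ Icc (0 : ℝ) 1 := by simp
    refine ⟨(KA * M₁ + KB + KC * M₂).toNNReal, fun s hs n => le_trans ?_ (Real.le_coe_toNNReal _)⟩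
    refine (norm_add₃_le).trans ?_
    rw [norm_mul, norm_mul]
    have h1 := (norm_nonneg _).trans (hKA s hs)
    have h2 := (norm_nonneg _).trans (hKC s hs)
    exact add_le_add (add_le_add (mul_le_mul (hKA s hs) (hM₁ n) (norm_nonneg _) h1) (hKB s hs))
      (mul_le_mul (hKC s hs) (hM₂ n) (norm_nonneg _) h2)
  · obtain ⟨KA, hKA⟩ := bound A hA p
    obtain ⟨KC, hKC⟩ := bound C hC p
    refine ⟨(KA * L₁ + KC * L₂).toNNReal, fun s hs => LipschitzWith.of_dist_le_mul fun x y => ?_⟩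
    refine le_trans ?_ (mul_le_mul_of_nonneg_right (Real.le_coe_toNNReal _) dist_nonneg)
    have e : f (p, s, x) - f (p, s, y) =
        A (p, s) * (J₁ x - J₁ y) + C (p, s) * (J₂ x - J₂ y) := by
      simp only [f]; ring
    rw [dist_eq_norm, e]
    refine (norm_add_le _ _).trans ?_
    rw [norm_mul, norm_mul, ← dist_eq_norm, ← dist_eq_norm]
    have h1 := (norm_nonneg _).trans (hKA s hs)
    have h2 := (norm_nonneg _).trans (hKC s hs)
    have h3 := mul_le_mul (hKA s hs) (hL₁.dist_le_mul x y) dist_nonneg h1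
    have h4 := mul_le_mul (hKC s hs) (hL₂.dist_le_mul x y) dist_nonneg h2
    linarith

/-- The rate of change of `(x - 1) / y` along the reduced flow, per unit of time and divided by
`y`, with the state dependence replaced by the cut-offs `J₁`, `J₂`. -/
def cutRate (a b α : ℝ) (J₁ J₂ : ℝ → ℝ) (e y n : ℝ) : ℝ :=
  y⁻¹ * ((1 + α * e) * J₁ n - (bracket a b e - e)) + bracket a b e * J₂ n

variable {a b α χ : ℝ}

/-- The back time is T (1 - s): the characteristic starts on the line y = χ at s = 0 when T is the
hitting time, and arrives at u at s = 1. This fixes the interval and turns T into a parameter. The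
use of 1/y as a parameter and of `cutInv` makes the coefficients smooth for all parameter values,
not only those which come from reduced points. -/
lemma exists_characteristics (a α : ℝ) {J₁ J₂ : ℝ → ℝ}
    (hJ₁ : ContDiff ℝ ∞ J₁) (hJ₂ : ContDiff ℝ ∞ J₂) (cJ₁ : HasCompactSupport J₁)
    (cJ₂ : HasCompactSupport J₂) (c : ℝ) :
    ∃ N : ℝ × ℝ × ℝ → ℝ → ℝ, (∀ p, N p 0 = c) ∧ ContDiff ℝ ∞ (fun p => N p 1) ∧
      ∀ (χ : ℝ) (u : ℝ × ℝ) (T : ℝ), ReducedPoint a b α χ u → 0 ≤ T → ∀ s ∈ Icc (0 : ℝ) 1,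
        HasDerivWithinAt (N (u.1 ^ 2 * u.2, u.2⁻¹, T))
          (T * cutRate a b α J₁ J₂ (backEps (u.1 ^ 2 * u.2) (T * (1 - s)))
            (backY a b u (T * (1 - s))) (N (u.1 ^ 2 * u.2, u.2⁻¹, T) s)) (Icc 0 1) s := by
  let t : (ℝ × ℝ × ℝ) × ℝ → ℝ := fun q => q.1.2.2 * (1 - q.2)
  let eS : (ℝ × ℝ × ℝ) × ℝ → ℝ := fun q => q.1.1 * cutInv (1 + q.1.1 * t q)
  let bS : (ℝ × ℝ × ℝ) × ℝ → ℝ := fun q => b + a * eS q ^ 2 * cutInv (1 + a * eS q)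
  let iY : (ℝ × ℝ × ℝ) × ℝ → ℝ := fun q => q.1.2.1 * Real.exp (-(2 * b * t q)) *
    (1 + q.1.1 * t q) * ((1 + a * eS q) * cutInv (1 + a * q.1.1)) ^ 2
  have hc := contDiff_cutInv
  have ht : ContDiff ℝ ∞ t := by fun_prop
  have heS : ContDiff ℝ ∞ eS := by fun_prop
  have hbS : ContDiff ℝ ∞ bS := by fun_prop
  have hiY : ContDiff ℝ ∞ iY := by fun_prop
  have h1 : ContDiff ℝ ∞ fun q : (ℝ × ℝ × ℝ) × ℝ => q.1.2.2 * (iY q * (1 + α * eS q)) := by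
    fun_prop
  have h2 : ContDiff ℝ ∞ fun q : (ℝ × ℝ × ℝ) × ℝ => q.1.2.2 * (iY q * -(bS q - eS q)) := by
    fun_prop
  have h3 : ContDiff ℝ ∞ fun q : (ℝ × ℝ × ℝ) × ℝ => q.1.2.2 * bS q := by fun_prop
  obtain ⟨N, hN0, hN, hN1⟩ := exists_smooth_solution_of_affine h1 h2 h3 hJ₁ hJ₂ cJ₁ cJ₂ c
  refine ⟨N, hN0, hN1, fun χ u T hu hT s hs => (hN (u.1 ^ 2 * u.2, u.2⁻¹, T) s hs).congr_deriv ?_⟩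
  generalize N (u.1 ^ 2 * u.2, u.2⁻¹, T) s = n
  have hts : 0 ≤ T * (1 - s) := mul_nonneg hT (by linarith [hs.2])
  have e1 : eS ((u.1 ^ 2 * u.2, u.2⁻¹, T), s) = backEps (u.1 ^ 2 * u.2) (T * (1 - s)) := by
    have : 0 ≤ u.1 ^ 2 * u.2 * (T * (1 - s)) := mul_nonneg hu.eps_nonneg hts
    simp only [eS, t, backEps]
    rw [cutInv_eq (by linarith), div_eq_mul_inv]
  have e2 : bS ((u.1 ^ 2 * u.2, u.2⁻¹, T), s) =
      bracket a b (backEps (u.1 ^ 2 * u.2) (T * (1 - s))) := by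
    simp only [bS, bracket]
    rw [e1, cutInv_eq (hu.one_add_back hts), div_eq_mul_inv]
  have e3 : iY ((u.1 ^ 2 * u.2, u.2⁻¹, T), s) = (backY a b u (T * (1 - s)))⁻¹ := by
    simp only [iY, backY]
    rw [e1, cutInv_eq hu.one_add_ne, Real.exp_neg]
    simp only [t]
    rw [mul_inv, inv_div, ← inv_pow, inv_div]
    ring
  simp only
  rw [e1, e2, e3, cutRate]
  ring

end Characteristics

/-! ### The hitting time of the line on which the characteristics start -/

section HitTime

/-- The time which the backward reduced flow needs to reach the line `y = χ`. -/
def hitTime (a b χ : ℝ) (u : ℝ × ℝ) : ℝ :=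
  open Classical in if h : ∃ T, 0 ≤ T ∧ backY a b u T = χ then h.choose else 0

variable {a b α χ t : ℝ} {u : ℝ × ℝ}

lemma ReducedPoint.hitTime_spec (h : ReducedPoint a b α χ u) :
    0 ≤ hitTime a b χ u ∧ backY a b u (hitTime a b χ u) = χ := by
  have h1 := h.exists_backY_eq h.y_le
  rw [hitTime, dif_pos h1]
  exact h1.choose_spec

lemma ReducedPoint.hitTime_unique (h : ReducedPoint a b α χ u) (ht : 0 ≤ t)
    (hy : backY a b u t = χ) : hitTime a b χ u = t :=
  h.strictMonoOn_backY.injOn h.hitTime_spec.1 ht (h.hitTime_spec.2.trans hy.symm)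

lemma ReducedPoint.hitTime_pos (h : ReducedPoint a b α χ u) (hy : u.2 < χ) :
    0 < hitTime a b χ u := by
  refine lt_of_le_of_ne h.hitTime_spec.1 fun h0 => ?_
  have h1 := h.hitTime_spec.2
  rw [← h0, backY_zero h] at h1
  exact hy.ne h1

lemma ReducedPoint.backY_le (h : ReducedPoint a b α χ u) (ht : 0 ≤ t)
    (ht' : t ≤ hitTime a b χ u) : backY a b u t ≤ χ := by
  rw [← h.hitTime_spec.2]
  exact h.strictMonoOn_backY.monotoneOn ht h.hitTime_spec.1 ht'

lemma ReducedPoint.hitTime_back (h : ReducedPoint a b α χ u) (ht : 0 ≤ t)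
    (ht' : t ≤ hitTime a b χ u) :
    hitTime a b χ (backRho a b u t, backY a b u t) = hitTime a b χ u - t := by
  refine (h.back ht (h.backY_le ht ht')).hitTime_unique (by linarith) ?_
  rw [h.backY_add ht (by linarith) (h.backY_le ht ht'), add_sub_cancel, h.hitTime_spec.2]

lemma ReducedPoint.contDiffAt_backY (h : ReducedPoint a b α χ u) (ht : 0 ≤ t) :
    ContDiffAt ℝ ∞ (fun q : (ℝ × ℝ) × ℝ => backY a b q.1 q.2) (u, t) := by
  have h1 : (1 + u.1 ^ 2 * u.2 * t) ≠ 0 := by have := mul_nonneg h.eps_nonneg ht; linarith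
  have h2 : 1 + a * backEps (u.1 ^ 2 * u.2) t ≠ 0 := by have := h.one_add_back ht; linarith
  have hE : ContDiffAt ℝ ∞ (fun q : (ℝ × ℝ) × ℝ => backEps (q.1.1 ^ 2 * q.1.2) q.2) (u, t) := by
    unfold backEps
    exact ContDiffAt.div (by fun_prop) (by fun_prop) h1
  have h3 : ContDiffAt ℝ ∞ (fun q : (ℝ × ℝ) × ℝ => q.1.2 * Real.exp (2 * b * q.2) /
      (1 + q.1.1 ^ 2 * q.1.2 * q.2)) (u, t) := ContDiffAt.div (by fun_prop) (by fun_prop) h1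
  have h4 : ContDiffAt ℝ ∞ (fun q : (ℝ × ℝ) × ℝ => (1 + a * (q.1.1 ^ 2 * q.1.2)) /
      (1 + a * backEps (q.1.1 ^ 2 * q.1.2) q.2)) (u, t) :=
    ContDiffAt.div (by fun_prop) (contDiffAt_const.add (contDiffAt_const.mul hE)) h2
  exact h3.mul (h4.pow 2)

/-- The implicit function theorem applies since y grows strictly along the back flow. The strict
inequality y < χ gives T > 0, so nearby solutions have positive time and are hitting times by
uniqueness. -/
lemma ReducedPoint.contDiffAt_hitTime (h : ReducedPoint a b α χ u) (hu : |u.1| < 2)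
    (hy : u.2 < χ) : ContDiffAt ℝ ∞ (hitTime a b χ) u := by
  set T := hitTime a b χ u with hT
  have hT0 : 0 < T := h.hitTime_pos hy
  have hc := h.contDiffAt_backY hT0.le
  have hd : HasDerivAt (backY a b u) (fderiv ℝ (fun q : (ℝ × ℝ) × ℝ => backY a b q.1 q.2) (u, T)
      (0, 1)) T := by
    have h1 := (hc.differentiableAt (by simp)).hasFDerivAt
    have h2 : HasDerivAt (fun t : ℝ => (u, t)) ((0 : ℝ × ℝ), (1 : ℝ)) T :=
      (hasDerivAt_const T u).prodMk (hasDerivAt_id T)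
    exact h1.comp_hasDerivAt T h2
  have hne : fderiv ℝ (fun q : (ℝ × ℝ) × ℝ => backY a b q.1 q.2) (u, T) (0, 1) ≠ 0 := by
    rw [hd.unique (h.hasDerivAt_backY hT0.le)]
    exact (mul_pos (h.backY_pos hT0.le) (h.small.b_pos.trans_le (h.rate_ge hT0.le))).ne'
  have hinv : (fderiv ℝ (fun q : (ℝ × ℝ) × ℝ => backY a b q.1 q.2) (u, T) ∘L
      .inr ℝ (ℝ × ℝ) ℝ).IsInvertible := by
    set d := fderiv ℝ (fun q : (ℝ × ℝ) × ℝ => backY a b q.1 q.2) (u, T) (0, 1) with hdd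
    refine ⟨ContinuousLinearEquiv.unitsEquivAut ℝ (Units.mk0 d hne), ?_⟩
    ext
    simp [hdd]
  have hself := hc.implicitFunction_apply_self (by simp) hinv
  have hsm := hc.contDiffAt_implicitFunction (by simp) hinv
  have hev := hc.eventually_apply_implicitFunction (by simp) hinv
  refine hsm.congr_of_eventuallyEq ?_
  have hpos : ∀ᶠ x in 𝓝 u, 0 < hc.implicitFunction (by simp) hinv x := by
    have := hsm.continuousAt.tendsto
    rw [hself] at this
    exact this.eventually (lt_mem_nhds hT0)
  have hdom : ∀ᶠ x : ℝ × ℝ in 𝓝 u, |x.1| < 2 ∧ 0 < x.2 ∧ x.2 < χ := by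
    refine (((continuous_fst.abs.isOpen_preimage _ isOpen_Iio).inter
      (continuous_snd.isOpen_preimage _ isOpen_Ioo)).mem_nhds ?_)
    exact ⟨hu, h.y_pos, hy⟩
  filter_upwards [hev, hpos, hdom] with x hx hx0 hxd
  have hx' : ReducedPoint a b α χ x := ⟨h.small, hxd.1.le, hxd.2.1, hxd.2.2.le⟩
  refine hx'.hitTime_unique hx0.le ?_
  rw [hx]
  exact h.hitTime_spec.2

end HitTime

end

noncomputable section

/-! ### The invariant graph over `y > 0` -/

section InvariantGraph

/-- The derivative of `(x - 1) / y` along the flow divided by `x - 1`, where `e = ρ² y` and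
`x = 1 + y n`, multiplied by `y`. -/
def flowRate (a b α e y n : ℝ) : ℝ :=
  (1 + α * e) / n - (bracket a b e - e) + bracket a b e * y * n

variable {a b α χ : ℝ}

/-- To leading order the rate is 1/n - b, which is -b/5 here; smallness of χ controls the rest. With
`IsSmall.flowRate_pos`, where the leading part is b/3, the field points into the box at both ends.
-/
lemma IsSmall.flowRate_neg (h : IsSmall a b α χ) {e y n : ℝ} (he : 0 ≤ e) (he' : e ≤ 4 * χ)
    (hy : 0 ≤ y) (hy' : y ≤ χ) (hn : b * n = 5 / 4) : flowRate a b α e y n < 0 := by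
  have hb := h.b_pos
  obtain ⟨h1, h2, h3⟩ := h.bracket_mem he he'
  obtain ⟨h4, h5⟩ := h.α_mem he he'
  have hn' : n = 5 / (4 * b) := by field_simp; linarith
  have h6 : (1 + α * e) / n ≤ 9 / 8 * (4 * b / 5) := by
    rw [hn', div_div_eq_mul_div, mul_div_assoc]
    exact mul_le_mul_of_nonneg_right h5 (by positivity)
  have h7 : y ≤ b / 256 := by have := h.le_b; linarith
  have h8 : bracket a b e * y * n ≤ 65 / 64 * (5 / 4) * (b / 256) := by
    have : bracket a b e * n ≤ 65 / 64 * (5 / 4) := by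
      rw [← hn, ← mul_assoc]
      exact mul_le_mul_of_nonneg_right h2 (by rw [hn']; positivity)
    calc bracket a b e * y * n = bracket a b e * n * y := by ring
      _ ≤ 65 / 64 * (5 / 4) * y := mul_le_mul_of_nonneg_right this hy
      _ ≤ _ := by linarith
  unfold flowRate
  linarith

lemma IsSmall.flowRate_pos (h : IsSmall a b α χ) {e y n : ℝ} (he : 0 ≤ e) (he' : e ≤ 4 * χ)
    (hy : 0 ≤ y) (hn : b * n = 3 / 4) : 0 < flowRate a b α e y n := by
  have hb := h.b_pos
  obtain ⟨h1, h2, h3⟩ := h.bracket_mem he he'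
  obtain ⟨h4, h5⟩ := h.α_mem he he'
  have hn' : n = 3 / (4 * b) := by field_simp; linarith
  have h6 : 7 / 8 * (4 * b / 3) ≤ (1 + α * e) / n := by
    rw [hn', div_div_eq_mul_div, mul_div_assoc (1 + α * e)]
    exact mul_le_mul_of_nonneg_right h4 (by positivity)
  have h8 : 0 ≤ bracket a b e * y * n := by
    rw [hn']
    have : 0 ≤ bracket a b e := by linarith
    positivity
  unfold flowRate
  linarith

lemma cutRate_eq {J₁ J₂ : ℝ → ℝ} {e y n : ℝ} (hy : y ≠ 0) (h₁ : J₁ n = n⁻¹) (h₂ : J₂ n = n) :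
    cutRate a b α J₁ J₂ e y n = y⁻¹ * flowRate a b α e y n := by
  rw [cutRate, flowRate, h₁, h₂]
  field_simp

/-- The reduced vector field `(ρ B, -y (2 B - ρ² y))`. -/
def reducedField (a b : ℝ) (u : ℝ × ℝ) : ℝ × ℝ :=
  (u.1 * bracket a b (u.1 ^ 2 * u.2),
    -(u.2 * (2 * bracket a b (u.1 ^ 2 * u.2) - u.1 ^ 2 * u.2)))

lemma ReducedPoint.lipschitz_cutRate {u : ℝ × ℝ} (h : ReducedPoint a b α χ u) {J₁ J₂ : ℝ → ℝ}
    {K₁ K₂ : NNReal} (hJ₁ : LipschitzWith K₁ J₁) (hJ₂ : LipschitzWith K₂ J₂) {T : ℝ} (hT : 0 ≤ T) :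
    ∃ K : NNReal, ∀ t, 0 ≤ t → LipschitzWith K fun n => T * cutRate a b α J₁ J₂
      (backEps (u.1 ^ 2 * u.2) t) (backY a b u t) n := by
  refine ⟨(T * (u.2⁻¹ * (9 / 8 * K₁) + 65 / 64 * b * K₂)).toNNReal, fun t ht =>
    LipschitzWith.of_dist_le_mul fun x y => ?_⟩
  refine le_trans ?_ (mul_le_mul_of_nonneg_right (Real.le_coe_toNNReal _) dist_nonneg)
  obtain ⟨e0, e1⟩ := h.backEps_mem ht
  have hb := h.small.b_pos
  obtain ⟨b0, b1, -⟩ := h.small.bracket_mem e0 e1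
  obtain ⟨a0, a1⟩ := h.small.α_mem e0 e1
  have hy : (backY a b u t)⁻¹ ≤ u.2⁻¹ := inv_anti₀ h.y_pos (le_trans (by
    have := Real.one_le_exp (mul_nonneg hb.le ht)
    exact le_mul_of_one_le_right h.y_pos.le this) (h.backY_ge ht))
  have hy0 := inv_pos.2 (h.backY_pos ht)
  generalize backEps (u.1 ^ 2 * u.2) t = ε at *
  generalize (backY a b u t) = Y at *
  rw [Real.dist_eq, ← mul_sub, abs_mul, abs_of_nonneg hT, mul_assoc]
  refine mul_le_mul_of_nonneg_left ?_ hT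
  have e : cutRate a b α J₁ J₂ ε Y x - cutRate a b α J₁ J₂ ε Y y =
      Y⁻¹ * ((1 + α * ε) * (J₁ x - J₁ y)) + bracket a b ε * (J₂ x - J₂ y) := by
    unfold cutRate; ring
  rw [e]
  refine (abs_add_le (Y⁻¹ * ((1 + α * ε) * (J₁ x - J₁ y))) _).trans ?_
  have a2 := abs_of_nonneg (by linarith : 0 ≤ 1 + α * ε)
  have b2 := abs_of_nonneg (by linarith : 0 ≤ bracket a b ε)
  rw [abs_mul, abs_mul, abs_mul, abs_of_pos hy0, a2, b2, ← Real.dist_eq, ← Real.dist_eq, add_mul (u.2⁻¹ * _)]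
  have hu := inv_pos.2 h.y_pos
  refine add_le_add ?_ ?_
  · rw [mul_assoc, mul_assoc]
    refine mul_le_mul hy ?_ (by have := dist_nonneg (x := J₁ x) (y := J₁ y); positivity) hu.le
    exact mul_le_mul a1 (hJ₁.dist_le_mul x y) dist_nonneg (by norm_num)
  · rw [mul_assoc]
    exact mul_le_mul b1 (hJ₂.dist_le_mul x y) dist_nonneg (by positivity)

/-- A barrier argument at both ends of the box: there the cut-offs are inactive and the sign of
`flowRate` pushes the solution inwards. -/
lemma ReducedPoint.box_invariant {u : ℝ × ℝ} (h : ReducedPoint a b α χ u) {J₁ J₂ N : ℝ → ℝ}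
    (hJ : ∀ n, |b * n - 1| ≤ 1 / 4 → J₁ n = n⁻¹ ∧ J₂ n = n) {T : ℝ} (hT : 0 < T)
    (hT' : backY a b u T ≤ χ) (hN0 : |b * N 0 - 1| ≤ 1 / 4)
    (hN : ∀ s ∈ Icc (0 : ℝ) 1, HasDerivWithinAt N (T * cutRate a b α J₁ J₂
      (backEps (u.1 ^ 2 * u.2) (T * (1 - s))) (backY a b u (T * (1 - s))) (N s)) (Icc 0 1) s) :
    ∀ s ∈ Icc (0 : ℝ) 1, |b * N s - 1| ≤ 1 / 4 := by
  have hb := h.small.b_pos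
  have hcont : ContinuousOn N (Icc 0 1) := fun s hs => (hN s hs).continuousWithinAt
  have hderiv : ∀ s ∈ Ico (0 : ℝ) 1, HasDerivWithinAt N (T * cutRate a b α J₁ J₂
      (backEps (u.1 ^ 2 * u.2) (T * (1 - s))) (backY a b u (T * (1 - s))) (N s)) (Ici s) s :=
    fun s hs => (hN s ⟨hs.1, hs.2.le⟩).mono_of_mem_nhdsWithin (Icc_mem_nhdsGE_of_mem hs)
  have hrate : ∀ s ∈ Ico (0 : ℝ) 1, |b * N s - 1| ≤ 1 / 4 →
      0 < (backY a b u (T * (1 - s)))⁻¹ ∧ 0 ≤ backEps (u.1 ^ 2 * u.2) (T * (1 - s)) ∧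
      backEps (u.1 ^ 2 * u.2) (T * (1 - s)) ≤ 4 * χ ∧ backY a b u (T * (1 - s)) ≤ χ ∧
      cutRate a b α J₁ J₂ (backEps (u.1 ^ 2 * u.2) (T * (1 - s))) (backY a b u (T * (1 - s))) (N s)
        = (backY a b u (T * (1 - s)))⁻¹ * flowRate a b α (backEps (u.1 ^ 2 * u.2) (T * (1 - s)))
          (backY a b u (T * (1 - s))) (N s) := by
    intro s hs hns
    have ht : 0 ≤ T * (1 - s) := mul_nonneg hT.le (by linarith [hs.2])
    have ht' : T * (1 - s) ≤ T := by nlinarith [hs.1]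
    exact ⟨inv_pos.2 (h.backY_pos ht), (h.backEps_mem ht).1, (h.backEps_mem ht).2,
      (h.strictMonoOn_backY.monotoneOn ht hT.le ht').trans hT',
      cutRate_eq (h.backY_pos ht).ne' (hJ _ hns).1 (hJ _ hns).2⟩
  have h0 := abs_le.1 hN0
  have upper : ∀ ⦃s⦄, s ∈ Icc (0 : ℝ) 1 → N s ≤ 5 / (4 * b) := by
    refine image_le_of_deriv_right_lt_deriv_boundary' hcont hderiv
      (by rw [le_div_iff₀ (by positivity)]; linarith) continuousOn_const
      (fun x _ => hasDerivWithinAt_const _ _ (5 / (4 * b))) fun s hs hns => ?_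
    have hbn : b * N s = 5 / 4 := by rw [hns]; field_simp
    obtain ⟨r1, r2, r3, r4, r5⟩ := hrate s hs (by rw [hbn]; norm_num)
    rw [r5]
    exact mul_neg_of_pos_of_neg hT (mul_neg_of_pos_of_neg r1
      (h.small.flowRate_neg r2 r3 (inv_pos.1 r1).le r4 hbn))
  have lower : ∀ ⦃s⦄, s ∈ Icc (0 : ℝ) 1 → -N s ≤ -(3 / (4 * b)) := by
    refine image_le_of_deriv_right_lt_deriv_boundary' hcont.neg (fun s hs => (hderiv s hs).neg)
      (by rw [Pi.neg_apply, neg_le_neg_iff, div_le_iff₀ (by positivity)]; linarith)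
      continuousOn_const
      (fun x _ => hasDerivWithinAt_const _ _ (-(3 / (4 * b)))) fun s hs hns => ?_
    have hbn : b * N s = 3 / 4 := by
      have : N s = 3 / (4 * b) := neg_injective hns
      rw [this]; field_simp
    obtain ⟨r1, r2, r3, r4, r5⟩ := hrate s hs (by rw [hbn]; norm_num)
    rw [r5, neg_lt_zero]
    exact mul_pos hT (mul_pos r1 (h.small.flowRate_pos r2 r3 (inv_pos.1 r1).le hbn))
  intro s hs
  have h1 := upper hs
  have h2 := lower hs
  rw [le_div_iff₀ (by positivity)] at h1
  rw [neg_le_neg_iff, div_le_iff₀ (by positivity)] at h2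
  rw [abs_le]
  constructor <;> linarith

/-- The method of characteristics: m u is the value at u of the solution which starts with n = c
where the back orbit of u meets the line y = χ. -/
theorem exists_invariant_graph (h : IsSmall a b α χ) {c : ℝ} (hc : |b * c - 1| ≤ 1 / 4) :
    ∃ m : ℝ × ℝ → ℝ, ContDiffOn ℝ ∞ m (Ioo (-2) 2 ×ˢ Ioo 0 χ) ∧
      (∀ u ∈ Ioo (-2 : ℝ) 2 ×ˢ Ioo 0 χ, |b * m u - 1| ≤ 1 / 4) ∧
      (∀ u ∈ Ioo (-2 : ℝ) 2 ×ˢ Ioo 0 χ, u.2 * fderiv ℝ m u (reducedField a b u) =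
        flowRate a b α (u.1 ^ 2 * u.2) u.2 (m u)) ∧
      Tendsto (fun y => m (0, y)) (𝓝[<] χ) (𝓝 c) := by
  obtain ⟨J₁, J₂, sJ₁, sJ₂, cJ₁, cJ₂, hJ⟩ := exists_cutoff h.b_pos
  obtain ⟨L₁, hL₁⟩ := sJ₁.lipschitzWith_of_hasCompactSupport cJ₁ (by simp)
  obtain ⟨L₂, hL₂⟩ := sJ₂.lipschitzWith_of_hasCompactSupport cJ₂ (by simp)
  obtain ⟨N, hN0, hN1, hN⟩ := exists_characteristics (b := b) a α sJ₁ sJ₂ cJ₁ cJ₂ c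
  set pt : ℝ × ℝ → ℝ × ℝ × ℝ := fun u => (u.1 ^ 2 * u.2, u.2⁻¹, hitTime a b χ u) with hpt
  set D : Set (ℝ × ℝ) := Ioo (-2) 2 ×ˢ Ioo 0 χ with hD
  have hDo : IsOpen D := isOpen_Ioo.prod isOpen_Ioo
  have hred : ∀ u ∈ D, ReducedPoint a b α χ u := fun u hu =>
    ⟨h, abs_le.2 ⟨hu.1.1.le, hu.1.2.le⟩, hu.2.1, hu.2.2.le⟩
  have hcd : ∀ u ∈ D, ContDiffAt ℝ ∞ (fun u => N (pt u) 1) u := by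
    intro u hu
    have h1 := (hred u hu).contDiffAt_hitTime (abs_lt.2 hu.1) hu.2.2
    have h2 : ContDiffAt ℝ ∞ (fun u : ℝ × ℝ => u.2⁻¹) u := contDiffAt_snd.inv hu.2.1.ne'
    have h3 : ContDiffAt ℝ ∞ pt u :=
      ContDiffAt.prodMk (by fun_prop) (h2.prodMk h1)
    exact hN1.contDiffAt.comp u h3
  have hbox : ∀ u ∈ D, ∀ s ∈ Icc (0 : ℝ) 1, |b * N (pt u) s - 1| ≤ 1 / 4 := by
    intro u hu
    have hu' := hred u hu
    exact hu'.box_invariant hJ (hu'.hitTime_pos hu.2.2) hu'.hitTime_spec.2.le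
      (by rw [hN0]; exact hc) (hN χ u _ hu' hu'.hitTime_spec.1)
  -- After the back time t only T - t remains to the line y = χ. The characteristic of the new point
  -- is therefore that of u on [0, κ], κ = 1 - t/T, rescaled to [0, 1]; both start at c and solve
  -- the same Lipschitz equation.
  have hflow : ∀ u ∈ D, ∀ t, 0 ≤ t → t < hitTime a b χ u →
      N (pt (backRho a b u t, backY a b u t)) 1 = N (pt u) (1 - t / hitTime a b χ u) := by
    intro u hu t ht htT
    have hu' := hred u hu
    set T := hitTime a b χ u with hT
    have hTpos : 0 < T := hu'.hitTime_pos hu.2.2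
    have hv' := hu'.back ht (hu'.backY_le ht htT.le)
    have hvT := hu'.hitTime_back ht htT.le
    set v := (backRho a b u t, backY a b u t) with hv
    have hveps : v.1 ^ 2 * v.2 = backEps (u.1 ^ 2 * u.2) t := hu'.backRho_sq_mul ht
    have hT0 : 0 ≤ T - t := by linarith
    obtain ⟨K, hK⟩ := hv'.lipschitz_cutRate hL₁ hL₂ hT0
    have hder := hN χ v (T - t) hv' hT0
    have hptv : pt v = (v.1 ^ 2 * v.2, v.2⁻¹, T - t) := by simp only [hpt, hvT, hT]
    rw [← hptv] at hder
    have hder2 := hN χ u T hu' hTpos.le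
    have hptu : pt u = (u.1 ^ 2 * u.2, u.2⁻¹, T) := rfl
    rw [← hptu] at hder2
    set κ := 1 - t / T with hκ
    have hκT : T * κ = T - t := by rw [hκ]; field_simp
    have hκ0 : 0 ≤ κ := by
      rw [hκ, sub_nonneg, div_le_one hTpos]; exact htT.le
    have hκ1 : κ ≤ 1 := by rw [hκ]; have := div_nonneg ht hTpos.le; linarith
    have hmaps : MapsTo (fun s => κ * s) (Icc (0 : ℝ) 1) (Icc 0 1) := fun s hs =>
      ⟨mul_nonneg hκ0 hs.1, mul_le_one₀ hκ1 hs.1 hs.2⟩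
    have hder3 : ∀ s ∈ Icc (0 : ℝ) 1, HasDerivWithinAt (fun s => N (pt u) (κ * s))
        ((T - t) * cutRate a b α J₁ J₂ (backEps (v.1 ^ 2 * v.2) ((T - t) * (1 - s)))
          (backY a b v ((T - t) * (1 - s))) (N (pt u) (κ * s))) (Icc 0 1) s := by
      intro s hs
      have hlin : HasDerivWithinAt (fun s => κ * s) κ (Icc 0 1) s := by
        simpa using ((hasDerivAt_id s).const_mul κ).hasDerivWithinAt
      have hcomp := (hder2 (κ * s) (hmaps hs)).comp s hlin hmaps
      refine hcomp.congr_deriv ?_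
      have htime : T * (1 - κ * s) = t + (T - t) * (1 - s) := by
        rw [mul_sub, ← mul_assoc, hκT]; ring
      have hs0 : 0 ≤ (T - t) * (1 - s) := mul_nonneg hT0 (by linarith [hs.2])
      rw [htime, hveps, backEps_add hu'.eps_nonneg ht hs0,
        hu'.backY_add ht hs0 (hu'.backY_le ht htT.le), ← hκT]
      ring
    have huniq := ODE_solution_unique_of_mem_Icc_right (v := fun s n => (T - t) *
        cutRate a b α J₁ J₂ (backEps (v.1 ^ 2 * v.2) ((T - t) * (1 - s)))
          (backY a b v ((T - t) * (1 - s))) n) (s := fun _ => univ) (K := K) (a := 0) (b := 1)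
      (f := N (pt v)) (g := fun s => N (pt u) (κ * s))
      (fun s hs => (hK _ (mul_nonneg hT0 (by linarith [hs.2]))).lipschitzOnWith)
      (fun s hs => (hder s hs).continuousWithinAt)
      (fun s hs => (hder s ⟨hs.1, hs.2.le⟩).mono_of_mem_nhdsWithin (Icc_mem_nhdsGE_of_mem hs))
      (fun _ _ => mem_univ _)
      (fun s hs => (hder3 s hs).continuousWithinAt)
      (fun s hs => (hder3 s ⟨hs.1, hs.2.le⟩).mono_of_mem_nhdsWithin (Icc_mem_nhdsGE_of_mem hs))
      (fun _ _ => mem_univ _) (by simp [hN0])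
    simpa using huniq (right_mem_Icc.2 zero_le_one)
  refine ⟨fun u => N (pt u) 1, fun u hu => (hcd u hu).contDiffWithinAt,
    fun u hu => hbox u hu 1 (by simp), fun u hu => ?_, ?_⟩
  -- Differentiating `hflow` at t = 0 in two ways gives the invariance equation. The derivatives are
  -- one-sided because the identity holds for t ≥ 0 only.
  · have hu' := hred u hu
    set T := hitTime a b χ u with hT
    have hTpos : 0 < T := hu'.hitTime_pos hu.2.2
    have hκ : HasDerivWithinAt (fun t => 1 - t / T) (-(1 / T)) (Ico 0 T) 0 := by
      simpa using (((hasDerivAt_id (0 : ℝ)).div_const T).const_sub 1).hasDerivWithinAt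
    have hmaps : MapsTo (fun t => 1 - t / T) (Ico 0 T) (Icc (0 : ℝ) 1) := fun t ht =>
      ⟨by rw [sub_nonneg, div_le_one hTpos]; exact ht.2.le,
        by have := div_nonneg ht.1 hTpos.le; linarith⟩
    have h1 := hN χ u T hu' hTpos.le 1 (by simp)
    have h2 := HasDerivWithinAt.comp (𝕜 := ℝ) (x := 0) (h := fun t => 1 - t / T)
      (h₂ := N (pt u)) (s' := Icc 0 1) (by simpa [hpt] using h1) hκ hmaps
    have hback : HasDerivAt (fun t => (backRho a b u t, backY a b u t))
        (-reducedField a b u) 0 := by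
      refine ((hu'.hasDerivAt_backRho le_rfl).prodMk (hu'.hasDerivAt_backY le_rfl)).congr_deriv ?_
      simp [reducedField, backEps_zero, backRho_zero hu', backY_zero hu']
    have hm : HasFDerivAt (fun u => N (pt u) 1) (fderiv ℝ (fun u => N (pt u) 1) u)
        ((backRho a b u 0, backY a b u 0)) := by
      rw [backRho_zero hu', backY_zero hu']
      exact ((hcd u hu).differentiableAt (by simp)).hasFDerivAt
    have h3 := (hm.comp_hasDerivAt (0 : ℝ) hback).hasDerivWithinAt (s := Ico 0 T)
    have h4 := h3.congr_of_mem (f₁ := N (pt u) ∘ fun t => 1 - t / T)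
      (fun t ht => (hflow u hu t ht.1 ht.2).symm) ⟨le_rfl, hTpos⟩
    have hud : UniqueDiffWithinAt ℝ (Ico 0 T) (0 : ℝ) :=
      uniqueDiffOn_Ico 0 T 0 ⟨le_rfl, hTpos⟩
    have h5 := hud.eq_deriv _ h4 h2
    simp only [backEps_zero, backY_zero hu', map_neg] at h5
    have h6 := hJ (N (pt u) 1) (hbox u hu 1 (by simp))
    have h7 : fderiv ℝ (fun u => N (pt u) 1) u (reducedField a b u) =
        cutRate a b α J₁ J₂ (u.1 ^ 2 * u.2) u.2 (N (pt u) 1) := by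
      have : T * cutRate a b α J₁ J₂ (u.1 ^ 2 * u.2) u.2 (N (pt u) 1) * -(1 / T) =
          -cutRate a b α J₁ J₂ (u.1 ^ 2 * u.2) u.2 (N (pt u) 1) := by
        field_simp
      exact neg_injective (h5.trans this)
    rw [h7, cutRate_eq hu.2.1.ne' h6.1 h6.2, mul_inv_cancel_left₀ hu.2.1.ne']
  · have hχ := h.pos
    have hb := h.b_pos
    -- On ρ = 0 the back flow multiplies y by e^{2bt}, so the orbit of this one point covers all y
    -- in [χ/2, χ). The limit is the continuity of its characteristic at s = 0.
    set u : ℝ × ℝ := (0, χ / 2) with hu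
    have huD : u ∈ D := by
      refine ⟨by simp [hu], ?_, ?_⟩ <;> simp only [hu] <;> linarith
    have hu' := hred u huD
    set T := hitTime a b χ u with hT
    have hTpos : 0 < T := hu'.hitTime_pos huD.2.2
    have hY : ∀ t, backY a b u t = χ / 2 * Real.exp (2 * b * t) := by
      intro t; simp [backY, backEps, hu]
    have hR : ∀ t, backRho a b u t = 0 := by intro t; simp [backRho, hu]
    set τ : ℝ → ℝ := fun y => Real.log (y / (χ / 2)) / (2 * b) with hτ
    have hYτ : ∀ y, 0 < y → backY a b u (τ y) = y := by
      intro y hy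
      rw [hY, hτ]
      simp only
      rw [mul_div_cancel₀ _ (by positivity), Real.exp_log (by positivity)]
      field_simp
    have hτ0 : ∀ y, χ / 2 ≤ y → 0 ≤ τ y := fun y hy =>
      div_nonneg (Real.log_nonneg (by rw [le_div_iff₀ (by positivity)]; linarith)) (by positivity)
    have hTτ : T = τ χ := hu'.hitTime_unique (hτ0 χ (by linarith)) (hYτ χ hχ)
    have hτT : ∀ y, 0 < y → y < χ → τ y < T := by
      intro y hy hyχ
      rw [hTτ]
      simp only [hτ]
      gcongr
    have hev : (fun y => N (pt u) (1 - τ y / T)) =ᶠ[𝓝[<] χ] fun y => N (pt (0, y)) 1 := by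
      filter_upwards [Ioo_mem_nhdsLT (by linarith : χ / 2 < χ)] with y hy
      have := hflow u huD (τ y) (hτ0 y hy.1.le) (hτT y (by linarith [hy.1]) hy.2)
      rw [hR, hYτ y (by linarith [hy.1])] at this
      exact this.symm
    refine Tendsto.congr' hev ?_
    have hlim : Tendsto (fun y => 1 - τ y / T) (𝓝[<] χ) (𝓝[Icc 0 1] 0) := by
      refine tendsto_nhdsWithin_iff.2 ⟨?_, ?_⟩
      · have hcont : ContinuousAt (fun y => 1 - τ y / T) χ := by
          have : ContinuousAt (fun y => Real.log (y / (χ / 2))) χ :=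
            ContinuousAt.log (by fun_prop) (by positivity)
          simp only [hτ]
          fun_prop
        have h0 : 1 - τ χ / T = 0 := by rw [← hTτ, div_self hTpos.ne', sub_self]
        have := hcont.tendsto
        rw [h0] at this
        exact this.mono_left nhdsWithin_le_nhds
      · filter_upwards [Ioo_mem_nhdsLT (by linarith : χ / 2 < χ)] with y hy
        have h1 := hτ0 y hy.1.le
        have h2 := hτT y (by linarith [hy.1]) hy.2
        exact ⟨by rw [sub_nonneg, div_le_one hTpos]; exact h2.le,
          by have := div_nonneg h1 hTpos.le; linarith⟩
    have hc0 := (hN χ u T hu' hTpos.le 0 (by simp)).continuousWithinAt.tendsto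
    rw [hN0] at hc0
    exact hc0.comp hlim

end InvariantGraph

end

noncomputable section

/-! ### Smoothness of the invariant graph up to `y = 0` -/

section Boundary

variable {a b α χ l : ℝ}

/-- The field `y • reducedField` in the coordinates `(ρ, y / l)`. -/
def scaledField (a b l : ℝ) (u : ℝ × ℝ) : ℝ × ℝ :=
  (l * u.2) • (u.1 * bracket a b (u.1 ^ 2 * (l * u.2)),
    -(u.2 * (2 * bracket a b (u.1 ^ 2 * (l * u.2)) - u.1 ^ 2 * (l * u.2))))

lemma contDiffAt_bracket {e : ℝ} (h : 1 + a * e ≠ 0) : ContDiffAt ℝ ∞ (bracket a b) e := by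
  unfold bracket
  exact contDiffAt_const.add (ContDiffAt.div (by fun_prop) (by fun_prop) h)

/-- The region on which `scaledField` is smooth. -/
def scaledDomain (a l : ℝ) : Set (ℝ × ℝ) := {u | 0 < 1 + a * (u.1 ^ 2 * (l * u.2))}

lemma isOpen_scaledDomain : IsOpen (scaledDomain a l) :=
  isOpen_lt continuous_const (by fun_prop)

/-- The scale l is one of the variables, so that compactness yields bounds uniform in l down to l =
0. -/
lemma contDiffAt_scaledField_joint {q : ℝ × ℝ × ℝ} (hq : q.2 ∈ scaledDomain a q.1) :
    ContDiffAt ℝ ∞ (fun q : ℝ × ℝ × ℝ => (q.2.2) • (q.2.1 * bracket a b (q.2.1 ^ 2 * (q.1 * q.2.2)),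
      -(q.2.2 * (2 * bracket a b (q.2.1 ^ 2 * (q.1 * q.2.2)) - q.2.1 ^ 2 * (q.1 * q.2.2))))) q := by
  have h1 : ContDiffAt ℝ ∞ (fun q : ℝ × ℝ × ℝ => bracket a b (q.2.1 ^ 2 * (q.1 * q.2.2))) q :=
    ContDiffAt.comp (g := bracket a b) (f := fun q : ℝ × ℝ × ℝ => q.2.1 ^ 2 * (q.1 * q.2.2)) q
      (contDiffAt_bracket (ne_of_gt hq)) (by fun_prop)
  have h2 : ContDiffAt ℝ ∞ (fun q : ℝ × ℝ × ℝ => q.2.1 * bracket a b (q.2.1 ^ 2 * (q.1 * q.2.2))) q :=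
    ContDiffAt.mul (by fun_prop) h1
  have h3 : ContDiffAt ℝ ∞ (fun q : ℝ × ℝ × ℝ => -(q.2.2 * (2 * bracket a b
      (q.2.1 ^ 2 * (q.1 * q.2.2)) - q.2.1 ^ 2 * (q.1 * q.2.2)))) q :=
    (ContDiffAt.mul (by fun_prop) ((contDiffAt_const.mul h1).sub (by fun_prop))).neg
  have h4 : ContDiffAt ℝ ∞ (fun q : ℝ × ℝ × ℝ => q.2.2) q := by fun_prop
  exact h4.smul (h2.prodMk h3)

lemma contDiffOn_scaledField : ContDiffOn ℝ ∞ (scaledField a b l) (scaledDomain a l) := by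
  intro u hu
  have h1 := contDiffAt_scaledField_joint (b := b) (q := (l, u)) hu
  have h2 : ContDiffAt ℝ ∞ (fun u : ℝ × ℝ => (l, u)) u := by fun_prop
  have h3 := (h1.comp u h2).const_smul l
  refine (h3.congr_of_eventuallyEq (.of_forall fun v => ?_)).contDiffWithinAt
  simp [scaledField, mul_assoc]

lemma IsSmall.mem_scaledDomain (h : IsSmall a b α χ) {u : ℝ × ℝ} (hl : 0 ≤ l) (hlχ : l ≤ χ)
    (hu : u ∈ Icc (-1 : ℝ) 1 ×ˢ Icc (0 : ℝ) 1) : u ∈ scaledDomain a l := by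
  have h1 : u.1 ^ 2 ≤ 1 := by rw [sq_le_one_iff_abs_le_one]; exact abs_le.2 hu.1
  have h2 : l * u.2 ≤ l := mul_le_of_le_one_right hl hu.2.2
  have h3 : 0 ≤ l * u.2 := mul_nonneg hl hu.2.1
  have h4 : u.1 ^ 2 * (l * u.2) ≤ 4 * χ := by
    have := mul_le_mul h1 h2 h3 zero_le_one
    have := h.pos
    linarith
  have := h.one_add (mul_nonneg (sq_nonneg u.1) h3) h4
  change 0 < 1 + a * (u.1 ^ 2 * (l * u.2))
  linarith

/-- The scaled field is l times a map smooth in (l, u). Its derivative is thus O(l), which makes the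
commutators harmless to any prescribed order. -/
lemma IsSmall.exists_fderiv_scaledField_le (h : IsSmall a b α χ) :
    ∃ C, 0 ≤ C ∧ ∀ l, 0 ≤ l → l ≤ χ → ∀ u ∈ Icc (-1 : ℝ) 1 ×ˢ Icc (0 : ℝ) 1,
      ‖fderiv ℝ (scaledField a b l) u‖ ≤ l * C := by
  set Z : ℝ × ℝ × ℝ → ℝ × ℝ := fun q => (q.2.2) • (q.2.1 * bracket a b (q.2.1 ^ 2 * (q.1 * q.2.2)),
      -(q.2.2 * (2 * bracket a b (q.2.1 ^ 2 * (q.1 * q.2.2)) - q.2.1 ^ 2 * (q.1 * q.2.2)))) with hZ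
  have hcompact : IsCompact (Icc 0 χ ×ˢ (Icc (-1 : ℝ) 1 ×ˢ Icc (0 : ℝ) 1)) :=
    isCompact_Icc.prod (isCompact_Icc.prod isCompact_Icc)
  have hcd : ∀ q ∈ Icc 0 χ ×ˢ (Icc (-1 : ℝ) 1 ×ˢ Icc (0 : ℝ) 1), ContDiffAt ℝ ∞ Z q :=
    fun q hq => contDiffAt_scaledField_joint (h.mem_scaledDomain hq.1.1 hq.1.2 hq.2)
  have hcont : ContinuousOn (fderiv ℝ Z) (Icc 0 χ ×ˢ (Icc (-1 : ℝ) 1 ×ˢ Icc (0 : ℝ) 1)) :=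
    fun q hq => ((hcd q hq).fderiv_right (m := 0) (by simp)).continuousAt.continuousWithinAt
  obtain ⟨C, hC⟩ := hcompact.exists_bound_of_continuousOn hcont
  have hC0 : 0 ≤ C := (norm_nonneg _).trans
    (hC (0, 0, 0) ⟨⟨le_rfl, h.pos.le⟩, ⟨by norm_num, by norm_num⟩, by norm_num, by norm_num⟩)
  refine ⟨C, hC0, fun l hl hlχ u hu => ?_⟩
  have hq : (l, u) ∈ Icc 0 χ ×ˢ (Icc (-1 : ℝ) 1 ×ˢ Icc (0 : ℝ) 1) := ⟨⟨hl, hlχ⟩, hu⟩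
  have h1 := ((hcd _ hq).differentiableAt (by simp)).hasFDerivAt
  have h2 : HasFDerivAt (fun u : ℝ × ℝ => (l, u)) (ContinuousLinearMap.inr ℝ ℝ (ℝ × ℝ)) u :=
    hasFDerivAt_prodMk_right l u
  have h3 : HasFDerivAt (scaledField a b l)
      (l • (fderiv ℝ Z (l, u) ∘L ContinuousLinearMap.inr ℝ ℝ (ℝ × ℝ))) u := by
    refine ((h1.comp u h2).const_smul l).congr_of_eventuallyEq (.of_forall fun v => ?_)
    simp [scaledField, hZ, mul_assoc]
  rw [h3.fderiv, norm_smul, Real.norm_of_nonneg hl]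
  refine mul_le_mul_of_nonneg_left ?_ hl
  refine (ContinuousLinearMap.opNorm_comp_le _ _).trans ?_
  have := mul_le_mul (hC _ hq) (ContinuousLinearMap.norm_inr_le_one ℝ ℝ (ℝ × ℝ)) (norm_nonneg _) hC0
  simpa using this

lemma IsSmall.reachedFrom (h : IsSmall a b α χ) (hl : 0 < l) (hlχ : l ≤ χ) :
    ReachedFrom (scaledField a b l) (Ioo (-1 : ℝ) 1 ×ˢ Ioo (0 : ℝ) 1)
      (Ioo (-1 : ℝ) 1 ×ˢ Ico (1 / 2 : ℝ) 1) := by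
  intro u hu
  rcases le_or_gt (1 / 2) u.2 with hu2 | hu2
  · refine ⟨0, fun _ => u, fun _ => 1, le_rfl, rfl, ⟨hu.1, hu2, hu.2.2⟩, continuousOn_const,
      fun t ht => ⟨hu, one_pos, ?_⟩⟩
    obtain rfl : t = 0 := by simpa using ht
    rw [Icc_self]
    exact HasFDerivWithinAt.of_subsingleton subsingleton_singleton
  · have hl2 : 0 < l * u.2 := mul_pos hl hu.2.1
    have hu' : ReducedPoint a b α χ (u.1, l * u.2) := by
      refine ⟨h, (abs_le.2 ⟨hu.1.1.le, hu.1.2.le⟩).trans one_le_two, hl2, ?_⟩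
      exact (mul_le_of_le_one_right hl.le hu.2.2.le).trans hlχ
    set v := (u.1, l * u.2) with hv
    have hv2 : v.2 ≤ l / 2 := by simp only [hv]; nlinarith
    obtain ⟨T, hT, hTy⟩ := hu'.exists_backY_eq hv2
    have hback : ∀ t ∈ Icc 0 T, 0 ≤ T - t := fun t ht => by linarith [ht.2]
    have hy : ∀ t ∈ Icc 0 T, backY a b v (T - t) ≤ l / 2 := fun t ht => by
      rw [← hTy]
      exact hu'.strictMonoOn_backY.monotoneOn (hback t ht) hT (by linarith [ht.1])
    have hd : ∀ t ∈ Icc 0 T, HasDerivAt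
        (fun t => (backRho a b v (T - t), backY a b v (T - t) / l))
        ((backRho a b v (T - t) * bracket a b (backEps (v.1 ^ 2 * v.2) (T - t))),
          -(backY a b v (T - t) * (2 * bracket a b (backEps (v.1 ^ 2 * v.2) (T - t)) -
            backEps (v.1 ^ 2 * v.2) (T - t)) / l)) t := by
      intro t ht
      have hsub : HasDerivAt (fun t : ℝ => T - t) (-1) t := by
        simpa using (hasDerivAt_id t).const_sub T
      have h1 := (hu'.hasDerivAt_backRho (hback t ht)).comp t hsub
      have h2 := ((hu'.hasDerivAt_backY (hback t ht)).comp t hsub).div_const l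
      refine (h1.prodMk h2).congr_deriv ?_
      ext
      · simp
      · simp only; ring
    -- The back orbit, run in reverse from the level y = l/2. The factor κ is 1/y because
    -- `scaledField` is the reduced field multiplied by y.
    refine ⟨T, fun t => (backRho a b v (T - t), backY a b v (T - t) / l),
      fun t => (backY a b v (T - t))⁻¹, hT, ?_, ⟨?_, ?_⟩, ?_, ?_⟩
    · simp only [sub_self, backRho_zero hu', backY_zero hu']
      ext
      · rfl
      · simp only [hv]; field_simp
    · refine abs_lt.1 (lt_of_le_of_lt ?_ (abs_lt.2 hu.1))
      simpa [hv] using hu'.abs_backRho_le (t := T) hT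
    · simp only [sub_zero, hTy]
      rw [div_right_comm, div_self hl.ne']
      norm_num
    · intro t ht
      have h1 : ContinuousAt (fun t => backY a b v (T - t)) t :=
        ContinuousAt.comp (g := backY a b v) (hu'.hasDerivAt_backY (hback t ht)).continuousAt
          (by fun_prop)
      exact (h1.inv₀ (hu'.backY_pos (hback t ht)).ne').continuousWithinAt
    · intro t ht
      have hpos := hu'.backY_pos (hback t ht)
      refine ⟨⟨abs_lt.1 ((hu'.abs_backRho_le (hback t ht)).trans_lt (abs_lt.2 hu.1)),
        div_pos hpos hl, ?_⟩, inv_pos.2 hpos, ?_⟩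
      · rw [div_lt_one hl]
        have := hy t ht
        linarith
      · refine (hd t ht).hasDerivWithinAt.congr_deriv ?_
        have e1 : l * (backY a b v (T - t) / l) = backY a b v (T - t) := by field_simp
        simp only [scaledField, e1, hu'.backRho_sq_mul (hback t ht), smul_smul]
        rw [inv_mul_cancel₀ hpos.ne', one_smul]
        ext
        · rfl
        · simp only; ring

end Boundary

end

noncomputable section

/-! ### Derivative bounds for the invariant graph and its extension to y = 0. -/

section CenterGraph

variable {a b α χ l : ℝ}

lemma box_bounds {n : ℝ} (hb : 0 < b) (hn : |b * n - 1| ≤ 1 / 4) :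
    0 < n ∧ n ≤ 5 / (4 * b) ∧ 4 * b / 5 ≤ n⁻¹ ∧ n⁻¹ ≤ 4 * b / 3 := by
  have h := abs_le.1 hn
  have h0 : 0 < n := by
    by_contra h1
    have := mul_nonpos_of_nonneg_of_nonpos hb.le (not_lt.1 h1)
    linarith
  refine ⟨h0, ?_, ?_, ?_⟩
  · rw [le_div_iff₀ (by positivity)]; linarith
  · rw [← one_div, le_div_iff₀ h0]; linarith
  · rw [inv_le_iff_one_le_mul₀ h0]; linarith

lemma hasDerivAt_flowRate {e y n : ℝ} (hn : n ≠ 0) :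
    HasDerivAt (flowRate a b α e y) (-((1 + α * e) * (n⁻¹) ^ 2) + bracket a b e * y) n := by
  have h1 : HasDerivAt (fun n => (1 + α * e) / n) (-((1 + α * e) * (n⁻¹) ^ 2)) n := by
    refine ((hasDerivAt_const n (1 + α * e)).div (hasDerivAt_id n) hn).congr_deriv ?_
    simp only [id]
    field_simp
    ring
  have h2 : HasDerivAt (fun n => bracket a b e * y * n) (bracket a b e * y) n := by
    simpa using (hasDerivAt_id n).const_mul (bracket a b e * y)
  exact (h1.sub_const (bracket a b e - e)).add h2

/-- The term -1/n² is at most -(4b/5)² in the box. This is the dissipation which the derivative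
bounds rest on. -/
lemma IsSmall.flowRate_deriv_le (h : IsSmall a b α χ) {e y n : ℝ} (he : 0 ≤ e) (he' : e ≤ 4 * χ)
    (hy : 0 ≤ y) (hy' : y ≤ χ) (hn : |b * n - 1| ≤ 1 / 4) :
    -((1 + α * e) * (n⁻¹) ^ 2) + bracket a b e * y ≤ -(b ^ 2 / 2) := by
  have hb := h.b_pos
  obtain ⟨h1, h2, h3⟩ := h.bracket_mem he he'
  obtain ⟨h4, h5⟩ := h.α_mem he he'
  obtain ⟨n0, -, n1, -⟩ := box_bounds hb hn
  have h6 : (4 * b / 5) ^ 2 ≤ n⁻¹ ^ 2 := pow_le_pow_left₀ (by positivity) n1 2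
  have h7 : 7 / 8 * (4 * b / 5) ^ 2 ≤ (1 + α * e) * n⁻¹ ^ 2 :=
    mul_le_mul h4 h6 (by positivity) (by linarith)
  have h8 : bracket a b e * y ≤ 65 / 64 * b * (b / 256) :=
    mul_le_mul h2 (by have := h.le_b; linarith) hy (by positivity)
  nlinarith

/-- At y = 0 the rate is 1/n - b and vanishes only at n = 1/b, so a small rate and a small y force n
to be near 1/b. -/
lemma IsSmall.abs_sub_le_flowRate (h : IsSmall a b α χ) {e y n : ℝ} (he : 0 ≤ e) (hey : e ≤ y)
    (hy' : y ≤ χ) (hn : |b * n - 1| ≤ 1 / 4) :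
    |n - b⁻¹| ≤ 5 / (4 * b ^ 2) * (|flowRate a b α e y n| + (|α| * (4 * b / 3) + 4) * y) := by
  have hb := h.b_pos
  have hχ := h.pos
  have he' : e ≤ 4 * χ := by linarith
  have hy : 0 ≤ y := he.trans hey
  have h0 := abs_le.1 (h.abs_bracket_sub_le he he')
  obtain ⟨h1, h2, h3⟩ := h.bracket_mem he he'
  obtain ⟨n0, n1, n2, n3⟩ := box_bounds hb hn
  have e1 : n - b⁻¹ = n / b * (b - n⁻¹) := by field_simp
  have e2 : b - n⁻¹ = -flowRate a b α e y n + (α * e * n⁻¹ - (bracket a b e - b) + e +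
      bracket a b e * n * y) := by
    unfold flowRate; field_simp; ring
  have h4 : |α * e * n⁻¹| ≤ |α| * (4 * b / 3) * y := by
    rw [abs_mul, abs_mul, abs_of_nonneg he, abs_of_pos (inv_pos.2 n0)]
    calc |α| * e * n⁻¹ ≤ |α| * y * (4 * b / 3) := by gcongr
      _ = _ := by ring
  have h4' := abs_le.1 h4
  have h5 : bracket a b e * n ≤ 65 / 64 * b * (5 / (4 * b)) :=
    mul_le_mul h2 n1 n0.le (by positivity)
  have h5' : 65 / 64 * b * (5 / (4 * b)) ≤ 2 := by
    have : 65 / 64 * b * (5 / (4 * b)) = 65 / 64 * (5 / 4) := by field_simp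
    rw [this]; norm_num
  have h6 : bracket a b e * n * y ≤ 2 * y := mul_le_mul_of_nonneg_right (h5.trans h5') hy
  have h6' : 0 ≤ bracket a b e * n * y :=
    mul_nonneg (mul_nonneg (by linarith) n0.le) hy
  have h7 : |b - n⁻¹| ≤ |flowRate a b α e y n| + (|α| * (4 * b / 3) + 4) * y := by
    rw [e2]
    refine (abs_add_le _ _).trans ?_
    rw [abs_neg]
    refine add_le_add le_rfl (abs_le.2 ⟨?_, ?_⟩) <;> linarith
  rw [e1, abs_mul, abs_of_pos (div_pos n0 hb)]
  refine mul_le_mul ?_ h7 (abs_nonneg _) (by positivity)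
  rw [div_le_iff₀ hb]
  calc n ≤ 5 / (4 * b) := n1
    _ = 5 / (4 * b ^ 2) * b := by field_simp

variable {m : ℝ × ℝ → ℝ}

/-- The conclusions of `exists_invariant_graph`. -/
structure IsInvariantGraph (a b α χ : ℝ) (m : ℝ × ℝ → ℝ) : Prop where
  small : IsSmall a b α χ
  contDiffOn : ContDiffOn ℝ ∞ m (Ioo (-2) 2 ×ˢ Ioo 0 χ)
  box : ∀ u ∈ Ioo (-2 : ℝ) 2 ×ˢ Ioo 0 χ, |b * m u - 1| ≤ 1 / 4
  eq : ∀ u ∈ Ioo (-2 : ℝ) 2 ×ˢ Ioo 0 χ, u.2 * fderiv ℝ m u (reducedField a b u) =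
    flowRate a b α (u.1 ^ 2 * u.2) u.2 (m u)

/-- The rescaling of the variable `y`. -/
def scaleY (l : ℝ) : ℝ × ℝ →L[ℝ] ℝ × ℝ :=
  (ContinuousLinearMap.fst ℝ ℝ ℝ).prod (l • ContinuousLinearMap.snd ℝ ℝ ℝ)

@[simp] lemma scaleY_apply (l : ℝ) (u : ℝ × ℝ) : scaleY l u = (u.1, l * u.2) := rfl

lemma scaleY_mem (hl : 0 < l) (hlχ : l < χ) {u : ℝ × ℝ}
    (hu : u ∈ Ioo (-1 : ℝ) 1 ×ˢ Ioo (0 : ℝ) 1) : scaleY l u ∈ Ioo (-2 : ℝ) 2 ×ˢ Ioo 0 χ := by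
  refine ⟨⟨?_, ?_⟩, mul_pos hl hu.2.1, ?_⟩
  · change -2 < u.1
    linarith [hu.1.1]
  · change u.1 < 2
    linarith [hu.1.2]
  · have := mul_lt_mul_of_pos_left hu.2.2 hl
    change l * u.2 < χ
    linarith

lemma IsInvariantGraph.hasFDerivAt (h : IsInvariantGraph a b α χ m) {u : ℝ × ℝ}
    (hu : u ∈ Ioo (-2 : ℝ) 2 ×ˢ Ioo 0 χ) : HasFDerivAt m (fderiv ℝ m u) u :=
  ((h.contDiffOn.contDiffAt ((isOpen_Ioo.prod isOpen_Ioo).mem_nhds hu)).differentiableAt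
    (by simp)).hasFDerivAt

lemma IsInvariantGraph.scaled_eq (h : IsInvariantGraph a b α χ m) (hl : 0 < l) (hlχ : l < χ)
    {u : ℝ × ℝ} (hu : u ∈ Ioo (-1 : ℝ) 1 ×ˢ Ioo (0 : ℝ) 1) :
    fderiv ℝ (fun u => m (scaleY l u)) u (scaledField a b l u) =
      flowRate a b α (u.1 ^ 2 * (l * u.2)) (l * u.2) (m (scaleY l u)) := by
  have h1 := h.eq _ (scaleY_mem hl hlχ hu)
  have h2 : HasFDerivAt (fun u => m (scaleY l u)) (fderiv ℝ m (scaleY l u) ∘L scaleY l) u :=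
    (h.hasFDerivAt (scaleY_mem hl hlχ hu)).comp u (ContinuousLinearMap.hasFDerivAt _)
  rw [h2.fderiv]
  have h3 : scaleY l (scaledField a b l u) = (l * u.2) • reducedField a b (scaleY l u) := by
    ext
    · simp [scaledField, reducedField]
    · simp [scaledField, reducedField]; ring
  rw [ContinuousLinearMap.comp_apply, h3, map_smul, smul_eq_mul]
  exact h1

/-- For every `n` the derivatives of order at most `n` of the graph are bounded near `y = 0`. -/
lemma IsInvariantGraph.exists_bddDerivs (h : IsInvariantGraph a b α χ m) (N : ℕ) :
    ∃ l, 0 < l ∧ l < χ ∧ ContDiffOn ℝ ∞ (fun u => m (scaleY l u))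
        (Ioo (-1 : ℝ) 1 ×ˢ Ioo (0 : ℝ) 1) ∧
      BddDerivs (N + 1) (fun u => m (scaleY l u)) (Ioo (-1 : ℝ) 1 ×ˢ Ioo (0 : ℝ) 1)
        (Ioo (-1 : ℝ) 1 ×ˢ Ioo (0 : ℝ) 1) := by
  have hs := h.small
  have hb := hs.b_pos
  have hχ := hs.pos
  obtain ⟨C, hC0, hC⟩ := hs.exists_fderiv_scaledField_le
  -- The commutators cost at most l C per order; l is chosen so that N + 1 of them use at most half
  -- of the dissipation b²/2.
  obtain ⟨l, hl, hlχ, hlN⟩ : ∃ l, 0 < l ∧ l < χ ∧ (N + 1) * (l * C) ≤ b ^ 2 / 2 / 2 := by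
    set D := (N + 1) * C + 1 with hD
    have hD1 : 1 ≤ D := by have := mul_nonneg (by positivity : (0 : ℝ) ≤ N + 1) hC0; linarith
    refine ⟨min (χ / 2) (b ^ 2 / 2 / 2 / D), by positivity,
      (min_le_left _ _).trans_lt (by linarith), ?_⟩
    have h1 : min (χ / 2) (b ^ 2 / 2 / 2 / D) * D ≤ b ^ 2 / 2 / 2 :=
      (le_div_iff₀ (by positivity)).1 (min_le_right _ _)
    have h2 : 0 < min (χ / 2) (b ^ 2 / 2 / 2 / D) := by positivity
    calc (N + 1) * (min (χ / 2) (b ^ 2 / 2 / 2 / D) * C)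
        = min (χ / 2) (b ^ 2 / 2 / 2 / D) * (D - 1) := by rw [hD]; ring
      _ ≤ _ := by nlinarith
  set S := Ioo (-1 : ℝ) 1 ×ˢ Ioo (0 : ℝ) 1 with hSdef
  set Q := Icc (-1 : ℝ) 1 ×ˢ Icc (0 : ℝ) 1 with hQ
  have hSQ : S ⊆ Q := prod_mono Ioo_subset_Icc_self Ioo_subset_Icc_self
  have hQc : IsCompact Q := isCompact_Icc.prod isCompact_Icc
  have hS : IsOpen S := isOpen_Ioo.prod isOpen_Ioo
  set D : Set (ℝ × ℝ) := Ioo (-2) 2 ×ˢ Ioo 0 χ with hD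
  have hDo : IsOpen D := isOpen_Ioo.prod isOpen_Ioo
  have hmaps : MapsTo (scaleY l) S D := fun u hu => scaleY_mem hl hlχ hu
  have hmc : ContDiffOn ℝ ∞ (fun u => m (scaleY l u)) (scaleY l ⁻¹' D) :=
    h.contDiffOn.comp ((ContinuousLinearMap.contDiff (scaleY l)).contDiffOn) fun _ hu => hu
  have hpre : IsOpen (scaleY l ⁻¹' D) := hDo.preimage (ContinuousLinearMap.continuous _)
  have hm : ContDiffOn ℝ ∞ (fun u => m (scaleY l u)) S := hmc.mono hmaps
  have hQO : Q ⊆ scaledDomain a l := fun u hu => hs.mem_scaledDomain hl.le hlχ.le hu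
  have hY := contDiffOn_scaledField (a := a) (b := b) (l := l)
  refine ⟨l, hl, hlχ, hm, ?_⟩
  have heps : ∀ u ∈ S, 0 ≤ u.1 ^ 2 * (l * u.2) ∧ u.1 ^ 2 * (l * u.2) ≤ 4 * χ ∧ 0 ≤ l * u.2 ∧
      l * u.2 ≤ χ := by
    intro u hu
    have h1 : u.1 ^ 2 ≤ 1 := by
      rw [sq_le_one_iff_abs_le_one]; exact abs_le.2 ⟨hu.1.1.le, hu.1.2.le⟩
    have h2 : l * u.2 ≤ l := mul_le_of_le_one_right hl.le hu.2.2.le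
    have h3 : 0 ≤ l * u.2 := mul_nonneg hl.le hu.2.1.le
    have := mul_le_mul h1 h2 h3 zero_le_one
    exact ⟨mul_nonneg (sq_nonneg _) h3, by linarith, h3, by linarith⟩
  set H : (ℝ × ℝ) × ℝ → ℝ := fun q => flowRate a b α (q.1.1 ^ 2 * (l * q.1.2)) (l * q.1.2) q.2 with hH
  have hHc : ContDiffOn ℝ ∞ H (scaledDomain a l ×ˢ Ioi 0) := by
    intro q hq
    have h1 : ContDiffAt ℝ ∞ (fun q : (ℝ × ℝ) × ℝ => bracket a b (q.1.1 ^ 2 * (l * q.1.2))) q :=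
      ContDiffAt.comp (g := bracket a b) (f := fun q : (ℝ × ℝ) × ℝ => q.1.1 ^ 2 * (l * q.1.2)) q
        (contDiffAt_bracket (ne_of_gt hq.1)) (by fun_prop)
    have h2 : ContDiffAt ℝ ∞ (fun q : (ℝ × ℝ) × ℝ =>
        (1 + α * (q.1.1 ^ 2 * (l * q.1.2))) / q.2) q :=
      ContDiffAt.div (by fun_prop) (by fun_prop) (ne_of_gt hq.2)
    refine ContDiffAt.contDiffWithinAt ?_
    exact (h2.sub (h1.sub (by fun_prop))).add ((h1.mul (by fun_prop)).mul (by fun_prop))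
  have hHo : IsOpen (scaledDomain a l ×ˢ Ioi (0 : ℝ)) := isOpen_scaledDomain.prod isOpen_Ioi
  have hCO : Q ×ˢ Icc (3 / (4 * b)) (5 / (4 * b)) ⊆ scaledDomain a l ×ˢ Ioi (0 : ℝ) :=
    fun q hq => ⟨hQO hq.1, lt_of_lt_of_le (by positivity) hq.2.1⟩
  have hmem : ∀ u ∈ S, (u, m (scaleY l u)) ∈ Q ×ˢ Icc (3 / (4 * b)) (5 / (4 * b)) := by
    intro u hu
    have h1 := abs_le.1 (h.box _ (hmaps hu))
    refine ⟨hSQ hu, ?_, ?_⟩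
    · rw [div_le_iff₀ (by positivity)]; linarith
    · rw [le_div_iff₀ (by positivity)]; linarith
  -- The curves start in the upper half of the strip. As l < χ, its closure lies in the open region
  -- where m is already smooth, and compactness bounds the derivatives there.
  refine bddDerivs_of_semilinear hS (K := Ioo (-1 : ℝ) 1 ×ˢ Ico (1 / 2 : ℝ) 1)
    (prod_mono subset_rfl fun y hy => ⟨by linarith [hy.1], hy.2⟩) (hs.reachedFrom hl hlχ.le)
    (hY.mono (hSQ.trans hQO)) (β₀ := b ^ 2 / 2) (q₁ := l * C) (by positivity)
    (mul_nonneg hl.le hC0) (fun u hu => hC l hl.le hlχ.le u (hSQ hu)) hm (H := H) hHo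
    (hQc.prod isCompact_Icc) hCO hHc hmem ?_ ?_ hlN ?_ ?_ ?_
  · exact fun u hu => h.scaled_eq hl hlχ hu
  · intro u hu
    obtain ⟨e1, e2, e3, e4⟩ := heps u hu
    have hbox := h.box _ (hmaps hu)
    have h1 := ((hHc.contDiffAt (hHo.mem_nhds (hCO (hmem u hu)))).differentiableAt
      (by simp)).hasFDerivAt
    have h2 : HasDerivAt (fun n : ℝ => (u, n)) ((0 : ℝ × ℝ), (1 : ℝ)) (m (scaleY l u)) :=
      (hasDerivAt_const _ u).prodMk (hasDerivAt_id _)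
    have h3 : HasDerivAt (flowRate a b α (u.1 ^ 2 * (l * u.2)) (l * u.2))
      (fderiv ℝ H (u, m (scaleY l u)) (0, 1)) (m (scaleY l u)) := h1.comp_hasDerivAt _ h2
    rw [h3.unique (hasDerivAt_flowRate (box_bounds hb hbox).1.ne')]
    exact hs.flowRate_deriv_le e1 e2 e3 e4 hbox
  · exact bddDerivs_of_isCompact isOpen_scaledDomain
      (hY.fderiv_of_isOpen isOpen_scaledDomain (by simp)) hQc hQO hS (hSQ.trans hQO) subset_rfl hSQ
  · exact bddDerivs_of_isCompact isOpen_univ contDiffOn_id hQc (subset_univ _) hS (subset_univ _)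
      subset_rfl hSQ
  · refine bddDerivs_of_isCompact (K := Icc (-1 : ℝ) 1 ×ˢ Icc (1 / 2 : ℝ) 1) hpre hmc
      (isCompact_Icc.prod isCompact_Icc) ?_ hS hmaps
      (prod_mono subset_rfl fun y hy => ⟨by linarith [hy.1], hy.2⟩)
      (prod_mono Ioo_subset_Icc_self Ico_subset_Icc_self)
    intro u hu
    have h1 : 0 < l * u.2 := mul_pos hl (by linarith [hu.2.1])
    have h2 : l * u.2 ≤ l := mul_le_of_le_one_right hl.le hu.2.2
    exact ⟨⟨by change -2 < u.1; linarith [hu.1.1], by change u.1 < 2; linarith [hu.1.2]⟩, h1,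
      by change l * u.2 < χ; linarith⟩

/-- For y < l the derivative of m is bounded and the transport field is O(y), so the rate `flowRate`
is O(y), and m - 1/b with it. For y ≥ l the box bound suffices. -/
lemma IsInvariantGraph.abs_sub_le (h : IsInvariantGraph a b α χ m) :
    ∃ K, ∀ u ∈ Ioo (-1 : ℝ) 1 ×ˢ Ioo 0 χ, |m u - b⁻¹| ≤ K * u.2 := by
  have hs := h.small
  have hb := hs.b_pos
  obtain ⟨l, hl, hlχ, -, hbd⟩ := h.exists_bddDerivs 0
  obtain ⟨C, hC⟩ := ((bddDerivs_succ (isOpen_Ioo.prod isOpen_Ioo) subset_rfl).1 hbd).2.bound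
  set K₁ := 5 / (4 * b ^ 2) * (C * (3 * b) + (|α| * (4 * b / 3) + 4)) with hK₁
  set K₂ := (4 * b * l)⁻¹ with hK₂
  refine ⟨max K₁ K₂, fun u hu => ?_⟩
  have hy := hu.2.1
  have huD : u ∈ Ioo (-2 : ℝ) 2 ×ˢ Ioo 0 χ :=
    ⟨⟨by linarith [hu.1.1], by linarith [hu.1.2]⟩, hu.2⟩
  have hbox := h.box u huD
  rcases lt_or_ge u.2 l with hul | hul
  · refine le_trans ?_ (mul_le_mul_of_nonneg_right (le_max_left _ _) hy.le)
    have h1 : u.1 ^ 2 ≤ 1 := by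
      rw [sq_le_one_iff_abs_le_one]; exact abs_le.2 ⟨hu.1.1.le, hu.1.2.le⟩
    have he : 0 ≤ u.1 ^ 2 * u.2 := mul_nonneg (sq_nonneg _) hy.le
    have hey : u.1 ^ 2 * u.2 ≤ u.2 := mul_le_of_le_one_left hy.le h1
    obtain ⟨b1, b2, b3⟩ := hs.bracket_mem he (by linarith [hu.2.2, hs.pos])
    set v : ℝ × ℝ := (u.1, u.2 / l) with hv
    have hv2 : l * v.2 = u.2 := by simp only [hv]; field_simp
    have hvS : v ∈ Ioo (-1 : ℝ) 1 ×ˢ Ioo (0 : ℝ) 1 :=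
      ⟨hu.1, div_pos hy hl, (div_lt_one hl).2 hul⟩
    have hvu : scaleY l v = u := by rw [scaleY_apply, hv2]
    have heq := h.scaled_eq hl hlχ hvS
    rw [hvu, hv2] at heq
    have hY : ‖scaledField a b l v‖ ≤ u.2 * (3 * b) := by
      rw [scaledField, hv2, norm_smul, Real.norm_of_nonneg hy.le]
      refine mul_le_mul_of_nonneg_left ?_ hy.le
      refine norm_prod_le_iff.2 ⟨?_, ?_⟩
      · simp only [hv]
        rw [norm_mul, Real.norm_eq_abs, Real.norm_eq_abs,
          abs_of_nonneg (by linarith : 0 ≤ bracket a b (u.1 ^ 2 * u.2))]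
        have := mul_le_mul (abs_le.2 ⟨hu.1.1.le, hu.1.2.le⟩) b2 (by linarith) zero_le_one
        linarith
      · simp only [norm_neg]
        have e0 : 0 ≤ 2 * bracket a b (v.1 ^ 2 * u.2) - v.1 ^ 2 * u.2 := by
          simp only [hv]; linarith
        have e1 : 2 * bracket a b (v.1 ^ 2 * u.2) - v.1 ^ 2 * u.2 ≤ 3 * b := by
          simp only [hv]; linarith
        rw [Real.norm_of_nonneg (mul_nonneg hvS.2.1.le e0)]
        have := mul_le_mul hvS.2.2.le e1 e0 zero_le_one
        linarith
    have hflow : |flowRate a b α (u.1 ^ 2 * u.2) u.2 (m u)| ≤ C * (3 * b) * u.2 := by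
      have e : flowRate a b α (u.1 ^ 2 * u.2) u.2 (m u) =
          fderiv ℝ (fun u => m (scaleY l u)) v (scaledField a b l v) := heq.symm
      rw [e, ← Real.norm_eq_abs]
      refine (ContinuousLinearMap.le_opNorm _ _).trans ?_
      have := mul_le_mul (hC v hvS) hY (norm_nonneg _) ((norm_nonneg _).trans (hC v hvS))
      linarith
    refine (hs.abs_sub_le_flowRate he hey hu.2.2.le hbox).trans ?_
    rw [hK₁, mul_assoc]
    refine mul_le_mul_of_nonneg_left ?_ (by positivity)
    linarith
  · refine le_trans ?_ (mul_le_mul_of_nonneg_right (le_max_right _ _) hy.le)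
    have e1 : m u - b⁻¹ = b⁻¹ * (b * m u - 1) := by field_simp
    rw [e1, abs_mul, abs_of_pos (inv_pos.2 hb), hK₂]
    calc b⁻¹ * |b * m u - 1| ≤ b⁻¹ * (1 / 4) := by gcongr
      _ = (4 * b * l)⁻¹ * l := by field_simp
      _ ≤ (4 * b * l)⁻¹ * u.2 := by gcongr

/-- The extension of the graph by its limit to `y ≤ 0`. -/
def extendGraph (b : ℝ) (m : ℝ × ℝ → ℝ) (u : ℝ × ℝ) : ℝ :=
  open Classical in if 0 < u.2 then m u else b⁻¹

lemma extendGraph_of_pos {u : ℝ × ℝ} (hu : 0 < u.2) : extendGraph b m u = m u := if_pos hu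

lemma extendGraph_of_eq_zero {u : ℝ × ℝ} (hu : u.2 = 0) : extendGraph b m u = b⁻¹ :=
  if_neg (by rw [hu]; exact lt_irrefl _)

lemma IsInvariantGraph.abs_extendGraph_sub_le (h : IsInvariantGraph a b α χ m) :
    ∃ K, ∀ u ∈ Ioo (-1 : ℝ) 1 ×ˢ Ico 0 χ, |extendGraph b m u - b⁻¹| ≤ K * u.2 := by
  obtain ⟨K, hK⟩ := h.abs_sub_le
  refine ⟨K, fun u hu => ?_⟩
  rcases hu.2.1.eq_or_lt with h0 | h0
  · rw [extendGraph_of_eq_zero h0.symm, ← h0]; simp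
  · rw [extendGraph_of_pos h0]
    exact hK u ⟨hu.1, h0, hu.2.2⟩

lemma IsInvariantGraph.extendGraph_box (h : IsInvariantGraph a b α χ m) {u : ℝ × ℝ}
    (hu : u ∈ Ioo (-2 : ℝ) 2 ×ˢ Ico 0 χ) : |b * extendGraph b m u - 1| ≤ 1 / 4 := by
  rcases hu.2.1.eq_or_lt with h0 | h0
  · rw [extendGraph_of_eq_zero h0.symm, mul_inv_cancel₀ h.small.b_pos.ne']; norm_num
  · rw [extendGraph_of_pos h0]
    exact h.box u ⟨hu.1, h0, hu.2.2⟩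

/-- At y = 0 each order n is treated on its own strip 0 ≤ y < l, where the abstract extension has
the boundary value 1/b by `IsInvariantGraph.abs_sub_le`. -/
theorem IsInvariantGraph.contDiffOn_extendGraph (h : IsInvariantGraph a b α χ m) :
    ContDiffOn ℝ ∞ (extendGraph b m) (Ico 0 1 ×ˢ Ico 0 χ) := by
  intro u hu
  rcases hu.2.1.eq_or_lt with h0 | h0
  · refine contDiffWithinAt_infty.2 fun n => ?_
    obtain ⟨l, hl, hlχ, hc, hbd⟩ := h.exists_bddDerivs n
    set S := Ioo (-1 : ℝ) 1 ×ˢ Ioo (0 : ℝ) 1 with hS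
    have hSo : IsOpen S := isOpen_Ioo.prod isOpen_Ioo
    have hext := contDiffOn_extendFrom hSo ((convex_Ioo _ _).prod (convex_Ioo _ _)) n hc hbd
    have hcl : closure S = Icc (-1 : ℝ) 1 ×ˢ Icc (0 : ℝ) 1 := by
      rw [hS, closure_prod_eq, closure_Ioo (by norm_num), closure_Ioo (by norm_num)]
    have hmaps : MapsTo (scaleY l⁻¹) (Ico 0 1 ×ˢ Ico 0 l) (closure S) := by
      intro v hv
      rw [hcl]
      refine ⟨⟨by change -1 ≤ v.1; linarith [hv.1.1], hv.1.2.le⟩,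
        mul_nonneg (inv_nonneg.2 hl.le) hv.2.1, ?_⟩
      change l⁻¹ * v.2 ≤ 1
      rw [inv_mul_le_one₀ hl]
      exact hv.2.2.le
    have hsc : ∀ v : ℝ × ℝ, scaleY l (scaleY l⁻¹ v) = v := by
      intro v
      ext
      · rfl
      · simp [hl.ne']
    have hEq : EqOn (extendGraph b m)
        (extendFrom S (fun u => m (scaleY l u)) ∘ scaleY l⁻¹) (Ico 0 1 ×ˢ Ico 0 l) := by
      intro v hv
      rcases hv.2.1.eq_or_lt with hv0 | hv0
      · rw [extendGraph_of_eq_zero hv0.symm]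
        symm
        have hw : scaleY l⁻¹ v ∈ closure S := hmaps hv
        refine extendFrom_eq hw ?_
        obtain ⟨K, hK⟩ := h.abs_sub_le
        have hlim : Tendsto (fun w : ℝ × ℝ => K * (l * w.2)) (𝓝[S] (scaleY l⁻¹ v)) (𝓝 0) := by
          have : ContinuousAt (fun w : ℝ × ℝ => K * (l * w.2)) (scaleY l⁻¹ v) := by fun_prop
          have h1 := this.tendsto.mono_left (nhdsWithin_le_nhds (s := S))
          simpa [← hv0] using h1
        rw [tendsto_iff_norm_sub_tendsto_zero]
        refine squeeze_zero' (.of_forall fun _ => norm_nonneg _) ?_ hlim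
        filter_upwards [self_mem_nhdsWithin] with w hw
        refine hK (scaleY l w) ⟨hw.1, mul_pos hl hw.2.1, ?_⟩
        have := mul_lt_mul_of_pos_left hw.2.2 hl
        change l * w.2 < χ
        linarith
      · rw [extendGraph_of_pos hv0]
        have hw : scaleY l⁻¹ v ∈ S := by
          refine ⟨⟨by change -1 < v.1; linarith [hv.1.1], hv.1.2⟩,
            mul_pos (inv_pos.2 hl) hv0, ?_⟩
          change l⁻¹ * v.2 < 1
          rw [inv_mul_lt_iff₀ hl, mul_one]
          exact hv.2.2
        rw [Function.comp_apply, extendFrom_eqOn hc.continuousOn hw]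
        exact (congrArg m (hsc v)).symm
    have huQ : u ∈ Ico (0 : ℝ) 1 ×ˢ Ico 0 l := ⟨hu.1, hu.2.1, by rw [← h0]; exact hl⟩
    have h1 : ContDiffWithinAt ℝ n (extendGraph b m) (Ico 0 1 ×ˢ Ico 0 l) u :=
      ((hext.comp (ContinuousLinearMap.contDiff (scaleY l⁻¹)).contDiffOn hmaps).congr hEq) u huQ
    refine h1.mono_of_mem_nhdsWithin ?_
    have h2 : (univ ×ˢ Iio l : Set (ℝ × ℝ)) ∈ 𝓝 u :=
      (isOpen_univ.prod isOpen_Iio).mem_nhds ⟨mem_univ _, huQ.2.2⟩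
    filter_upwards [self_mem_nhdsWithin, mem_nhdsWithin_of_mem_nhds h2] with v hv hv2
    exact ⟨hv.1, hv.2.1, hv2.2⟩
  · have huD : u ∈ Ioo (-2 : ℝ) 2 ×ˢ Ioo 0 χ :=
      ⟨⟨by linarith [hu.1.1], by linarith [hu.1.2]⟩, h0, hu.2.2⟩
    have hD := (isOpen_Ioo.prod isOpen_Ioo).mem_nhds huD
    refine ((h.contDiffOn.contDiffAt hD).congr_of_eventuallyEq ?_).contDiffWithinAt
    filter_upwards [hD] with v hv
    exact extendGraph_of_pos hv.2.1

end CenterGraph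

end

/-! ### Scalar linear differential equations -/

section ScalarLinear

variable {f c : ℝ → ℝ}

lemma le_of_hasDerivWithinAt_nonneg {f' : ℝ → ℝ} {s t : ℝ} (hst : s ≤ t)
    (hf : ∀ x ∈ Icc s t, HasDerivWithinAt f (f' x) (Icc s t) x) (hf' : ∀ x ∈ Icc s t, 0 ≤ f' x) :
    f s ≤ f t := by
  refine monotoneOn_of_deriv_nonneg (convex_Icc s t) (fun x hx => (hf x hx).continuousWithinAt)
    (fun x hx => ?_) (fun x hx => ?_) (left_mem_Icc.2 hst) (right_mem_Icc.2 hst) hst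
  · exact ((hf x (interior_subset hx)).mono interior_subset).differentiableWithinAt
  · have h := (hf x (interior_subset hx)).hasDerivAt (mem_interior_iff_mem_nhds.1 hx)
    rw [h.deriv]
    exact hf' x (interior_subset hx)

/-- Zeros and signs of a solution persist in both directions of time; this is how y = 0 and y > 0
are propagated along orbits. -/
lemma exists_exp_of_linear {s t : ℝ} (hc : ContinuousOn c (Icc s t))
    (hf : ∀ x ∈ Icc s t, HasDerivWithinAt f (c x * f x) (Icc s t) x) :
    ∃ A : ℝ → ℝ, ∀ x ∈ Icc s t, ∀ y ∈ Icc s t, f y = f x * Real.exp (A y - A x) := by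
  rcases le_or_gt s t with hst | hst
  · obtain ⟨A, -, -, hA⟩ := exists_primitive hst hc
    have hd : ∀ x ∈ Icc s t, HasDerivWithinAt (fun x => f x * Real.exp (-A x)) 0 (Icc s t) x := by
      intro x hx
      have h1 := (hA x hx).1
      rw [(hA x hx).2] at h1
      refine ((hf x hx).mul h1.neg.exp.hasDerivWithinAt).congr_deriv ?_
      simp only [Pi.neg_apply]
      ring
    have hconst : ∀ x ∈ Icc s t, f x * Real.exp (-A x) = f s * Real.exp (-A s) :=
      constant_of_has_deriv_right_zero (fun x hx => (hd x hx).continuousWithinAt)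
        (fun x hx => (hd x (Ico_subset_Icc_self hx)).mono_of_mem_nhdsWithin
          (Icc_mem_nhdsGE_of_mem hx))
    refine ⟨A, fun x hx y hy => ?_⟩
    have h1 := (hconst y hy).trans (hconst x hx).symm
    rw [sub_eq_add_neg, add_comm, Real.exp_add, ← mul_assoc, ← h1, mul_assoc, ← Real.exp_add]
    simp
  · exact ⟨0, fun x hx => absurd (hx.1.trans hx.2) (not_le.2 hst)⟩

/-- The squared solution is compared with an exponential, so the coefficient need not be continuous.
-/
lemma abs_mul_exp_le_of_linear {s t k : ℝ} (hst : s ≤ t)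
    (hf : ∀ x ∈ Icc s t, HasDerivWithinAt f (c x * f x) (Icc s t) x)
    (hk : ∀ x ∈ Icc s t, k ≤ c x) : |f s| * Real.exp (k * (t - s)) ≤ |f t| := by
  have hd : ∀ x ∈ Icc s t, HasDerivWithinAt (fun x => f x ^ 2 * Real.exp (-(2 * k * x)))
      (2 * (c x - k) * f x ^ 2 * Real.exp (-(2 * k * x))) (Icc s t) x := by
    intro x hx
    have h1 : HasDerivAt (fun x => Real.exp (-(2 * k * x)))
        (Real.exp (-(2 * k * x)) * (-(2 * k))) x := by
      simpa using (((hasDerivAt_id x).const_mul (2 * k)).neg).exp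
    refine (((hf x hx).pow 2).mul h1.hasDerivWithinAt).congr_deriv ?_
    simp only [Pi.pow_apply]
    push_cast
    ring
  have h1 := le_of_hasDerivWithinAt_nonneg hst hd fun x hx => by
    have := hk x hx
    have : 0 ≤ c x - k := by linarith
    positivity
  refine abs_le_of_sq_le_sq' ?_ (abs_nonneg _) |>.2
  rw [mul_pow, sq_abs, sq_abs, ← Real.exp_nat_mul]
  have e1 : Real.exp (↑(2 : ℕ) * (k * (t - s))) =
      Real.exp (-(2 * k * s)) * Real.exp (2 * k * t) := by
    rw [← Real.exp_add]; congr 1; push_cast; ring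
  have e2 : Real.exp (-(2 * k * t)) * Real.exp (2 * k * t) = 1 := by
    rw [← Real.exp_add]; simp
  rw [e1, ← mul_assoc]
  calc f s ^ 2 * Real.exp (-(2 * k * s)) * Real.exp (2 * k * t)
      ≤ f t ^ 2 * Real.exp (-(2 * k * t)) * Real.exp (2 * k * t) :=
        mul_le_mul_of_nonneg_right h1 (Real.exp_pos _).le
    _ = f t ^ 2 := by rw [mul_assoc, e2, mul_one]

/-- A solution of a linear equation which decays backwards faster than the asymptotic rate of the
equation vanishes. -/
lemma eq_zero_of_isBigO_atBot (hc : ContinuousOn c (Iic 0)) {c₀ ν : ℝ}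
    (hf : ∀ x ∈ Iic (0 : ℝ), HasDerivWithinAt f (c x * f x) (Iic 0) x)
    (hlim : Tendsto c atBot (𝓝 c₀)) (hν : c₀ < ν)
    (hO : f =O[atBot] fun t => Real.exp (ν * t)) : ∀ t ≤ 0, f t = 0 := by
  -- Going backwards a nonzero solution decays at most like e^{kt}, which contradicts the bound
  -- e^{νt} with ν > k.
  obtain ⟨k, hk, hkν⟩ := exists_between hν
  obtain ⟨T₀, hT₀⟩ := eventually_atBot.1 (hlim.eventually (gt_mem_nhds hk))
  set T := min T₀ 0 with hT
  have hT0 : T ≤ 0 := min_le_right _ _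
  have hneg : ∀ s ≤ T, |f T| ≤ |f s| * Real.exp (k * (T - s)) := by
    intro s hs
    have hsub : Icc s T ⊆ Iic 0 := fun x hx => hx.2.trans hT0
    have hd : ∀ x ∈ Icc (-T) (-s), HasDerivWithinAt (fun x => f (-x)) (-c (-x) * f (-x))
        (Icc (-T) (-s)) x := by
      intro x hx
      have hmaps : MapsTo (fun x : ℝ => -x) (Icc (-T) (-s)) (Iic 0) := fun y hy =>
        (neg_le.1 hy.1).trans hT0
      have h1 := (hf (-x) (hmaps hx)).comp x (hasDerivAt_neg x).hasDerivWithinAt hmaps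
      refine h1.congr_deriv ?_
      ring
    have h2 := abs_mul_exp_le_of_linear (f := fun x => f (-x)) (c := fun x => -c (-x)) (k := -k)
      (neg_le_neg hs) hd fun x hx => by
        have := hT₀ (-x) ((neg_le.1 hx.1).trans (min_le_left _ _))
        linarith
    simp only [neg_neg] at h2
    have e : Real.exp (-k * (-s - -T)) * Real.exp (k * (T - s)) = 1 := by
      rw [← Real.exp_add]; simp; ring
    calc |f T| = |f T| * Real.exp (-k * (-s - -T)) * Real.exp (k * (T - s)) := by
          rw [mul_assoc, e, mul_one]
      _ ≤ _ := mul_le_mul_of_nonneg_right h2 (Real.exp_pos _).le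
  have hfT : f T = 0 := by
    obtain ⟨C, hC⟩ := hO.bound
    have hlim2 : Tendsto (fun s => C * Real.exp (k * T) * Real.exp ((ν - k) * s)) atBot (𝓝 0) := by
      have h1 : Tendsto (fun s => Real.exp ((ν - k) * s)) atBot (𝓝 0) :=
        Real.tendsto_exp_atBot.comp ((tendsto_id).const_mul_atBot (by linarith))
      simpa using h1.const_mul (C * Real.exp (k * T))
    have hle : |f T| ≤ 0 := by
      refine ge_of_tendsto hlim2 ?_
      filter_upwards [hC, eventually_le_atBot T] with s hs hsT
      rw [Real.norm_eq_abs, Real.norm_of_nonneg (Real.exp_pos _).le] at hs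
      calc |f T| ≤ |f s| * Real.exp (k * (T - s)) := hneg s hsT
        _ ≤ C * Real.exp (ν * s) * Real.exp (k * (T - s)) :=
          mul_le_mul_of_nonneg_right hs (Real.exp_pos _).le
        _ = _ := by
          rw [mul_assoc, mul_assoc, ← Real.exp_add, ← Real.exp_add]
          congr 2; ring
    exact abs_nonpos_iff.1 hle
  intro t ht
  have hsub : Icc (min t T) 0 ⊆ Iic 0 := fun x hx => hx.2
  obtain ⟨A, hA⟩ := exists_exp_of_linear (hc.mono hsub) fun x hx => (hf x hx.2).mono hsub
  rw [hA T ⟨min_le_right _ _, hT0⟩ t ⟨min_le_left _ _, ht⟩, hfT, zero_mul]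

/-- Time reversal of the backward statement: the limit rate becomes -c₀ < 0, and boundedness is
decay at the rate ν = 0. -/
lemma eq_zero_of_tendsto_atTop (hc : ContinuousOn c (Ici 0)) {c₀ : ℝ} (hc₀ : 0 < c₀)
    (hf : ∀ x ∈ Ici (0 : ℝ), HasDerivWithinAt f (c x * f x) (Ici 0) x)
    (hlim : Tendsto c atTop (𝓝 c₀)) (h0 : Tendsto f atTop (𝓝 0)) : ∀ t, 0 ≤ t → f t = 0 := by
  have hmaps : MapsTo (fun x : ℝ => -x) (Iic 0) (Ici 0) :=
    fun x hx => mem_Ici.2 (neg_nonneg.2 (mem_Iic.1 hx))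
  have h := eq_zero_of_isBigO_atBot (f := fun x => f (-x)) (c := fun x => -c (-x)) (c₀ := -c₀)
    (ν := 0) ((hc.comp continuous_neg.continuousOn hmaps).neg)
    (fun x hx => ((hf (-x) (hmaps hx)).comp x (hasDerivAt_neg x).hasDerivWithinAt
      hmaps).congr_deriv (by ring)) (hlim.comp tendsto_neg_atBot_atTop).neg (by linarith)
    (by simpa using (h0.comp tendsto_neg_atBot_atTop).isBigO_one ℝ)
  intro t ht
  simpa using h (-t) (by linarith)

end ScalarLinear

/-! ### Solutions of the system -/

section Solutions

lemma IsSolutionOn.mono {E : Type*} [NormedAddCommGroup E] [NormedSpace ℝ E] {F : E → E}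
    {P P' : Set E} {γ : ℝ → E} {J J' : Set ℝ} (h : IsSolutionOn F P γ J) (hP : P ⊆ P')
    (hJ : J' ⊆ J) : IsSolutionOn F P' γ J' :=
  fun t ht => ⟨hP (h t (hJ ht)).1, (h t (hJ ht)).2.mono hJ⟩

lemma IsSolutionOn.continuousOn {E : Type*} [NormedAddCommGroup E] [NormedSpace ℝ E] {F : E → E}
    {P : Set E} {γ : ℝ → E} {J : Set ℝ} (h : IsSolutionOn F P γ J) : ContinuousOn γ J :=
  fun t ht => (h t ht).2.continuousWithinAt

variable {a b α : ℝ} {P : Set (ℝ × ℝ × ℝ)} {γ : ℝ → ℝ × ℝ × ℝ} {J : Set ℝ}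

lemma IsSolutionOn.deriv_rho (h : IsSolutionOn (kappa1Field a b α) P γ J) {t : ℝ} (ht : t ∈ J) :
    HasDerivWithinAt (fun t => (γ t).1)
      (((γ t).2.1 - 1) * kappa1Bracket a b (γ t).1 (γ t).2.2 * (γ t).1) J t :=
  ((hasFDerivAt_fst (p := γ t)).comp_hasDerivWithinAt t (h t ht).2).congr_deriv (by
    change (γ t).1 * ((γ t).2.1 - 1) * kappa1Bracket a b (γ t).1 (γ t).2.2 = _
    ring)

lemma IsSolutionOn.deriv_x (h : IsSolutionOn (kappa1Field a b α) P γ J) {t : ℝ} (ht : t ∈ J) :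
    HasDerivWithinAt (fun t => (γ t).2.1)
      ((γ t).2.2 * (1 + α * (γ t).1 ^ 2 * (γ t).2.2 + (γ t).1 ^ 2 * (γ t).2.1 * ((γ t).2.1 - 1)) -
        (γ t).2.1 * ((γ t).2.1 - 1) * kappa1Bracket a b (γ t).1 (γ t).2.2) J t :=
  (ContinuousLinearMap.hasFDerivAt ((ContinuousLinearMap.fst ℝ ℝ ℝ).comp
    (ContinuousLinearMap.snd ℝ ℝ (ℝ × ℝ)))).comp_hasDerivWithinAt t (h t ht).2

lemma IsSolutionOn.deriv_y (h : IsSolutionOn (kappa1Field a b α) P γ J) {t : ℝ} (ht : t ∈ J) :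
    HasDerivWithinAt (fun t => (γ t).2.2)
      (-(((γ t).2.1 - 1) * (2 * kappa1Bracket a b (γ t).1 (γ t).2.2 - (γ t).2.2 * (γ t).1 ^ 2)) *
        (γ t).2.2) J t :=
  (((hasFDerivAt_snd (p := (γ t).2)).comp (γ t) hasFDerivAt_snd).comp_hasDerivWithinAt t
    (h t ht).2).congr_deriv (by
      change -(γ t).2.2 * ((γ t).2.1 - 1) * (2 * kappa1Bracket a b (γ t).1 (γ t).2.2 -
        (γ t).2.2 * (γ t).1 ^ 2) = _
      ring)

lemma continuousAt_kappa1Bracket {p : ℝ × ℝ × ℝ} (hp : 0 < 1 + a * p.1 ^ 2 * p.2.2) :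
    ContinuousAt (fun p : ℝ × ℝ × ℝ => kappa1Bracket a b p.1 p.2.2) p := by
  unfold kappa1Bracket
  exact continuousAt_const.add (ContinuousAt.div (by fun_prop) (by fun_prop) hp.ne')

lemma kappa1Bracket_of_rho (b y : ℝ) : kappa1Bracket a b 0 y = b := by simp [kappa1Bracket]

lemma kappa1Bracket_of_y (b ρ : ℝ) : kappa1Bracket a b ρ 0 = b := by simp [kappa1Bracket]

lemma kappa1Bracket_eq (b ρ y : ℝ) : kappa1Bracket a b ρ y = bracket a b (ρ ^ 2 * y) := by
  rw [kappa1Bracket, bracket]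
  ring_nf

/-- The logarithmic derivative of `ρ₁` along orbits. -/
noncomputable def rateRho (a b : ℝ) (p : ℝ × ℝ × ℝ) : ℝ := (p.2.1 - 1) * kappa1Bracket a b p.1 p.2.2

/-- The logarithmic derivative of `y₁` along orbits. -/
noncomputable def rateY (a b : ℝ) (p : ℝ × ℝ × ℝ) : ℝ :=
  -((p.2.1 - 1) * (2 * kappa1Bracket a b p.1 p.2.2 - p.2.2 * p.1 ^ 2))

lemma continuousAt_rateRho {p : ℝ × ℝ × ℝ} (hp : 0 < 1 + a * p.1 ^ 2 * p.2.2) :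
    ContinuousAt (rateRho a b) p :=
  ContinuousAt.mul (by fun_prop) (continuousAt_kappa1Bracket hp)

lemma continuousAt_rateY {p : ℝ × ℝ × ℝ} (hp : 0 < 1 + a * p.1 ^ 2 * p.2.2) :
    ContinuousAt (rateY a b) p :=
  (ContinuousAt.mul (by fun_prop)
    ((continuousAt_const.mul (continuousAt_kappa1Bracket hp)).sub (by fun_prop))).neg

lemma IsSolutionOn.continuousOn_rate (h : IsSolutionOn (kappa1Field a b α) (kappa1Space a) γ J)
    {f : ℝ × ℝ × ℝ → ℝ} (hf : ∀ p ∈ kappa1Space a, ContinuousAt f p) :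
    ContinuousOn (fun t => f (γ t)) J := fun t ht =>
  ContinuousAt.comp_continuousWithinAt (f := γ) (g := f) (hf _ (h t ht).1)
    (h.continuousOn t ht)

lemma IsSolutionOn.exists_exp_y {s t : ℝ}
    (h : IsSolutionOn (kappa1Field a b α) (kappa1Space a) γ (Icc s t)) :
    ∃ A : ℝ → ℝ, ∀ x ∈ Icc s t, ∀ y ∈ Icc s t, (γ y).2.2 = (γ x).2.2 * Real.exp (A y - A x) :=
  exists_exp_of_linear (f := fun t => (γ t).2.2)
    (h.continuousOn_rate fun _ hp => continuousAt_rateY (b := b) hp.2) fun _ hx => h.deriv_y hx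

lemma origin_mem : (0 : ℝ × ℝ × ℝ) ∈ kappa1Space a := by simp [kappa1Space]

lemma tendsto_comp_origin {l : Filter ℝ} (hγ : Tendsto γ l (𝓝 0)) {f : ℝ × ℝ × ℝ → ℝ}
    (hf : ContinuousAt f 0) : Tendsto (fun t => f (γ t)) l (𝓝 (f 0)) := hf.tendsto.comp hγ

/-- Near the origin ρ has the logarithmic rate -b, so a nonzero ρ would grow backwards without
bound. -/
theorem rho_eq_zero_of_unstable (hb : 0 < b)
    (h : IsSolutionOn (kappa1Field a b α) (kappa1Space a) γ (Iic 0)) (hγ : Tendsto γ atBot (𝓝 0)) :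
    ∀ t ≤ 0, (γ t).1 = 0 := by
  refine eq_zero_of_isBigO_atBot (f := fun t => (γ t).1) (c₀ := -b) (ν := 0)
    (h.continuousOn_rate fun _ hp => continuousAt_rateRho (b := b) hp.2)
    (fun _ hx => h.deriv_rho hx) ?_ (by linarith) ?_
  · have := tendsto_comp_origin hγ (continuousAt_rateRho (a := a) (b := b) origin_mem.2)
    simpa [rateRho, kappa1Bracket] using this
  · have := (tendsto_comp_origin hγ (f := fun p => p.1) continuous_fst.continuousAt).isBigO_one ℝ
    simpa using this

/-- The component y has the limit rate 2b > 0 and must vanish; on y = 0 the component x then has the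
limit rate b > 0. -/
theorem eq_zero_of_stable (hb : 0 < b)
    (h : IsSolutionOn (kappa1Field a b α) (kappa1Space a) γ (Ici 0)) (hγ : Tendsto γ atTop (𝓝 0)) :
    (γ 0).2.1 = 0 ∧ (γ 0).2.2 = 0 := by
  have hy : ∀ t, 0 ≤ t → (γ t).2.2 = 0 := by
    refine eq_zero_of_tendsto_atTop (f := fun t => (γ t).2.2) (c₀ := 2 * b)
      (h.continuousOn_rate fun _ hp => continuousAt_rateY (b := b) hp.2) (by linarith)
      (fun _ hx => h.deriv_y hx) ?_ ?_
    · have := tendsto_comp_origin hγ (continuousAt_rateY (a := a) (b := b) origin_mem.2)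
      simpa [rateY, kappa1Bracket] using this
    · exact tendsto_comp_origin hγ (f := fun p => p.2.2) (by fun_prop)
  refine ⟨?_, hy 0 le_rfl⟩
  refine eq_zero_of_tendsto_atTop (f := fun t => (γ t).2.1) (c := fun t => -(((γ t).2.1 - 1) * b))
    (c₀ := b) ?_ hb (fun t ht => ?_) ?_ ?_ 0 le_rfl
  · have hc := h.continuousOn
    fun_prop
  · refine (h.deriv_x ht).congr_deriv ?_
    rw [hy t ht, kappa1Bracket_of_y]
    ring
  · have := tendsto_comp_origin hγ (f := fun p => -((p.2.1 - 1) * b)) (by fun_prop)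
    simpa using this
  · exact tendsto_comp_origin hγ (f := fun p => p.2.1) (by fun_prop)

end Solutions

/-! ### The invariant plane `ρ₁ = 0` -/

section Planar

variable {a b α : ℝ} {P : Set (ℝ × ℝ × ℝ)} {γ : ℝ → ℝ × ℝ × ℝ} {J : Set ℝ}

lemma planar_mem (x y : ℝ) : ((0, x, y) : ℝ × ℝ × ℝ) ∈ kappa1Space a := by simp [kappa1Space]

lemma isSolutionOn_planar {x y : ℝ → ℝ}
    (hx : ∀ t ∈ J, HasDerivWithinAt x (y t + b * x t * (1 - x t)) J t)
    (hy : ∀ t ∈ J, HasDerivWithinAt y (2 * b * (1 - x t) * y t) J t) :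
    IsSolutionOn (kappa1Field a b α) (kappa1Space a) (fun t => (0, x t, y t)) J := by
  refine fun t ht => ⟨planar_mem _ _, ?_⟩
  refine ((hasDerivWithinAt_const t J (0 : ℝ)).prodMk ((hx t ht).prodMk (hy t ht))).congr_deriv ?_
  simp only [kappa1Field, kappa1Bracket_of_rho, Prod.mk.injEq]
  refine ⟨by ring, by ring, by ring⟩

lemma IsSolutionOn.planar_x (h : IsSolutionOn (kappa1Field a b α) P γ J) {t : ℝ} (ht : t ∈ J)
    (hρ : (γ t).1 = 0) : HasDerivWithinAt (fun t => (γ t).2.1)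
      ((γ t).2.2 + b * (γ t).2.1 * (1 - (γ t).2.1)) J t := by
  refine (h.deriv_x ht).congr_deriv ?_
  rw [hρ, kappa1Bracket_of_rho]
  ring

lemma IsSolutionOn.planar_y (h : IsSolutionOn (kappa1Field a b α) P γ J) {t : ℝ} (ht : t ∈ J)
    (hρ : (γ t).1 = 0) : HasDerivWithinAt (fun t => (γ t).2.2)
      (2 * b * (1 - (γ t).2.1) * (γ t).2.2) J t := by
  refine (h.deriv_y ht).congr_deriv ?_
  rw [hρ, kappa1Bracket_of_rho]
  ring

/-- A solution of the linear system behind the flow in the plane `ρ₁ = 0`: with `s = e^{bt}` and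
`y / y₀ = s² / u²` the equations become `u'' = k / u`, where `k = y₀ / b`. -/
lemma exists_second_order_solution {x₀ k : ℝ} (h : 4 * |x₀| + 8 * |k| ≤ 1 / 4) :
    ∃ u v : ℝ → ℝ, u 1 = 1 ∧ v 1 = 4 * x₀ ∧ ∀ s ∈ Icc (0 : ℝ) 1,
      HasDerivWithinAt u (v s / 4) (Icc 0 1) s ∧
      HasDerivWithinAt v (4 * k / u s) (Icc 0 1) s ∧ 3 / 4 ≤ u s ∧
      |v s| ≤ 4 * |x₀| + 8 * |k| := by
  have hk0 := abs_nonneg k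
  have hx0 := abs_nonneg x₀
  -- Truncation makes the field bounded and Lipschitz. With v = 4u' and |v| clipped at 1, |u'| ≤ 1/4
  -- keeps u ≥ 3/4, and then |v| ≤ 1/4, so the truncation is never active.
  let f : ℝ → ℝ × ℝ → ℝ × ℝ := fun _ q => (max (-1) (min q.2 1) / 4, 4 * k / max q.1 (1 / 2))
  have hclip : ∀ z : ℝ, |max (-1) (min z 1)| ≤ 1 := fun z =>
    abs_le.2 ⟨le_max_left _ _, max_le (by norm_num) (min_le_right _ _)⟩
  have hquot : ∀ z : ℝ, |4 * k / max z (1 / 2)| ≤ 8 * |k| := fun z => by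
    have hz : (1 / 2 : ℝ) ≤ max z (1 / 2) := le_max_right _ _
    have hz' : 0 < max z (1 / 2) := by linarith
    rw [abs_div, abs_of_pos hz', div_le_iff₀ hz', abs_mul, abs_of_pos (by norm_num : (0 : ℝ) < 4)]
    nlinarith
  have hbound : ∀ t q, ‖f t q‖ ≤ 1 / 4 := fun t q => by
    refine norm_prod_le_iff.2 ⟨?_, ?_⟩
    · rw [Real.norm_eq_abs, abs_div, abs_of_pos (by norm_num : (0 : ℝ) < 4)]
      have := hclip q.2
      linarith
    · have := hquot q.1
      rw [Real.norm_eq_abs]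
      linarith
  have hlip : ∀ t, LipschitzWith (NNReal.mk (1 / 4 + 16 * |k|) (by positivity)) (f t) := fun t => by
    refine LipschitzWith.of_dist_le_mul fun p q => ?_
    have hd1 : |p.1 - q.1| ≤ dist p q := by
      rw [← Real.dist_eq]; exact le_max_left _ _
    have hd2 : |p.2 - q.2| ≤ dist p q := by
      rw [← Real.dist_eq]; exact le_max_right _ _
    have hd0 : 0 ≤ dist p q := dist_nonneg
    rw [Prod.dist_eq, NNReal.coe_mk]
    refine max_le ?_ ?_
    · have e : |max (-1) (min p.2 1) - max (-1) (min q.2 1)| ≤ |p.2 - q.2| := by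
        refine (abs_max_sub_max_le_max _ _ _ _).trans (max_le (by simp) ?_)
        refine (abs_min_sub_min_le_max _ _ _ _).trans (max_le le_rfl (by simp))
      rw [Real.dist_eq, ← sub_div, abs_div, abs_of_pos (by norm_num : (0 : ℝ) < 4)]
      nlinarith
    · have e : |max p.1 (1 / 2) - max q.1 (1 / 2)| ≤ |p.1 - q.1| := by
        refine (abs_max_sub_max_le_max _ _ _ _).trans (max_le le_rfl (by simp))
      have hz : (1 / 2 : ℝ) ≤ max p.1 (1 / 2) := le_max_right _ _
      have hz' : (1 / 2 : ℝ) ≤ max q.1 (1 / 2) := le_max_right _ _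
      simp only [f]
      generalize max p.1 (1 / 2) = A at *
      generalize max q.1 (1 / 2) = B at *
      have hA : 0 < A := by linarith
      have hB : 0 < B := by linarith
      have e2 : 4 * k / A - 4 * k / B = 4 * k * (B - A) / (A * B) := by field_simp
      rw [Real.dist_eq, e2, abs_div, abs_of_pos (mul_pos hA hB), div_le_iff₀ (mul_pos hA hB),
        abs_mul, abs_mul, abs_of_pos (by norm_num : (0 : ℝ) < 4), abs_sub_comm]
      have hAB : 1 / 4 ≤ A * B := by nlinarith
      calc 4 * |k| * |A - B| ≤ 4 * |k| * dist p q := by gcongr; linarith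
        _ = (16 * |k|) * dist p q * (1 / 4) := by ring
        _ ≤ (1 / 4 + 16 * |k|) * dist p q * (A * B) := by
          gcongr
          linarith
  have hPL : IsPicardLindelof f (⟨1, by simp⟩ : Icc (0 : ℝ) 1) ((1 : ℝ), 4 * x₀)
      (NNReal.mk (1 / 4) (by norm_num)) 0 (NNReal.mk (1 / 4) (by norm_num))
      (NNReal.mk (1 / 4 + 16 * |k|) (by positivity)) :=
    { lipschitzOnWith := fun t _ => (hlip t).lipschitzOnWith
      continuousOn := fun _ _ => continuousOn_const
      norm_le := fun t _ q _ => hbound t q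
      mul_max_le := by simp }
  obtain ⟨w, hw1, hw⟩ := hPL.exists_eq_forall_mem_Icc_hasDerivWithinAt₀
  simp only at hw1
  have hu : ∀ s ∈ Icc (0 : ℝ) 1, HasDerivWithinAt (fun s => (w s).1)
      (max (-1) (min (w s).2 1) / 4) (Icc 0 1) s := fun s hs =>
    (hasFDerivAt_fst (p := w s)).comp_hasDerivWithinAt s (hw s hs)
  have hv : ∀ s ∈ Icc (0 : ℝ) 1, HasDerivWithinAt (fun s => (w s).2)
      (4 * k / max (w s).1 (1 / 2)) (Icc 0 1) s := fun s hs =>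
    (hasFDerivAt_snd (p := w s)).comp_hasDerivWithinAt s (hw s hs)
  have h1mem : (1 : ℝ) ∈ Icc (0 : ℝ) 1 := by simp
  have hs1 : ∀ s ∈ Icc (0 : ℝ) 1, ‖s - 1‖ ≤ 1 := fun s hs => by
    rw [Real.norm_eq_abs, abs_le]; constructor <;> linarith [hs.1, hs.2]
  have hub : ∀ s ∈ Icc (0 : ℝ) 1, 3 / 4 ≤ (w s).1 := by
    intro s hs
    have h1 := (convex_Icc (0 : ℝ) 1).norm_image_sub_le_of_norm_hasDerivWithin_le (C := 1 / 4) hu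
      (fun s _ => by
        rw [Real.norm_eq_abs, abs_div, abs_of_pos (by norm_num : (0 : ℝ) < 4)]
        have := hclip (w s).2
        linarith) h1mem hs
    simp only [hw1, Real.norm_eq_abs] at h1
    have := (abs_le.1 h1).1
    have := hs1 s hs
    rw [Real.norm_eq_abs] at this
    linarith
  have hvb : ∀ s ∈ Icc (0 : ℝ) 1, |(w s).2| ≤ 4 * |x₀| + 8 * |k| := by
    intro s hs
    have h1 := (convex_Icc (0 : ℝ) 1).norm_image_sub_le_of_norm_hasDerivWithin_le (C := 8 * |k|) hv
      (fun s _ => hquot _) h1mem hs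
    simp only [hw1, Real.norm_eq_abs] at h1
    have h2 := hs1 s hs
    rw [Real.norm_eq_abs] at h2
    have h3 : 8 * |k| * |s - 1| ≤ 8 * |k| := mul_le_of_le_one_right (by positivity) h2
    calc |(w s).2| = |((w s).2 - 4 * x₀) + 4 * x₀| := by ring_nf
      _ ≤ |(w s).2 - 4 * x₀| + |4 * x₀| := abs_add_le _ _
      _ ≤ _ := by rw [abs_mul, abs_of_pos (by norm_num : (0 : ℝ) < 4)]; linarith
  refine ⟨fun s => (w s).1, fun s => (w s).2, by simp [hw1], by simp [hw1], fun s hs =>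
    ⟨(hu s hs).congr_deriv ?_, (hv s hs).congr_deriv ?_, hub s hs, hvb s hs⟩⟩
  · have := abs_le.1 (hvb s hs)
    rw [min_eq_left (by linarith), max_eq_right (by linarith)]
  · have := hub s hs
    rw [max_eq_left (by linarith)]

/-- In terms of s = e^{bt} the orbit is x = s u'/u, y = y₀ (s/u)². It provides the full unstable
neighborhood in the plane, with a bound on x for all negative times which keeps orbits in the domain
of a graph. -/
theorem exists_backward_orbit (a α : ℝ) (hb : 0 < b) {x₀ y₀ : ℝ}
    (h : 4 * |x₀| + 8 * (|y₀| / b) ≤ 1 / 4) :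
    ∃ γ : ℝ → ℝ × ℝ × ℝ, IsSolutionOn (kappa1Field a b α) (kappa1Space a) γ (Iic 0) ∧
      γ 0 = (0, x₀, y₀) ∧ Tendsto γ atBot (𝓝 0) ∧
      ∀ t ≤ 0, (γ t).1 = 0 ∧ |(γ t).2.1| ≤ 4 * |x₀| + 8 * (|y₀| / b) := by
  set k := y₀ / b with hk
  have hk' : |k| = |y₀| / b := by rw [hk, abs_div, abs_of_pos hb]
  rw [← hk'] at h ⊢
  obtain ⟨u, v, hu1, hv1, huv⟩ := exists_second_order_solution h
  set s : ℝ → ℝ := fun t => Real.exp (b * t) with hs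
  have hsd : ∀ t, HasDerivAt s (b * s t) t := fun t => by
    have := ((hasDerivAt_id t).const_mul b).exp
    simp only [id, mul_one] at this
    exact this.congr_deriv (mul_comm _ _)
  have hmaps : MapsTo s (Iic 0) (Icc 0 1) := fun t ht =>
    ⟨(Real.exp_pos _).le, Real.exp_le_one_iff.2 (mul_nonpos_of_nonneg_of_nonpos hb.le ht)⟩
  have hs0 : s 0 = 1 := by simp [hs]
  set x : ℝ → ℝ := fun t => s t * v (s t) / (4 * u (s t)) with hx
  set y : ℝ → ℝ := fun t => y₀ * (s t / u (s t)) ^ 2 with hy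
  have hslim : Tendsto s atBot (𝓝 0) :=
    Real.tendsto_exp_atBot.comp (tendsto_id.const_mul_atBot hb)
  have hxb : ∀ t ≤ 0, |x t| ≤ s t * (4 * |x₀| + 8 * |k|) := by
    intro t ht
    obtain ⟨-, -, h3, h4⟩ := huv (s t) (hmaps ht)
    have hst := (hmaps ht).1
    have hupos : 0 < 4 * u (s t) := by linarith
    simp only [hx]
    rw [abs_div, abs_mul, abs_of_nonneg hst, abs_of_pos hupos, mul_div_assoc]
    refine mul_le_mul_of_nonneg_left ?_ hst
    rw [div_le_iff₀ hupos]
    nlinarith [abs_nonneg (v (s t))]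
  have hyb : ∀ t ≤ 0, |y t| ≤ s t * (2 * |y₀|) := by
    intro t ht
    obtain ⟨-, -, h3, h4⟩ := huv (s t) (hmaps ht)
    have hst := (hmaps ht).1
    have hst1 := (hmaps ht).2
    have hupos : 0 < u (s t) := by linarith
    simp only [hy]
    rw [abs_mul, abs_pow, abs_div, abs_of_nonneg hst, abs_of_pos hupos]
    have h5 : (s t / u (s t)) ^ 2 ≤ s t * 2 := by
      rw [div_pow, div_le_iff₀ (by positivity)]
      have h6 : 1 ≤ 2 * u (s t) ^ 2 := by nlinarith
      have h7 : s t ^ 2 ≤ s t := by nlinarith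
      nlinarith
    calc |y₀| * (s t / u (s t)) ^ 2 ≤ |y₀| * (s t * 2) := by gcongr
      _ = _ := by ring
  refine ⟨fun t => (0, x t, y t), isSolutionOn_planar (fun t ht => ?_) (fun t ht => ?_), ?_, ?_, ?_⟩
  · obtain ⟨h1, h2, h3, -⟩ := huv (s t) (hmaps ht)
    have h1' := h1.comp t (hsd t).hasDerivWithinAt hmaps
    have h2' := h2.comp t (hsd t).hasDerivWithinAt hmaps
    have hupos : 4 * u (s t) ≠ 0 := by linarith
    refine (((hsd t).hasDerivWithinAt.mul h2').div (h1'.const_mul 4) hupos).congr_deriv ?_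
    simp only [hx, hy, hk, Function.comp_apply, Pi.mul_apply]
    have hu0 : u (s t) ≠ 0 := by linarith
    field_simp
    ring
  · obtain ⟨h1, h2, h3, -⟩ := huv (s t) (hmaps ht)
    have h1' := h1.comp t (hsd t).hasDerivWithinAt hmaps
    have hu0 : u (s t) ≠ 0 := by linarith
    refine ((((hsd t).hasDerivWithinAt.div h1' hu0).pow 2).const_mul y₀).congr_deriv ?_
    simp only [hx, hy, Function.comp_apply, Pi.div_apply, Nat.add_one_sub_one, pow_one,
      Nat.cast_ofNat]
    field_simp
  · simp only [hx, hy, hs0, hu1, hv1]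
    ext <;> simp
  · have h1 : Tendsto x atBot (𝓝 0) := by
      refine squeeze_zero_norm' ?_ (by simpa using hslim.mul_const (4 * |x₀| + 8 * |k|))
      filter_upwards [eventually_le_atBot 0] with t ht using hxb t ht
    have h2 : Tendsto y atBot (𝓝 0) := by
      refine squeeze_zero_norm' ?_ (by simpa using hslim.mul_const (2 * |y₀|))
      filter_upwards [eventually_le_atBot 0] with t ht using hyb t ht
    exact tendsto_const_nhds.prodMk_nhds (h1.prodMk_nhds h2)
  · intro t ht
    refine ⟨rfl, (hxb t ht).trans (mul_le_of_le_one_left (by positivity) (hmaps ht).2)⟩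

end Planar

noncomputable section

/-! ### Dawson's function -/

section Dawson

/-- The integral of `exp (q t² / 2)` from `0` to `s`. -/
def expInt (q s : ℝ) : ℝ := ∫ t in (0 : ℝ)..s, Real.exp (q * t ^ 2 / 2)

lemma hasDerivAt_expInt (q s : ℝ) : HasDerivAt (expInt q) (Real.exp (q * s ^ 2 / 2)) s :=
  ((by fun_prop : Continuous fun t : ℝ => Real.exp (q * t ^ 2 / 2)).integral_hasStrictDerivAt
    0 s).hasDerivAt

lemma expInt_zero (q : ℝ) : expInt q 0 = 0 := by simp [expInt]

lemma mul_expInt (q r : ℝ) : r * expInt (q * r ^ 2) 1 = expInt q r := by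
  have h := intervalIntegral.mul_integral_comp_mul_left (a := 0) (b := 1) (c := r)
    (f := fun t => Real.exp (q * t ^ 2 / 2))
  simp only [mul_zero, mul_one] at h
  rw [expInt, expInt, ← h]
  congr 2
  ext t
  ring_nf

/-- An instance of smooth dependence on parameters, with a right hand side independent of the state.
-/
lemma contDiff_expInt_one : ContDiff ℝ ∞ fun q => expInt q 1 := by
  have hf : ContDiff ℝ ∞ fun q : ℝ × ℝ × ℝ => Real.exp (q.1 * q.2.1 ^ 2 / 2) := by fun_prop
  obtain ⟨N, hN0, hN, hN1⟩ := exists_smooth_solution hf 0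
    (fun p => ⟨(Real.exp |p|).toNNReal, fun s hs n => by
      rw [Real.norm_of_nonneg (Real.exp_pos _).le, Real.coe_toNNReal _ (Real.exp_pos _).le,
        Real.exp_le_exp]
      have h1 : s ^ 2 ≤ 1 := pow_le_one₀ hs.1 hs.2
      have h2 := mul_le_mul (le_abs_self p) h1 (sq_nonneg s) (abs_nonneg p)
      have := abs_nonneg p
      simp only
      linarith⟩)
    (fun p => ⟨0, fun s _ => LipschitzWith.const (Real.exp (p * s ^ 2 / 2))⟩)
  have key : ∀ q, expInt q 1 = N q 1 := by
    intro q
    have hd : ∀ s ∈ Icc (0 : ℝ) 1, HasDerivWithinAt (fun s => expInt q s - N q s) 0 (Icc 0 1) s :=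
      fun s hs => (((hasDerivAt_expInt q s).hasDerivWithinAt).sub (hN q s hs)).congr_deriv
        (sub_self _)
    have h1 := constant_of_has_deriv_right_zero (fun s hs => (hd s hs).continuousWithinAt)
      (fun s hs => (hd s (Ico_subset_Icc_self hs)).mono_of_mem_nhdsWithin
        (Icc_mem_nhdsGE_of_mem hs)) 1 (right_mem_Icc.2 zero_le_one)
    rw [expInt_zero, hN0, sub_zero] at h1
    linarith
  rwa [show (fun q => expInt q 1) = fun q => N q 1 from funext key]

/-- The smooth function `E` with `w E (w²) = D (w)`, where `D` is Dawson's function. -/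
def dawsonE (q : ℝ) : ℝ := expInt q 1 * Real.exp (-(q / 2))

lemma contDiff_dawsonE : ContDiff ℝ ∞ dawsonE :=
  contDiff_expInt_one.mul (by fun_prop)

lemma dawsonE_zero : dawsonE 0 = 1 := by simp [dawsonE, expInt]

lemma dawsonE_pos (q : ℝ) : 0 < dawsonE q := by
  refine mul_pos ?_ (Real.exp_pos _)
  exact intervalIntegral.intervalIntegral_pos_of_pos
    ((by fun_prop : Continuous fun t : ℝ => Real.exp (q * t ^ 2 / 2)).intervalIntegrable _ _)
    (fun t => Real.exp_pos _) one_pos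

lemma hasDerivAt_dawsonE (q : ℝ) : HasDerivAt dawsonE (deriv dawsonE q) q :=
  (contDiff_dawsonE.differentiable (by simp) q).hasDerivAt

/-- This is Dawson's equation D' = 1 - w D in the variable q = w²; it comes from differentiating the
scaling relation `mul_expInt` at r = 1. -/
lemma two_mul_deriv_dawsonE (q : ℝ) :
    2 * q * deriv dawsonE q = 1 - q * dawsonE q - dawsonE q := by
  set F : ℝ → ℝ := fun q => expInt q 1 with hF
  have hFd : HasDerivAt F (deriv F q) q :=
    (contDiff_expInt_one.differentiable (by simp) q).hasDerivAt
  have h1 : F q + 2 * q * deriv F q = Real.exp (q / 2) := by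
    have hin : HasDerivAt (fun r : ℝ => q * r ^ 2) (2 * q) 1 := by
      refine ((hasDerivAt_pow 2 (1 : ℝ)).const_mul q).congr_deriv ?_
      norm_num
      ring
    have hFd' : HasDerivAt F (deriv F q) (q * (1 : ℝ) ^ 2) := by simpa using hFd
    have h2 : HasDerivAt (fun r => r * F (q * r ^ 2)) _ 1 :=
      (hasDerivAt_id (1 : ℝ)).mul (HasDerivAt.comp (h₂ := F) (1 : ℝ) hFd' hin)
    have h3 : (fun r => r * F (q * r ^ 2)) = expInt q := funext fun r => mul_expInt q r
    rw [h3] at h2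
    have h4 := h2.unique (hasDerivAt_expInt q 1)
    simp only [id, one_pow, mul_one, one_mul] at h4
    linarith
  have hexp : HasDerivAt (fun q : ℝ => Real.exp (-(q / 2))) (Real.exp (-(q / 2)) * (-(1 / 2))) q := by
    simpa using (((hasDerivAt_id q).div_const 2).neg).exp
  have h2 : deriv dawsonE q = _ := (hFd.mul hexp).deriv
  have h3 : Real.exp (q / 2) * Real.exp (-(q / 2)) = 1 := by rw [← Real.exp_add]; simp
  rw [h2, dawsonE]
  linear_combination Real.exp (-(q / 2)) * h1 + h3

/-- Dawson's function. -/
def dawson (w : ℝ) : ℝ := w * dawsonE (w ^ 2)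

lemma dawson_eq (w : ℝ) : dawson w = expInt 1 w * Real.exp (-(w ^ 2 / 2)) := by
  rw [dawson, dawsonE, ← mul_expInt 1 w, one_mul, mul_assoc]

lemma dawson_pos {w : ℝ} (hw : 0 < w) : 0 < dawson w := mul_pos hw (dawsonE_pos _)

lemma hasDerivAt_dawson (w : ℝ) : HasDerivAt dawson (1 - w * dawson w) w := by
  have hexp : HasDerivAt (fun w : ℝ => Real.exp (-(w ^ 2 / 2)))
      (Real.exp (-(w ^ 2 / 2)) * (-w)) w := by
    refine (((hasDerivAt_pow 2 w).div_const 2).neg).exp.congr_deriv ?_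
    simp only [Pi.neg_apply]
    norm_num
  have h := (hasDerivAt_expInt 1 w).mul hexp
  have h2 : Real.exp (1 * w ^ 2 / 2) * Real.exp (-(w ^ 2 / 2)) = 1 := by
    rw [← Real.exp_add]; simp
  rw [show dawson = fun w => expInt 1 w * Real.exp (-(w ^ 2 / 2)) from funext dawson_eq]
  refine h.congr_deriv ?_
  linear_combination h2

/-- The strong unstable manifold as a graph near the origin. -/
theorem exists_unstable_graph {b : ℝ} (hb : 0 < b) :
    ∃ (δ : ℝ) (φ : ℝ → ℝ), 0 < δ ∧ ContDiffOn ℝ ∞ φ (Ioo (-δ) δ) ∧ φ 0 = 0 ∧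
      HasDerivAt φ b 0 ∧ (fun x => φ x - b * x) =O[𝓝 0] (fun x => x ^ 2) ∧
      ∀ x ∈ Ioo (-δ) δ, HasDerivAt φ (deriv φ x) x ∧
        deriv φ x * (φ x + b * x * (1 - x)) = 2 * b * φ x * (1 - x) := by
  -- With q = w² the curve is x = q E(q), y = b q E(q)² = b x E(q). As E(0) = 1, q is a smooth
  -- function of x near 0.
  set X : ℝ → ℝ := fun q => q * dawsonE q with hX
  have hXc : ContDiff ℝ ∞ X := contDiff_id.mul contDiff_dawsonE
  have hXd : ∀ q, HasDerivAt X (dawsonE q + q * deriv dawsonE q) q := fun q =>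
    ((hasDerivAt_id q).mul (hasDerivAt_dawsonE q)).congr_deriv (by simp)
  have hX0 : X 0 = 0 := by simp [hX]
  have hd0 : HasFDerivAt X ((ContinuousLinearEquiv.unitsEquivAut ℝ (Units.mk0 (1 : ℝ)
      one_ne_zero) : ℝ ≃L[ℝ] ℝ) : ℝ →L[ℝ] ℝ) 0 := by
    refine (hXd 0).hasFDerivAt.congr_fderiv ?_
    ext
    simp [dawsonE_zero]
  set e := hXc.contDiffAt.toOpenPartialHomeomorph X hd0 (by simp) with he
  have hex : ∀ q, e q = X q := fun q => rfl
  have hs0 : (0 : ℝ) ∈ e.source := hXc.contDiffAt.mem_toOpenPartialHomeomorph_source hd0 (by simp)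
  have ht0 : (0 : ℝ) ∈ e.target := by
    have := e.map_source hs0
    rwa [hex, hX0] at this
  have hξ0 : e.symm 0 = 0 := by
    have := e.left_inv hs0
    rwa [hex, hX0] at this
  have hcont0 : ContinuousAt e.symm 0 := e.continuousAt_symm ht0
  have hXd' : Continuous fun q => dawsonE q + q * deriv dawsonE q := by
    have h1 := contDiff_dawsonE.continuous
    have h2 := contDiff_dawsonE.continuous_deriv (by simp)
    fun_prop
  have hnear : ∀ᶠ x in 𝓝 (0 : ℝ), x ∈ e.target ∧
      0 < dawsonE (e.symm x) + e.symm x * deriv dawsonE (e.symm x) := by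
    refine (show ∀ᶠ x in 𝓝 (0 : ℝ), x ∈ e.target from e.open_target.mem_nhds ht0).and ?_
    have h1 : ContinuousAt (fun x => dawsonE (e.symm x) + e.symm x * deriv dawsonE (e.symm x)) 0 :=
      ContinuousAt.comp (g := fun q => dawsonE q + q * deriv dawsonE q) hXd'.continuousAt hcont0
    refine h1.eventually (lt_mem_nhds ?_)
    simp only [hξ0, dawsonE_zero]
    norm_num
  obtain ⟨δ, hδ, hδ'⟩ := Metric.eventually_nhds_iff.1 hnear
  have hmem : ∀ x ∈ Ioo (-δ) δ, x ∈ e.target ∧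
      0 < dawsonE (e.symm x) + e.symm x * deriv dawsonE (e.symm x) := fun x hx =>
    hδ' (by rw [Real.dist_eq, sub_zero, abs_lt]; exact hx)
  have hξc : ∀ x ∈ Ioo (-δ) δ, ContDiffAt ℝ ∞ e.symm x := fun x hx =>
    e.contDiffAt_symm_deriv (hmem x hx).2.ne' (hmem x hx).1 (hXd _) hXc.contDiffAt
  have hξd : ∀ x ∈ Ioo (-δ) δ, HasDerivAt e.symm
      (dawsonE (e.symm x) + e.symm x * deriv dawsonE (e.symm x))⁻¹ x := fun x hx =>
    e.hasDerivAt_symm (hmem x hx).1 (hmem x hx).2.ne' (hXd _)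
  have h0mem : (0 : ℝ) ∈ Ioo (-δ) δ := ⟨by linarith, hδ⟩
  set φ : ℝ → ℝ := fun x => b * x * dawsonE (e.symm x) with hφ
  have hφd : ∀ x ∈ Ioo (-δ) δ, HasDerivAt φ (b * dawsonE (e.symm x) + b * x *
      (deriv dawsonE (e.symm x) *
        (dawsonE (e.symm x) + e.symm x * deriv dawsonE (e.symm x))⁻¹)) x := by
    intro x hx
    have h1 : HasDerivAt (fun x => dawsonE (e.symm x)) _ x :=
      HasDerivAt.comp (h₂ := dawsonE) x (hasDerivAt_dawsonE _) (hξd x hx)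
    have h2 : HasDerivAt (fun x => b * x) b x := by simpa using (hasDerivAt_id x).const_mul b
    exact h2.mul h1
  refine ⟨δ, φ, hδ, fun x hx => ?_, by simp [hφ], ?_, ?_, fun x hx => ?_⟩
  · exact (ContDiffAt.mul (by fun_prop)
      (contDiff_dawsonE.contDiffAt.comp x (hξc x hx))).contDiffWithinAt
  · refine (hφd 0 h0mem).congr_deriv ?_
    rw [hξ0, dawsonE_zero]
    simp
  · have h1 : HasDerivAt (fun x => dawsonE (e.symm x)) _ 0 :=
      HasDerivAt.comp (h₂ := dawsonE) (0 : ℝ) (hasDerivAt_dawsonE _) (hξd 0 h0mem)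
    have h2 := h1.isBigO_sub
    simp only [hξ0, dawsonE_zero, sub_zero] at h2
    have h3 := ((isBigO_refl (fun x : ℝ => x) (𝓝 0)).const_mul_left b).mul h2
    refine (h3.congr_left fun x => ?_).congr_right fun x => ?_
    · simp only [hφ]; ring
    · ring
  · refine ⟨(hφd x hx).differentiableAt.hasDerivAt, ?_⟩
    rw [(hφd x hx).deriv]
    have hpos := (hmem x hx).2
    have hxX : e.symm x * dawsonE (e.symm x) = x := e.right_inv (hmem x hx).1
    have hode := two_mul_deriv_dawsonE (e.symm x)
    simp only [hφ]
    generalize e.symm x = q at *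
    generalize deriv dawsonE q = E' at *
    generalize dawsonE q = E at *
    have h2 : 2 * (E + q * E') = E + 1 - q * E := by linarith
    have h3 : b * x * E + b * x * (1 - x) = 2 * b * x * (E + q * E') := by
      linear_combination -b * x * h2 + b * x * hxX
    rw [h3]
    have h4 : (b * E + b * x * (E' * (E + q * E')⁻¹)) * (2 * b * x * (E + q * E')) =
        2 * b * x * (b * E * (E + q * E') + b * x * E') := by
      generalize E + q * E' = G at *
      field_simp
    rw [h4]
    subst hxX
    linear_combination b ^ 2 * q * E ^ 2 * 2 * hode

end Dawson

end

noncomputable section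

/-! ### Asymptotics of Dawson's function -/

section DawsonAsymptotics

lemma hasDerivAt_exp_sq (w : ℝ) :
    HasDerivAt (fun w : ℝ => Real.exp (w ^ 2 / 2)) (Real.exp (w ^ 2 / 2) * w) w := by
  refine ((hasDerivAt_pow 2 w).div_const 2).exp.congr_deriv ?_
  norm_num

lemma hasDerivAt_inv_pow {w : ℝ} (hw : w ≠ 0) (n : ℕ) :
    HasDerivAt (fun w : ℝ => (w⁻¹) ^ (n + 1)) (-((n + 1) * w⁻¹ ^ (n + 2))) w := by
  refine ((hasDerivAt_inv hw).pow (n + 1)).congr_deriv ?_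
  rw [Nat.add_sub_cancel, ← inv_pow]
  push_cast
  ring

/-- A partial sum of the asymptotic series 1/w + 1/w³ + 3/w⁵ + … is subtracted. After multiplication
by the integrating factor e^{w²/2} the derivative is positive. -/
lemma dawson_lower : ∃ C, ∀ w, 1 ≤ w →
    C ≤ (dawson w - w⁻¹ ^ 1 - w⁻¹ ^ 3) * Real.exp (w ^ 2 / 2) := by
  have hd : ∀ w, 1 ≤ w → HasDerivAt
      (fun w => (dawson w - w⁻¹ ^ 1 - w⁻¹ ^ 3) * Real.exp (w ^ 2 / 2))
      (3 * w⁻¹ ^ 4 * Real.exp (w ^ 2 / 2)) w := by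
    intro w hw
    have hw0 : w ≠ 0 := by linarith
    refine ((((hasDerivAt_dawson w).sub (hasDerivAt_inv_pow hw0 0)).sub
      (hasDerivAt_inv_pow hw0 2)).mul (hasDerivAt_exp_sq w)).congr_deriv ?_
    simp only [Pi.sub_apply, inv_pow]
    push_cast
    norm_num
    field_simp
    ring
  refine ⟨_, fun w hw => le_of_hasDerivWithinAt_nonneg hw
    (fun x hx => (hd x hx.1).hasDerivWithinAt) fun x hx => by positivity⟩

/-- The coefficient 4 exceeds the true coefficient 3 of 1/w⁵, so the derivative changes sign once w²
≥ 20; hence w ≥ 5. -/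
lemma dawson_upper : ∃ C, ∀ w, 5 ≤ w →
    (dawson w - w⁻¹ ^ 1 - w⁻¹ ^ 3 - 4 * w⁻¹ ^ 5) * Real.exp (w ^ 2 / 2) ≤ C := by
  have hd : ∀ w, 5 ≤ w → HasDerivAt
      (fun w => -((dawson w - w⁻¹ ^ 1 - w⁻¹ ^ 3 - 4 * w⁻¹ ^ 5) * Real.exp (w ^ 2 / 2)))
      ((w ^ 2 - 20) * w⁻¹ ^ 6 * Real.exp (w ^ 2 / 2)) w := by
    intro w hw
    have hw0 : w ≠ 0 := by linarith
    refine (((((hasDerivAt_dawson w).sub (hasDerivAt_inv_pow hw0 0)).sub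
      (hasDerivAt_inv_pow hw0 2)).sub ((hasDerivAt_inv_pow hw0 4).const_mul 4)).mul
        (hasDerivAt_exp_sq w)).neg.congr_deriv ?_
    simp only [Pi.sub_apply, inv_pow]
    push_cast
    norm_num
    field_simp
    ring
  refine ⟨(dawson 5 - (5:ℝ)⁻¹ ^ 1 - (5:ℝ)⁻¹ ^ 3 - 4 * (5:ℝ)⁻¹ ^ 5) * Real.exp ((5:ℝ) ^ 2 / 2), fun w hw => ?_⟩
  have h := le_of_hasDerivWithinAt_nonneg hw (fun x hx => (hd x hx.1).hasDerivWithinAt)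
    fun x hx => by
      have : 0 ≤ x ^ 2 - 20 := by nlinarith [hx.1]
      positivity
  exact neg_le_neg_iff.1 h

lemma tendsto_pow_mul_exp_neg_sq :
    Tendsto (fun w : ℝ => w ^ 3 * Real.exp (-(w ^ 2 / 2))) atTop (𝓝 0) := by
  refine squeeze_zero' ?_ ?_ (Real.tendsto_pow_mul_exp_neg_atTop_nhds_zero 3)
  · filter_upwards [eventually_ge_atTop 0] with w hw
    positivity
  · filter_upwards [eventually_ge_atTop 2] with w hw
    gcongr
    nlinarith

/-- The second order term of the expansion of D; it determines the limit of (x - 1)/y, that is, the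
direction of approach to L₁. -/
lemma tendsto_dawson_sq : Tendsto (fun w => w ^ 2 * (w * dawson w - 1)) atTop (𝓝 1) := by
  obtain ⟨C₁, hC₁⟩ := dawson_lower
  obtain ⟨C₂, hC₂⟩ := dawson_upper
  have h0 : Tendsto (fun w => w ^ 3 * (dawson w - w⁻¹ ^ 1 - w⁻¹ ^ 3)) atTop (𝓝 0) := by
    have hlow : Tendsto (fun w : ℝ => C₁ * (w ^ 3 * Real.exp (-(w ^ 2 / 2)))) atTop (𝓝 0) := by
      simpa using tendsto_pow_mul_exp_neg_sq.const_mul C₁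
    have hupp : Tendsto (fun w : ℝ => C₂ * (w ^ 3 * Real.exp (-(w ^ 2 / 2))) + 4 * w⁻¹ ^ 2) atTop
        (𝓝 0) := by
      have := (tendsto_pow_mul_exp_neg_sq.const_mul C₂).add
        ((tendsto_inv_atTop_zero (𝕜 := ℝ)).pow 2 |>.const_mul 4)
      simpa using this
    have hexp : ∀ w z : ℝ, z = z * Real.exp (w ^ 2 / 2) * Real.exp (-(w ^ 2 / 2)) := fun w z => by
      rw [mul_assoc, ← Real.exp_add]; simp
    refine tendsto_of_tendsto_of_tendsto_of_le_of_le' hlow hupp ?_ ?_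
    · filter_upwards [eventually_ge_atTop 1] with w hw
      rw [hexp w (dawson w - w⁻¹ ^ 1 - w⁻¹ ^ 3)]
      calc C₁ * (w ^ 3 * Real.exp (-(w ^ 2 / 2))) = w ^ 3 * (C₁ * Real.exp (-(w ^ 2 / 2))) := by ring
        _ ≤ _ := by gcongr; exact hC₁ w hw
    · filter_upwards [eventually_ge_atTop 5] with w hw
      have e1 : w ^ 3 * (dawson w - w⁻¹ ^ 1 - w⁻¹ ^ 3) =
          w ^ 3 * (dawson w - w⁻¹ ^ 1 - w⁻¹ ^ 3 - 4 * w⁻¹ ^ 5) + 4 * w⁻¹ ^ 2 := by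
        have : w ≠ 0 := by linarith
        field_simp
        ring
      rw [e1, hexp w (dawson w - w⁻¹ ^ 1 - w⁻¹ ^ 3 - 4 * w⁻¹ ^ 5)]
      calc _ ≤ w ^ 3 * (C₂ * Real.exp (-(w ^ 2 / 2))) + 4 * w⁻¹ ^ 2 := by
            gcongr; exact hC₂ w hw
        _ = _ := by ring
  have h1 := h0.add_const 1
  rw [zero_add] at h1
  refine h1.congr' ?_
  filter_upwards [eventually_gt_atTop 0] with w hw
  field_simp
  ring

lemma tendsto_mul_dawson : Tendsto (fun w => w * dawson w) atTop (𝓝 1) := by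
  have h := (tendsto_dawson_sq.mul ((tendsto_inv_atTop_zero (𝕜 := ℝ)).pow 2)).const_add 1
  have h' : Tendsto (fun w : ℝ => 1 + w ^ 2 * (w * dawson w - 1) * w⁻¹ ^ 2) atTop (𝓝 1) := by
    simpa using h
  refine h'.congr' ?_
  filter_upwards [eventually_gt_atTop 0] with w hw
  field_simp
  ring

lemma tendsto_dawson : Tendsto dawson atTop (𝓝 0) := by
  have h := tendsto_mul_dawson.mul (tendsto_inv_atTop_zero (𝕜 := ℝ))
  rw [mul_zero] at h
  refine h.congr' ?_
  filter_upwards [eventually_gt_atTop 0] with w hw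
  field_simp

/-- The slope `(x - 1) / y` along the connecting orbit. -/
def dawsonSlope (b w : ℝ) : ℝ := (w * dawson w - 1) / (b * dawson w ^ 2)

lemma tendsto_dawsonSlope {b : ℝ} (hb : 0 < b) : Tendsto (dawsonSlope b) atTop (𝓝 b⁻¹) := by
  have h := tendsto_dawson_sq.div ((tendsto_mul_dawson.pow 2).const_mul b) (by simp [hb.ne'])
  simp only [one_pow, mul_one, one_div] at h
  refine h.congr' ?_
  filter_upwards [eventually_gt_atTop 0] with w hw
  have := (dawson_pos hw).ne'
  simp only [dawsonSlope, Pi.div_apply]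
  field_simp

/-- This is the invariance equation on ρ = 0, with the parameter w in place of y = b D(w)². -/
lemma hasDerivAt_dawsonSlope {b w : ℝ} (hb : 0 < b) (hw : 0 < w) :
    HasDerivAt (dawsonSlope b) ((1 - b * dawsonSlope b w +
      b ^ 2 * dawson w ^ 2 * dawsonSlope b w ^ 2) / (b * dawson w)) w := by
  have hD := hasDerivAt_dawson w
  have hD0 := (dawson_pos hw).ne'
  have h1 : HasDerivAt (fun w => w * dawson w - 1) (dawson w + w * (1 - w * dawson w)) w :=
    (((hasDerivAt_id w).mul hD).sub_const 1).congr_deriv (by simp)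
  have h2 : HasDerivAt (fun w => b * dawson w ^ 2) (b * (2 * dawson w * (1 - w * dawson w))) w :=
    ((hD.pow 2).const_mul b).congr_deriv (by norm_num)
  refine (h1.div h2 (by positivity)).congr_deriv ?_
  simp only [dawsonSlope]
  field_simp
  ring

/-- The derivative is D e^{w²/2} ≥ 0. Hence w D crosses the value 1 at most once, and D increases
before the crossing and decreases after it. -/
lemma dawson_sub_mono {v w : ℝ} (hv : 0 ≤ v) (hvw : v ≤ w) :
    (v * dawson v - 1) * Real.exp (v ^ 2 / 2) ≤ (w * dawson w - 1) * Real.exp (w ^ 2 / 2) := by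
  have hd : ∀ w, HasDerivAt (fun w => (w * dawson w - 1) * Real.exp (w ^ 2 / 2))
      (dawson w * Real.exp (w ^ 2 / 2)) w := fun w => by
    refine ((((hasDerivAt_id w).mul (hasDerivAt_dawson w)).sub_const 1).mul
      (hasDerivAt_exp_sq w)).congr_deriv ?_
    simp only [id, Pi.mul_apply]
    ring
  refine le_of_hasDerivWithinAt_nonneg hvw (fun x _ => (hd x).hasDerivWithinAt) fun x hx => ?_
  exact mul_nonneg (mul_nonneg (hv.trans hx.1) (dawsonE_pos _).le) (Real.exp_pos _).le

lemma mul_dawson_le_one {v w : ℝ} (hv : 0 ≤ v) (hvw : v ≤ w) (hw : w * dawson w ≤ 1) :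
    v * dawson v ≤ 1 := by
  have h := dawson_sub_mono hv hvw
  have h1 : (w * dawson w - 1) * Real.exp (w ^ 2 / 2) ≤ 0 :=
    mul_nonpos_of_nonpos_of_nonneg (by linarith) (Real.exp_pos _).le
  by_contra hcon
  have h2 : 0 < (v * dawson v - 1) * Real.exp (v ^ 2 / 2) :=
    mul_pos (by linarith) (Real.exp_pos _)
  linarith

lemma one_lt_mul_dawson {v w : ℝ} (hv : 0 ≤ v) (hvw : v ≤ w) (h1 : 1 < v * dawson v) :
    1 < w * dawson w := by
  by_contra h
  exact absurd (mul_dawson_le_one hv hvw (not_lt.1 h)) (not_le.2 h1)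

lemma dawson_lt {v w : ℝ} (hv : 0 ≤ v) (hvw : v < w) (h1 : 1 < v * dawson v) :
    dawson w < dawson v := by
  have hanti : StrictAntiOn dawson (Icc v w) := by
    refine strictAntiOn_of_deriv_neg (convex_Icc v w)
      (fun x _ => (hasDerivAt_dawson x).continuousAt.continuousWithinAt) fun x hx => ?_
    rw [(hasDerivAt_dawson x).deriv]
    have := one_lt_mul_dawson hv (interior_subset hx).1 h1
    linarith
  exact hanti ⟨le_rfl, hvw.le⟩ ⟨hvw.le, le_rfl⟩ hvw

end DawsonAsymptotics

end

/-! ### The inverse of the integral of `exp (t² / 2)` -/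

section ExpInt

lemma strictMono_expInt_one : StrictMono (expInt 1) :=
  strictMono_of_deriv_pos fun s => by
    rw [(hasDerivAt_expInt 1 s).deriv]
    exact Real.exp_pos _

lemma monotone_expInt_one_sub : Monotone fun s => expInt 1 s - s := by
  have hd : ∀ s, HasDerivAt (fun s => expInt 1 s - s) (Real.exp (1 * s ^ 2 / 2) - 1) s := fun s =>
    (hasDerivAt_expInt 1 s).sub (hasDerivAt_id s)
  refine monotone_of_deriv_nonneg (fun s => (hd s).differentiableAt) fun s => ?_
  rw [(hd s).deriv]
  have : 1 ≤ Real.exp (1 * s ^ 2 / 2) := Real.one_le_exp (by positivity)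
  linarith

lemma le_expInt_one {s : ℝ} (hs : 0 ≤ s) : s ≤ expInt 1 s := by
  have := monotone_expInt_one_sub hs
  simp only [expInt_zero] at this
  linarith

lemma expInt_one_le {s : ℝ} (hs : s ≤ 0) : expInt 1 s ≤ s := by
  have := monotone_expInt_one_sub hs
  simp only [expInt_zero] at this
  linarith

lemma surjective_expInt_one : Function.Surjective (expInt 1) := by
  refine Continuous.surjective
    (continuous_iff_continuousAt.2 fun s => (hasDerivAt_expInt 1 s).continuousAt) ?_ ?_
  · refine tendsto_atTop_mono' _ ?_ tendsto_id
    filter_upwards [eventually_ge_atTop 0] with s hs using le_expInt_one hs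
  · refine tendsto_atBot_mono' _ ?_ tendsto_id
    filter_upwards [eventually_le_atBot 0] with s hs using expInt_one_le hs

/-- The inverse of `expInt 1`. -/
noncomputable def invExpInt : ℝ ≃o ℝ :=
  (strictMono_expInt_one.orderIsoOfSurjective _ surjective_expInt_one).symm

lemma expInt_invExpInt (z : ℝ) : expInt 1 (invExpInt z) = z :=
  (strictMono_expInt_one.orderIsoOfSurjective _ surjective_expInt_one).apply_symm_apply z

lemma invExpInt_expInt (s : ℝ) : invExpInt (expInt 1 s) = s :=
  (strictMono_expInt_one.orderIsoOfSurjective _ surjective_expInt_one).symm_apply_apply s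

lemma invExpInt_zero : invExpInt 0 = 0 := by
  have := invExpInt_expInt 0
  rwa [expInt_zero] at this

lemma hasDerivAt_invExpInt (z : ℝ) :
    HasDerivAt invExpInt (Real.exp (-(invExpInt z ^ 2 / 2))) z := by
  have h := HasDerivAt.of_local_left_inverse (f := expInt 1) (g := invExpInt) (a := z)
    invExpInt.continuous.continuousAt (hasDerivAt_expInt 1 _) (Real.exp_pos _).ne'
    (Eventually.of_forall expInt_invExpInt)
  rw [← Real.exp_neg, one_mul] at h
  exact h

end ExpInt

/-! ### The orbit which connects the origin with `L₁` -/

section Connection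

variable {b : ℝ}

/-- The curve which connects the origin with `L₁`. -/
noncomputable def dawsonCurve (b w : ℝ) : ℝ × ℝ × ℝ := (0, w * dawson w, b * dawson w ^ 2)

/-- A parametrization of the positive half line by the time along the connecting orbit. -/
noncomputable def dawsonTime (b k t : ℝ) : ℝ := invExpInt (k * Real.exp (b * t))

variable {k : ℝ}

lemma hasDerivAt_mul_exp (b k t : ℝ) :
    HasDerivAt (fun t => k * Real.exp (b * t)) (b * (k * Real.exp (b * t))) t :=
  ((((hasDerivAt_id t).const_mul b).exp).const_mul k).congr_deriv (by simp only [id]; ring)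

lemma hasDerivAt_dawsonTime (b k t : ℝ) :
    HasDerivAt (dawsonTime b k) (b * dawson (dawsonTime b k t)) t := by
  refine (HasDerivAt.comp t (hasDerivAt_invExpInt _) (hasDerivAt_mul_exp b k t)).congr_deriv ?_
  rw [dawson_eq, dawsonTime, expInt_invExpInt]
  ring

lemma dawsonTime_pos (hk : 0 < k) (t : ℝ) : 0 < dawsonTime b k t := by
  rw [dawsonTime, ← invExpInt_zero]
  exact invExpInt.strictMono (mul_pos hk (Real.exp_pos _))

lemma dawsonTime_zero (w : ℝ) : dawsonTime b (expInt 1 w) 0 = w := by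
  simp [dawsonTime, invExpInt_expInt]

lemma expInt_pos {w : ℝ} (hw : 0 < w) : 0 < expInt 1 w := hw.trans_le (le_expInt_one hw.le)

lemma dawsonTime_le (hk : 0 < k) (t : ℝ) : dawsonTime b k t ≤ k * Real.exp (b * t) := by
  have h := le_expInt_one (dawsonTime_pos (b := b) hk t).le
  rwa [dawsonTime, expInt_invExpInt] at h

lemma tendsto_dawsonTime_atBot (hb : 0 < b) (k : ℝ) : Tendsto (dawsonTime b k) atBot (𝓝 0) := by
  have h1 : Tendsto (fun t => k * Real.exp (b * t)) atBot (𝓝 0) := by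
    simpa using (Real.tendsto_exp_atBot.comp (tendsto_id.const_mul_atBot hb)).const_mul k
  have h2 := (invExpInt.continuous.tendsto 0).comp h1
  rwa [invExpInt_zero] at h2

lemma tendsto_dawsonTime_atTop (hb : 0 < b) (hk : 0 < k) :
    Tendsto (dawsonTime b k) atTop atTop := by
  have h1 : Tendsto (fun t => k * Real.exp (b * t)) atTop atTop :=
    (Real.tendsto_exp_atTop.comp (tendsto_id.const_mul_atTop hb)).const_mul_atTop hk
  exact invExpInt.tendsto_atTop.comp h1

lemma exists_dawsonTime_eq (hb : 0 < b) (hk : 0 < k) {w : ℝ} (hw : 0 < w) :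
    ∃ t, dawsonTime b k t = w := by
  refine ⟨Real.log (expInt 1 w / k) / b, ?_⟩
  rw [dawsonTime, mul_div_cancel₀ _ hb.ne', Real.exp_log (div_pos (expInt_pos hw) hk),
    mul_div_cancel₀ _ hk.ne', invExpInt_expInt]

lemma isSolutionOn_dawsonCurve (a b α k : ℝ) (J : Set ℝ) :
    IsSolutionOn (kappa1Field a b α) (kappa1Space a) (fun t => dawsonCurve b (dawsonTime b k t))
      J := by
  have hD : ∀ t, HasDerivAt (fun t => dawson (dawsonTime b k t))
      ((1 - dawsonTime b k t * dawson (dawsonTime b k t)) * (b * dawson (dawsonTime b k t))) t :=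
    fun t => (hasDerivAt_dawson _).comp t (hasDerivAt_dawsonTime b k t)
  refine isSolutionOn_planar (fun t _ => HasDerivAt.hasDerivWithinAt ?_)
    (fun t _ => HasDerivAt.hasDerivWithinAt ?_)
  · refine ((hasDerivAt_dawsonTime b k t).mul (hD t)).congr_deriv ?_
    ring
  · refine (((hD t).pow 2).const_mul b).congr_deriv ?_
    push_cast
    ring

lemma dawsonCurve_eq_smul (b w : ℝ) :
    dawsonCurve b w = w ^ 2 • ((0, dawsonE (w ^ 2), b * dawsonE (w ^ 2) ^ 2) : ℝ × ℝ × ℝ) := by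
  simp only [dawsonCurve, dawson, Prod.smul_mk, smul_eq_mul, mul_zero, Prod.mk.injEq, true_and]
  exact ⟨by ring, by ring⟩

lemma dawsonCurve_sub_eq_smul (hb : 0 < b) {w : ℝ} (hw : 0 < w) :
    dawsonCurve b w - pointL1 = dawson w ^ 2 • ((0, b * dawsonSlope b w, b) : ℝ × ℝ × ℝ) := by
  have := (dawson_pos hw).ne'
  simp only [dawsonCurve, pointL1, Prod.smul_mk, smul_eq_mul, mul_zero, Prod.mk_sub_mk,
    Prod.mk.injEq, sub_zero, true_and, dawsonSlope]
  generalize dawson w = d at *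
  constructor
  · field_simp
  · ring

lemma approachesAlong_of_smul {E : Type*} [NormedAddCommGroup E] [NormedSpace ℝ E] {γ : ℝ → E}
    {l : Filter ℝ} {p v : E} {c : ℝ → ℝ} {u : ℝ → E} (hγ : Tendsto γ l (𝓝 p))
    (h : ∀ t, γ t - p = c t • u t) (hc : ∀ t, 0 < c t) (hu : Tendsto u l (𝓝 v)) (hv : v ≠ 0) :
    ApproachesAlong γ l p v := by
  refine ⟨hγ, ?_⟩
  have h1 := (hu.norm.inv₀ (norm_ne_zero_iff.2 hv)).smul hu
  refine h1.congr fun t => ?_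
  rw [h t, norm_smul, Real.norm_of_nonneg (hc t).le, smul_smul, mul_inv, mul_right_comm,
    inv_mul_cancel₀ (hc t).ne', one_mul]

lemma tendsto_dawson_chart (b : ℝ) : Tendsto
    (fun w => ((0, dawsonE (w ^ 2), b * dawsonE (w ^ 2) ^ 2) : ℝ × ℝ × ℝ)) (𝓝 0)
      (𝓝 (0, 1, b)) := by
  have hE := contDiff_dawsonE.continuous
  have : Continuous fun w : ℝ => ((0, dawsonE (w ^ 2), b * dawsonE (w ^ 2) ^ 2) : ℝ × ℝ × ℝ) := by
    fun_prop
  have h := this.tendsto 0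
  simpa [dawsonE_zero] using h

lemma tendsto_dawsonCurve_zero (b : ℝ) : Tendsto (dawsonCurve b) (𝓝 0) (𝓝 0) := by
  have h := ((continuous_pow 2).tendsto (0 : ℝ)).smul (tendsto_dawson_chart b)
  simp only [ne_eq, OfNat.ofNat_ne_zero, not_false_eq_true, zero_pow, zero_smul] at h
  exact h.congr fun w => (dawsonCurve_eq_smul b w).symm

lemma strongDirection_ne_zero (b : ℝ) : ((0, 1, b) : ℝ × ℝ × ℝ) ≠ 0 := by simp

lemma approachesAlong_dawsonCurve_atBot (hb : 0 < b) (hk : 0 < k) :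
    ApproachesAlong (fun t => dawsonCurve b (dawsonTime b k t)) atBot 0 (0, 1, b) := by
  have hW := tendsto_dawsonTime_atBot hb k
  exact approachesAlong_of_smul ((tendsto_dawsonCurve_zero b).comp hW)
    (fun t => (sub_zero _).trans (dawsonCurve_eq_smul b _))
    (fun t => pow_pos (dawsonTime_pos hk t) 2) ((tendsto_dawson_chart b).comp hW)
    (strongDirection_ne_zero b)

lemma tendsto_dawsonCurve_atTop (b : ℝ) : Tendsto (dawsonCurve b) atTop (𝓝 pointL1) := by
  refine tendsto_const_nhds.prodMk_nhds (tendsto_mul_dawson.prodMk_nhds ?_)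
  simpa using (tendsto_dawson.pow 2).const_mul b

lemma approachesAlong_dawsonCurve_atTop (hb : 0 < b) (hk : 0 < k) :
    ApproachesAlong (fun t => dawsonCurve b (dawsonTime b k t)) atTop pointL1 (0, 1, b) := by
  have hW := tendsto_dawsonTime_atTop hb hk
  refine approachesAlong_of_smul (u := fun t => (0, b * dawsonSlope b (dawsonTime b k t), b))
    ((tendsto_dawsonCurve_atTop b).comp hW)
    (fun t => dawsonCurve_sub_eq_smul hb (dawsonTime_pos hk t))
    (fun t => pow_pos (dawson_pos (dawsonTime_pos hk t)) 2) ?_ (strongDirection_ne_zero b)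
  refine tendsto_const_nhds.prodMk_nhds (Tendsto.prodMk_nhds ?_ tendsto_const_nhds)
  have := ((tendsto_dawsonSlope hb).comp hW).const_mul b
  rwa [mul_inv_cancel₀ hb.ne'] at this

/-- The parameter is at most k e^{bt} and the curve is quadratic in it, so the decay rate is 2b. -/
lemma dawsonCurve_mem_kappa1Wuu (a α : ℝ) (hb : 0 < b) {w : ℝ} (hw : 0 < w) :
    dawsonCurve b w ∈ kappa1Wuu a b α := by
  set k := expInt 1 w with hk
  have hk0 : 0 < k := expInt_pos hw
  have hW := tendsto_dawsonTime_atBot hb k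
  refine ⟨fun t => dawsonCurve b (dawsonTime b k t), isSolutionOn_dawsonCurve a b α k _,
    congrArg (dawsonCurve b) (dawsonTime_zero w), (tendsto_dawsonCurve_zero b).comp hW, 2 * b, by linarith, ?_⟩
  have h1 : (fun t => dawsonTime b k t ^ 2) =O[atBot] fun t => Real.exp (2 * b * t) := by
    refine IsBigO.of_bound (k ^ 2) (Eventually.of_forall fun t => ?_)
    rw [Real.norm_of_nonneg (sq_nonneg _), Real.norm_of_nonneg (Real.exp_pos _).le]
    calc dawsonTime b k t ^ 2 ≤ (k * Real.exp (b * t)) ^ 2 :=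
          pow_le_pow_left₀ (dawsonTime_pos hk0 t).le (dawsonTime_le hk0 t) 2
      _ = k ^ 2 * Real.exp (2 * b * t) := by
          rw [mul_pow, ← Real.exp_nat_mul]; congr 2; push_cast; ring
  have h2 := h1.smul (((tendsto_dawson_chart b).comp hW).isBigO_one ℝ)
  refine (h2.congr_left fun t => ?_).congr_right fun t => by simp
  simp only [Function.comp_apply, sub_zero, dawsonCurve_eq_smul b (dawsonTime b k t)]

end Connection

/-! ### Backward orbits in the half plane `ρ₁ = 0`, `y₁ > 0` -/

section HalfPlane

variable {a b α : ℝ} {P : Set (ℝ × ℝ × ℝ)} {γ : ℝ → ℝ × ℝ × ℝ}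

lemma y_pos_of_pos {J : Set ℝ} (hJ : J.OrdConnected)
    (h : IsSolutionOn (kappa1Field a b α) (kappa1Space a) γ J) {s : ℝ} (hs : s ∈ J)
    (h0 : 0 < (γ s).2.2) : ∀ t ∈ J, 0 < (γ t).2.2 := by
  intro t ht
  have hsub : Icc (min s t) (max s t) ⊆ J := by
    rcases le_total s t with hst | hst
    · simpa [hst] using hJ.out hs ht
    · simpa [hst] using hJ.out ht hs
  obtain ⟨A, hA⟩ := (h.mono le_rfl hsub).exists_exp_y
  rw [hA s ⟨min_le_left _ _, le_max_left _ _⟩ t ⟨min_le_right _ _, le_max_right _ _⟩]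
  exact mul_pos h0 (Real.exp_pos _)

/-- An explicit form of the backward orbits in the half plane. -/
lemma exists_halfPlane_formula (hb : 0 < b)
    (h : IsSolutionOn (kappa1Field a b α) (kappa1Space a) γ (Iic 0))
    (hρ : ∀ t ≤ 0, (γ t).1 = 0) (hy0 : 0 < (γ 0).2.2) :
    ∃ (c k : ℝ) (W : ℝ → ℝ), 0 < k ∧ ∀ t ≤ 0, W t = invExpInt (c + k * Real.exp (b * t)) ∧
      (γ t).2.1 = W t * (k * Real.exp (b * t) * Real.exp (-(W t ^ 2 / 2))) ∧
      (γ t).2.2 = b * (k * Real.exp (b * t) * Real.exp (-(W t ^ 2 / 2))) ^ 2 := by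
  have hy := y_pos_of_pos ordConnected_Iic h (mem_Iic.2 le_rfl) hy0
  -- Here q' = b (1 - x) q and, for W = x/q, W' = b q. The two constants k and c are the integrals
  -- of this pair.
  set q : ℝ → ℝ := fun t => √((γ t).2.2 / b) with hq
  have hq0 : ∀ t ≤ 0, 0 < q t := fun t ht => Real.sqrt_pos.2 (div_pos (hy t ht) hb)
  have hq2 : ∀ t ≤ 0, b * q t ^ 2 = (γ t).2.2 := fun t ht => by
    rw [hq, Real.sq_sqrt (div_pos (hy t ht) hb).le, mul_div_cancel₀ _ hb.ne']
  have hqd : ∀ t ∈ Iic (0 : ℝ), HasDerivWithinAt q (b * (1 - (γ t).2.1) * q t) (Iic 0) t := by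
    intro t ht
    refine (((h.planar_y ht (hρ t ht)).div_const b).sqrt (div_pos (hy t ht) hb).ne').congr_deriv ?_
    change _ / (2 * q t) = _
    rw [← hq2 t ht]
    have := (hq0 t ht).ne'
    field_simp
  set W : ℝ → ℝ := fun t => (γ t).2.1 / q t with hW
  have hWq : ∀ t ≤ 0, (γ t).2.1 = W t * q t := fun t ht => by
    rw [hW, div_mul_cancel₀ _ (hq0 t ht).ne']
  have hWd : ∀ t ∈ Iic (0 : ℝ), HasDerivWithinAt W (b * q t) (Iic 0) t := by
    intro t ht
    refine ((h.planar_x ht (hρ t ht)).div (hqd t ht) (hq0 t ht).ne').congr_deriv ?_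
    rw [← hq2 t ht]
    have := (hq0 t ht).ne'
    field_simp
    ring
  have hconst : ∀ {f : ℝ → ℝ}, (∀ t ∈ Iic (0 : ℝ), HasDerivWithinAt f 0 (Iic 0) t) →
      ∀ t ≤ 0, f t = f 0 := by
    intro f hf t ht
    have hsub : Icc t 0 ⊆ Iic 0 := fun x hx => hx.2
    exact (constant_of_has_deriv_right_zero (fun x hx => ((hf x hx.2).mono hsub).continuousWithinAt)
      (fun x hx => ((hf x hx.2.le).mono hsub).mono_of_mem_nhdsWithin
        (Icc_mem_nhdsGE_of_mem hx)) 0 ⟨ht, le_rfl⟩).symm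
  have hex : ∀ t, HasDerivAt (fun t => Real.exp (-(b * t))) (Real.exp (-(b * t)) * -b) t :=
    fun t => by simpa using ((hasDerivAt_id t).const_mul b).neg.exp
  have h1 : ∀ t ≤ 0, q t * Real.exp (W t ^ 2 / 2) * Real.exp (-(b * t)) =
      q 0 * Real.exp (W 0 ^ 2 / 2) * Real.exp (-(b * 0)) := by
    refine hconst fun t ht => ?_
    have hE : HasDerivWithinAt (fun t => Real.exp (W t ^ 2 / 2))
        (Real.exp (W t ^ 2 / 2) * W t * (b * q t)) (Iic 0) t :=
      (hasDerivAt_exp_sq (W t)).comp_hasDerivWithinAt t (hWd t ht)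
    refine (((hqd t ht).mul hE).mul (hex t).hasDerivWithinAt).congr_deriv ?_
    simp only [Pi.mul_apply]
    rw [hWq t ht]
    ring
  set k := q 0 * Real.exp (W 0 ^ 2 / 2) with hk
  have hk0 : 0 < k := mul_pos (hq0 0 le_rfl) (Real.exp_pos _)
  have h2 : ∀ t ≤ 0, q t * Real.exp (W t ^ 2 / 2) = k * Real.exp (b * t) := by
    intro t ht
    have h3 := h1 t ht
    simp only [mul_zero, neg_zero, Real.exp_zero, mul_one] at h3
    rw [← h3, mul_assoc, ← Real.exp_add]
    simp
  have h3 : ∀ t ≤ 0, expInt 1 (W t) - k * Real.exp (b * t) =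
      expInt 1 (W 0) - k * Real.exp (b * 0) := by
    refine hconst fun t ht => ?_
    refine (((hasDerivAt_expInt 1 (W t)).comp_hasDerivWithinAt t (hWd t ht)).sub
      (hasDerivAt_mul_exp b k t).hasDerivWithinAt).congr_deriv ?_
    rw [← h2 t ht, one_mul]
    ring
  have h4 : ∀ t ≤ 0, k * Real.exp (b * t) * Real.exp (-(W t ^ 2 / 2)) = q t := by
    intro t ht
    rw [← h2 t ht, mul_assoc, ← Real.exp_add]
    simp
  refine ⟨expInt 1 (W 0) - k * Real.exp (b * 0), k, W, hk0, fun t ht => ⟨?_, ?_, ?_⟩⟩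
  · rw [← h3 t ht, sub_add_cancel, invExpInt_expInt]
  · rw [h4 t ht, hWq t ht]
  · rw [h4 t ht, hq2 t ht]

/-- A backward orbit with the constant `c = 0` lies on the connecting orbit. -/
lemma eq_dawsonCurve_of_formula {c k : ℝ} {W : ℝ → ℝ} (hc : c = 0)
    (hρ : ∀ t ≤ 0, (γ t).1 = 0)
    (h : ∀ t ≤ 0, W t = invExpInt (c + k * Real.exp (b * t)) ∧
      (γ t).2.1 = W t * (k * Real.exp (b * t) * Real.exp (-(W t ^ 2 / 2))) ∧
      (γ t).2.2 = b * (k * Real.exp (b * t) * Real.exp (-(W t ^ 2 / 2))) ^ 2) :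
    ∀ t ≤ 0, γ t = dawsonCurve b (dawsonTime b k t) := by
  subst hc
  intro t ht
  obtain ⟨h1, h2, h3⟩ := h t ht
  rw [zero_add] at h1
  have hD : dawson (dawsonTime b k t) = k * Real.exp (b * t) * Real.exp (-(W t ^ 2 / 2)) := by
    rw [dawson_eq, dawsonTime, expInt_invExpInt, ← h1]
  refine Prod.ext (hρ t ht) (Prod.ext ?_ ?_)
  · rw [h2, dawsonCurve, hD, dawsonTime, ← h1]
  · rw [h3, dawsonCurve, hD]

lemma tendsto_formula_atBot (hb : 0 < b) {c k : ℝ} {W : ℝ → ℝ}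
    (h : ∀ t ≤ 0, W t = invExpInt (c + k * Real.exp (b * t))) :
    Tendsto W atBot (𝓝 (invExpInt c)) := by
  have h1 : Tendsto (fun t => c + k * Real.exp (b * t)) atBot (𝓝 c) := by
    simpa using ((Real.tendsto_exp_atBot.comp (tendsto_id.const_mul_atBot hb)).const_mul
      k).const_add c
  refine ((invExpInt.continuous.tendsto c).comp h1).congr' ?_
  filter_upwards [eventually_le_atBot 0] with t ht using (h t ht).symm

lemma eq_zero_of_invExpInt {c : ℝ} (h : invExpInt c = 0) : c = 0 := by
  rw [← expInt_invExpInt c, h, expInt_zero]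

/-- As t → -∞, x e^{-bt} tends to W₀ k e^{-W₀²/2}, where W₀ is the limit of W. Decay faster than
e^{bt} forces W₀ = 0, that is c = 0. -/
theorem exists_dawsonTime_of_isBigO (hb : 0 < b)
    (h : IsSolutionOn (kappa1Field a b α) (kappa1Space a) γ (Iic 0))
    (hρ : ∀ t ≤ 0, (γ t).1 = 0) (hy0 : 0 < (γ 0).2.2) {ν : ℝ} (hν : b < ν)
    (hO : (fun t => (γ t).2.1) =O[atBot] fun t => Real.exp (ν * t)) :
    ∃ k > 0, ∀ t ≤ 0, γ t = dawsonCurve b (dawsonTime b k t) := by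
  obtain ⟨c, k, W, hk, hf⟩ := exists_halfPlane_formula hb h hρ hy0
  refine ⟨k, hk, eq_dawsonCurve_of_formula ?_ hρ hf⟩
  have hW := tendsto_formula_atBot hb fun t ht => (hf t ht).1
  have h1 : Tendsto (fun t => W t * (k * Real.exp (-(W t ^ 2 / 2)))) atBot
      (𝓝 (invExpInt c * (k * Real.exp (-(invExpInt c ^ 2 / 2))))) := by
    have hcont : Continuous fun w : ℝ => w * (k * Real.exp (-(w ^ 2 / 2))) := by fun_prop
    exact (hcont.tendsto _).comp hW
  have h2 : Tendsto (fun t => (γ t).2.1 * Real.exp (-(b * t))) atBot (𝓝 0) := by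
    have h3 := hO.mul (isBigO_refl (fun t => Real.exp (-(b * t))) atBot)
    refine h3.trans_tendsto ?_
    have h4 : Tendsto (fun t => Real.exp ((ν - b) * t)) atBot (𝓝 0) :=
      Real.tendsto_exp_atBot.comp (tendsto_id.const_mul_atBot (by linarith))
    refine h4.congr fun t => ?_
    rw [← Real.exp_add]
    ring_nf
  have h3 := tendsto_nhds_unique (h2.congr' ?_) h1
  · rcases mul_eq_zero.1 h3.symm with h4 | h4
    · exact eq_zero_of_invExpInt h4
    · exact absurd h4 (mul_pos hk (Real.exp_pos _)).ne'
  · filter_upwards [eventually_le_atBot 0] with t ht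
    rw [(hf t ht).2.1]
    calc W t * (k * Real.exp (b * t) * Real.exp (-(W t ^ 2 / 2))) * Real.exp (-(b * t))
        = W t * (k * Real.exp (-(W t ^ 2 / 2))) * (Real.exp (b * t) * Real.exp (-(b * t))) := by
          ring
      _ = _ := by rw [← Real.exp_add]; simp

/-- The relation W y = b q x is divided by the norm. As q → 0 and y keeps a positive share of the
norm, W must tend to 0, so c = 0. -/
theorem exists_dawsonTime_of_approachesAlong (hb : 0 < b)
    (h : IsSolutionOn (kappa1Field a b α) (kappa1Space a) γ (Iic 0)) (hy0 : 0 < (γ 0).2.2)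
    (hγ : ApproachesAlong γ atBot 0 (0, 1, b)) :
    ∃ k > 0, ∀ t ≤ 0, γ t = dawsonCurve b (dawsonTime b k t) := by
  have hρ := rho_eq_zero_of_unstable hb h hγ.1
  obtain ⟨c, k, W, hk, hf⟩ := exists_halfPlane_formula hb h hρ hy0
  refine ⟨k, hk, eq_dawsonCurve_of_formula ?_ hρ hf⟩
  have hW := tendsto_formula_atBot hb fun t ht => (hf t ht).1
  set n := ‖((0, 1, b) : ℝ × ℝ × ℝ)‖ with hn
  have hn0 : n ≠ 0 := norm_ne_zero_iff.2 (strongDirection_ne_zero b)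
  have hx : Tendsto (fun t => ‖γ t‖⁻¹ * (γ t).2.1) atBot (𝓝 n⁻¹) := by
    have := (((continuous_fst.comp continuous_snd).tendsto _).comp hγ.2)
    simpa [Function.comp_def, hn] using this
  have hy : Tendsto (fun t => ‖γ t‖⁻¹ * (γ t).2.2) atBot (𝓝 (n⁻¹ * b)) := by
    have := (((continuous_snd.comp continuous_snd).tendsto _).comp hγ.2)
    simpa [Function.comp_def, hn] using this
  set q : ℝ → ℝ := fun t => k * Real.exp (b * t) * Real.exp (-(W t ^ 2 / 2)) with hq
  have hq0 : Tendsto q atBot (𝓝 0) := by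
    have h1 : Tendsto (fun t => k * Real.exp (b * t)) atBot (𝓝 0) := by
      simpa using (Real.tendsto_exp_atBot.comp (tendsto_id.const_mul_atBot hb)).const_mul k
    have hcont : Continuous fun w : ℝ => Real.exp (-(w ^ 2 / 2)) := by fun_prop
    simpa using h1.mul ((hcont.tendsto _).comp hW)
  have h1 := hW.mul hy
  have h2 := (hq0.const_mul b).mul hx
  have h3 := tendsto_nhds_unique (h1.congr' ?_) h2
  · rw [mul_zero, zero_mul] at h3
    rcases mul_eq_zero.1 h3 with h4 | h4
    · exact eq_zero_of_invExpInt h4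
    · exact absurd h4 (mul_ne_zero (inv_ne_zero hn0) hb.ne')
  · filter_upwards [eventually_le_atBot 0] with t ht
    rw [(hf t ht).2.1, (hf t ht).2.2]
    simp only [hq]
    ring

end HalfPlane

/-! ### The invariant manifolds of the origin -/

section Origin

variable {a b α : ℝ} {γ γ' : ℝ → ℝ × ℝ × ℝ}

lemma planar_backward_unique (h : IsSolutionOn (kappa1Field a b α) (kappa1Space a) γ (Iic 0))
    (hρ : ∀ t ≤ 0, (γ t).1 = 0)
    (h' : IsSolutionOn (kappa1Field a b α) (kappa1Space a) γ' (Iic 0))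
    (hρ' : ∀ t ≤ 0, (γ' t).1 = 0) (h0 : γ 0 = γ' 0) : ∀ t ≤ 0, γ t = γ' t := by
  intro t ht
  set v : ℝ × ℝ → ℝ × ℝ := fun p => (p.2 + b * p.1 * (1 - p.1), 2 * b * (1 - p.1) * p.2) with hv
  have hvc : ContDiff ℝ 1 v := by fun_prop
  have hsub : Icc t 0 ⊆ Iic 0 := fun x hx => hx.2
  have hcont : ∀ {γ : ℝ → ℝ × ℝ × ℝ}, IsSolutionOn (kappa1Field a b α) (kappa1Space a) γ (Iic 0) →
      ContinuousOn (fun t => (γ t).2) (Icc t 0) := fun h =>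
    continuous_snd.comp_continuousOn (h.continuousOn.mono hsub)
  obtain ⟨R, hR⟩ := (isCompact_Icc.image_of_continuousOn (hcont h)).isBounded.subset_closedBall 0
  obtain ⟨R', hR'⟩ := (isCompact_Icc.image_of_continuousOn (hcont h')).isBounded.subset_closedBall 0
  obtain ⟨K, hK⟩ := (hvc.contDiffOn (s := Metric.closedBall 0 (max R R'))).exists_lipschitzOnWith
    one_ne_zero (convex_closedBall _ _) (isCompact_closedBall _ _)
  have hd : ∀ {γ : ℝ → ℝ × ℝ × ℝ}, IsSolutionOn (kappa1Field a b α) (kappa1Space a) γ (Iic 0) →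
      (∀ t ≤ 0, (γ t).1 = 0) → ∀ s ∈ Ioc t 0,
        HasDerivWithinAt (fun t => (γ t).2) (v (γ s).2) (Iic s) s := by
    intro γ h hρ s hs
    have h1 := (h.planar_x hs.2 (hρ s hs.2)).prodMk (h.planar_y hs.2 (hρ s hs.2))
    exact h1.mono (Iic_subset_Iic.2 hs.2)
  have hEq := ODE_solution_unique_of_mem_Icc_left (v := fun _ => v)
    (s := fun _ => Metric.closedBall 0 (max R R')) (fun s _ => hK) (hcont h) (hd h hρ)
    (fun s hs => Metric.closedBall_subset_closedBall (le_max_left _ _)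
      (hR (mem_image_of_mem _ (Ioc_subset_Icc_self hs)))) (hcont h') (hd h' hρ')
    (fun s hs => Metric.closedBall_subset_closedBall (le_max_right _ _)
      (hR' (mem_image_of_mem _ (Ioc_subset_Icc_self hs)))) (by rw [h0])
  exact Prod.ext ((hρ t ht).trans (hρ' t ht).symm) (hEq ⟨le_rfl, ht⟩)

/-- Backward orbits on a curve which is tangent to the strong eigenvector lie in the strong
unstable manifold. -/
lemma mem_kappa1Wuu_of_graph (hb : 0 < b)
    (h : IsSolutionOn (kappa1Field a b α) (kappa1Space a) γ (Iic 0))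
    (hγ : Tendsto γ atBot (𝓝 0)) {ψ : ℝ → ℝ} (hψ : ∀ t ≤ 0, (γ t).2.2 = ψ (γ t).2.1)
    (hx : ∀ t ≤ 0, |(γ t).2.1| ≤ 1 / 4 ∧
      |ψ (γ t).2.1 - b * (γ t).2.1| ≤ b / 4 * |(γ t).2.1|) :
    γ 0 ∈ kappa1Wuu a b α := by
  have hρ := rho_eq_zero_of_unstable hb h hγ
  refine ⟨γ, h, rfl, hγ, 3 / 2 * b, by linarith, ?_⟩
  -- Where x = 0 the curve gives y = 0 and any rate is correct; 2b keeps the lower bound 3b/2.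
  -- Elsewhere y/x ≥ 3b/4 and 1 - x ≥ 3/4.
  set c : ℝ → ℝ := fun t => if (γ t).2.1 = 0 then 2 * b else
    (γ t).2.2 / (γ t).2.1 + b * (1 - (γ t).2.1) with hc
  have hxd : ∀ t ∈ Iic (0 : ℝ), HasDerivWithinAt (fun t => (γ t).2.1) (c t * (γ t).2.1) (Iic 0) t := by
    intro t ht
    refine (h.planar_x ht (hρ t ht)).congr_deriv ?_
    rw [hc]
    by_cases h0 : (γ t).2.1 = 0
    · have h1 := (hx t ht).2
      rw [h0] at h1
      simp only [mul_zero, sub_zero, abs_zero] at h1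
      have h2 := hψ t ht
      rw [h0, abs_nonpos_iff.1 h1] at h2
      simp [h0, h2]
    · simp only [h0, if_false]
      field_simp
  have hck : ∀ t ≤ 0, 3 / 2 * b ≤ c t := by
    intro t ht
    simp only [hc]
    split_ifs with h0
    · linarith
    · obtain ⟨h1, h2⟩ := hx t ht
      rw [← hψ t ht] at h2
      have h3 : |(γ t).2.2 / (γ t).2.1 - b| ≤ b / 4 := by
        rw [div_sub' h0, abs_div, div_le_iff₀ (abs_pos.2 h0), mul_comm (γ t).2.1]
        exact h2
      have h4 := (abs_le.1 h3).1
      have h5 := (abs_le.1 h1).2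
      nlinarith
  have hxb : ∀ t ≤ 0, |(γ t).2.1| ≤ |(γ 0).2.1| * Real.exp (3 / 2 * b * t) := by
    intro t ht
    have hsub : Icc t 0 ⊆ Iic 0 := fun x hx => hx.2
    have h1 := abs_mul_exp_le_of_linear ht (fun s hs => (hxd s hs.2).mono hsub)
      (fun s hs => hck s hs.2)
    calc |(γ t).2.1| = |(γ t).2.1| * Real.exp (3 / 2 * b * (0 - t)) * Real.exp (3 / 2 * b * t) := by
          rw [mul_assoc, ← Real.exp_add]; ring_nf; simp
      _ ≤ _ := by gcongr
  have hyb : ∀ t ≤ 0, |(γ t).2.2| ≤ (5 / 4 * b) * |(γ t).2.1| := by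
    intro t ht
    have h2 := (hx t ht).2
    rw [← hψ t ht] at h2
    calc |(γ t).2.2| = |((γ t).2.2 - b * (γ t).2.1) + b * (γ t).2.1| := by ring_nf
      _ ≤ _ := abs_add_le _ _
      _ ≤ b / 4 * |(γ t).2.1| + b * |(γ t).2.1| := by
        rw [abs_mul, abs_of_pos hb]; gcongr
      _ = _ := by ring
  refine IsBigO.of_bound ((1 + 5 / 4 * b) * |(γ 0).2.1|) ?_
  filter_upwards [eventually_le_atBot 0] with t ht
  have h1 := hxb t ht
  have h2 := hyb t ht
  have h3 : 0 ≤ |(γ t).2.1| := abs_nonneg _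
  rw [sub_zero, Real.norm_of_nonneg (Real.exp_pos _).le, Prod.norm_def, Prod.norm_def, hρ t ht]
  have h4 : |(γ t).2.1| * (1 + 5 / 4 * b) ≤
      |(γ 0).2.1| * Real.exp (3 / 2 * b * t) * (1 + 5 / 4 * b) := by gcongr
  simp only [norm_zero, Real.norm_eq_abs]
  have h5 : 0 ≤ 5 / 4 * b * |(γ t).2.1| := by positivity
  refine max_le ?_ (max_le ?_ ?_)
  · nlinarith
  · nlinarith
  · nlinarith

/-- Small backward orbits in the strong unstable manifold lie on the invariant curve. -/
lemma eq_graph_of_isBigO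
    (h : IsSolutionOn (kappa1Field a b α) (kappa1Space a) γ (Iic 0))
    (hγ : Tendsto γ atBot (𝓝 0)) (hρ : ∀ t ≤ 0, (γ t).1 = 0) {δ : ℝ} (hδ : 0 < δ) {φ : ℝ → ℝ}
    (hφ : ContDiffOn ℝ ∞ φ (Ioo (-δ) δ)) (hφ0 : φ 0 = 0) (hφb : HasDerivAt φ b 0)
    (hφd : ∀ x ∈ Ioo (-δ) δ, HasDerivAt φ (deriv φ x) x ∧
        deriv φ x * (φ x + b * x * (1 - x)) = 2 * b * φ x * (1 - x))
    (hx : ∀ t ≤ 0, (γ t).2.1 ∈ Ioo (-δ) δ)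
    (hend : (γ 0).2.2 = φ (γ 0).2.1 ∨ ∃ ν, b < ν ∧ γ =O[atBot] fun t => Real.exp (ν * t)) :
    ∀ t ≤ 0, (γ t).2.2 = φ (γ t).2.1 := by
  -- The distance y - φ(x) satisfies a linear equation with this rate, which tends to 2b - b = b at
  -- the origin; decay faster than e^{bt} makes the distance vanish.
  set c : ℝ → ℝ := fun t => 2 * b * (1 - (γ t).2.1) - deriv φ (γ t).2.1 with hc
  have hcd : ContinuousOn (deriv φ) (Ioo (-δ) δ) :=
    hφ.continuousOn_deriv_of_isOpen isOpen_Ioo (by exact_mod_cast le_top)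
  have hxc : ContinuousOn (fun t => (γ t).2.1) (Iic 0) := by
    have := h.continuousOn
    fun_prop
  have hcc : ContinuousOn c (Iic 0) :=
    (by fun_prop : ContinuousOn (fun t => 2 * b * (1 - (γ t).2.1)) (Iic 0)).sub
      (hcd.comp hxc fun t ht => hx t ht)
  have hzd : ∀ t ∈ Iic (0 : ℝ), HasDerivWithinAt (fun t => (γ t).2.2 - φ (γ t).2.1)
      (c t * ((γ t).2.2 - φ (γ t).2.1)) (Iic 0) t := by
    intro t ht
    obtain ⟨h1, h2⟩ := hφd _ (hx t ht)
    refine ((h.planar_y ht (hρ t ht)).sub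
      (h1.comp_hasDerivWithinAt t (h.planar_x ht (hρ t ht)))).congr_deriv ?_
    simp only [hc]
    linear_combination -h2
  have hz : ∀ t ≤ 0, (γ t).2.2 - φ (γ t).2.1 = 0 := by
    rcases hend with h0 | ⟨ν, hν, hO⟩
    · intro t ht
      have hsub : Icc t 0 ⊆ Iic 0 := fun x hx => hx.2
      obtain ⟨A, hA⟩ := exists_exp_of_linear (f := fun t => (γ t).2.2 - φ (γ t).2.1)
        (hcc.mono hsub) fun s hs => (hzd s hs.2).mono hsub
      rw [hA 0 ⟨ht, le_rfl⟩ t ⟨le_rfl, ht⟩, h0, sub_self, zero_mul]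
    · have hx0 : Tendsto (fun t => (γ t).2.1) atBot (𝓝 0) :=
        tendsto_comp_origin hγ (f := fun p => p.2.1) (by fun_prop)
      have hxO : (fun t => (γ t).2.1) =O[atBot] γ := by
        refine IsBigO.of_bound 1 (Eventually.of_forall fun t => ?_)
        rw [one_mul]
        exact (norm_fst_le _).trans (norm_snd_le _)
      have hyO : (fun t => (γ t).2.2) =O[atBot] γ := by
        refine IsBigO.of_bound 1 (Eventually.of_forall fun t => ?_)
        rw [one_mul]
        exact (norm_snd_le _).trans (norm_snd_le _)
      have hφO : (fun t => φ (γ t).2.1) =O[atBot] γ := by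
        have h1 := hφb.isBigO_sub
        simp only [hφ0, sub_zero] at h1
        exact (h1.comp_tendsto hx0).trans hxO
      refine eq_zero_of_isBigO_atBot (f := fun t => (γ t).2.2 - φ (γ t).2.1) (c₀ := b) hcc hzd ?_ hν
        ((hyO.sub hφO).trans hO)
      have h0 : Ioo (-δ) δ ∈ 𝓝 (0 : ℝ) := Ioo_mem_nhds (by linarith) hδ
      have h1 : Tendsto (fun t => deriv φ (γ t).2.1) atBot (𝓝 (deriv φ 0)) :=
        ((hcd.continuousAt h0).tendsto).comp hx0
      rw [hφb.deriv] at h1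
      have h2 := ((hx0.const_sub 1).const_mul (2 * b)).sub h1
      have e : 2 * b * (1 - 0) - b = b := by ring
      rwa [e] at h2
  intro t ht
  linarith [hz t ht]

lemma eventually_abs_sub_le (hb : 0 < b) {ψ : ℝ → ℝ} (h0 : ψ 0 = 0) (hψ : HasDerivAt ψ b 0) :
    ∃ ε > 0, ∀ x, |x| < ε → |ψ x - b * x| ≤ b / 4 * |x| := by
  have h1 := (hasDerivAt_iff_isLittleO.1 hψ).bound (c := b / 4) (by positivity)
  simp only [h0, sub_zero, smul_eq_mul, Real.norm_eq_abs] at h1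
  obtain ⟨ε, hε, h2⟩ := Metric.eventually_nhds_iff.1 h1
  refine ⟨ε, hε, fun x hx => ?_⟩
  have := h2 (y := x) (by simpa [Real.dist_eq] using hx)
  rwa [mul_comm x b] at this

theorem stableManifold_inter (a α : ℝ) (hb : 0 < b) (U : Set (ℝ × ℝ × ℝ)) :
    stableManifold (kappa1Field a b α) (kappa1Space a) 0 ∩ U =
      {p | p ∈ U ∧ p.2.1 = 0 ∧ p.2.2 = 0 ∧ 0 ≤ p.1} := by
  ext p
  constructor
  · rintro ⟨⟨γ, hγ, rfl, hlim⟩, hU⟩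
    obtain ⟨h1, h2⟩ := eq_zero_of_stable hb hγ hlim
    exact ⟨hU, h1, h2, (hγ 0 self_mem_Ici).1.1⟩
  · rintro ⟨hU, h1, h2, h3⟩
    refine ⟨⟨fun t => (p.1 * Real.exp (-b * t), 0, 0), fun t _ => ⟨?_, ?_⟩, ?_, ?_⟩, hU⟩
    · simp only [kappa1Space, mem_ofPred_eq, mul_zero, add_zero, zero_lt_one, and_true]
      positivity
    · refine ((hasDerivAt_mul_exp (-b) p.1 t).prodMk
        (hasDerivAt_const t ((0 : ℝ), (0 : ℝ)))).hasDerivWithinAt.congr_deriv ?_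
      simp only [kappa1Field, kappa1Bracket_of_y]
      ext <;> simp
      ring
    · ext <;> simp [h1, h2]
    · have h4 : Tendsto (fun t => p.1 * Real.exp (-b * t)) atTop (𝓝 0) := by
        simpa using (Real.tendsto_exp_atBot.comp
          (tendsto_id.const_mul_atTop_of_neg (neg_neg_of_pos hb))).const_mul p.1
      exact h4.prodMk_nhds tendsto_const_nhds

/-- The local description of the invariant manifolds of the origin. -/
theorem exists_origin_neighborhood (a α : ℝ) (hb : 0 < b) :
    ∃ U : Set (ℝ × ℝ × ℝ), IsOpen U ∧ 0 ∈ U ∧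
      unstableManifold (kappa1Field a b α) (kappa1Space a) 0 ∩ U = {p | p ∈ U ∧ p.1 = 0} ∧
      ∃ (δ : ℝ) (φ : ℝ → ℝ), 0 < δ ∧ (∀ p ∈ U, |p.2.1| < δ) ∧ ContDiffOn ℝ ∞ φ (Ioo (-δ) δ) ∧
        (fun x => φ x - b * x) =O[𝓝 0] (fun x => x ^ 2) ∧
        kappa1Wuu a b α ∩ U = {p | p ∈ U ∧ p.1 = 0 ∧ p.2.2 = φ p.2.1} ∧
        ∀ (ε : ℝ) (ψ : ℝ → ℝ), 0 < ε → ContDiffOn ℝ 1 ψ (Ioo (-ε) ε) →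
          ψ 0 = 0 → deriv ψ 0 = b →
          IsLocallyInvariant (kappa1Field a b α) (kappa1Space a) {p | |p.2.1| < ε}
            {p | p.1 = 0 ∧ |p.2.1| < ε ∧ p.2.2 = ψ p.2.1} →
          ∀ᶠ x in 𝓝 0, ψ x = φ x := by
  obtain ⟨δ, φ, hδ, hφ, hφ0, hφb, hφO, hφd⟩ := exists_unstable_graph hb
  obtain ⟨ε₁, hε₁, hφε⟩ := eventually_abs_sub_le hb hφ0 hφb
  set δ' := min (min δ ε₁) (1 / 4) with hδ'
  have hδ'0 : 0 < δ' := lt_min (lt_min hδ hε₁) (by norm_num)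
  have hδ'δ : δ' ≤ δ := (min_le_left _ _).trans (min_le_left _ _)
  have hδ'ε : δ' ≤ ε₁ := (min_le_left _ _).trans (min_le_right _ _)
  have hδ'4 : δ' ≤ 1 / 4 := min_le_right _ _
  -- The orbit bound 4|x| + 8|y|/b is then below (4 + 8) d = δ'.
  set d := δ' / 12 with hd
  have hd0 : 0 < d := by positivity
  have hnear : ∀ x y : ℝ, |x| < d → |y| < b * d → 4 * |x| + 8 * (|y| / b) < δ' := by
    intro x y hx hy
    have : |y| / b < d := by rw [div_lt_iff₀ hb, mul_comm]; exact hy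
    linarith
  set U : Set (ℝ × ℝ × ℝ) := {p | |p.2.1| < d ∧ |p.2.2| < b * d} with hU
  have hgraph : kappa1Wuu a b α ∩ U = {p | p ∈ U ∧ p.1 = 0 ∧ p.2.2 = φ p.2.1} := by
    ext p
    constructor
    · rintro ⟨⟨γ, h, rfl, hlim, ν, hν, hO⟩, hpU⟩
      have hρ := rho_eq_zero_of_unstable hb h hlim
      have hn := hnear _ _ hpU.1 hpU.2
      -- The given orbit coincides with the explicit one, whose bound keeps x in the domain of φ for
      -- all negative times.
      obtain ⟨γ', h', h0', hlim', hs'⟩ := exists_backward_orbit a α hb (hn.le.trans hδ'4)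
      have heq := planar_backward_unique h hρ h' (fun t ht => (hs' t ht).1)
        (by rw [h0']; exact Prod.ext (hρ 0 le_rfl) rfl)
      refine ⟨hpU, hρ 0 le_rfl, ?_⟩
      refine eq_graph_of_isBigO h hlim hρ hδ hφ hφ0 hφb hφd (fun t ht => ?_)
        (Or.inr ⟨ν, hν, by simpa using hO⟩) 0 le_rfl
      rw [heq t ht]
      exact abs_lt.1 ((hs' t ht).2.trans_lt (hn.trans_le hδ'δ))
    · rintro ⟨hpU, h1, h2⟩
      have hn := hnear _ _ hpU.1 hpU.2
      obtain ⟨γ, h, h0, hlim, hs⟩ := exists_backward_orbit a α hb (hn.le.trans hδ'4)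
      have hp : γ 0 = p := by rw [h0, ← h1]
      refine ⟨?_, hpU⟩
      have hg := eq_graph_of_isBigO h hlim (fun t ht => (hs t ht).1) hδ hφ hφ0 hφb hφd
        (fun t ht => abs_lt.1 ((hs t ht).2.trans_lt (hn.trans_le hδ'δ)))
        (Or.inl (by rw [hp, h2]))
      rw [← hp]
      exact mem_kappa1Wuu_of_graph hb h hlim hg fun t ht =>
        ⟨((hs t ht).2.trans hn.le).trans hδ'4, hφε _ ((hs t ht).2.trans_lt (hn.trans_le hδ'ε))⟩
  refine ⟨U, ?_, ?_, ?_, δ, φ, hδ, ?_, hφ, hφO, hgraph, ?_⟩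
  · exact (isOpen_lt (f := fun p : ℝ × ℝ × ℝ => |p.2.1|) (by fun_prop) continuous_const).inter
      (isOpen_lt (f := fun p : ℝ × ℝ × ℝ => |p.2.2|) (by fun_prop) continuous_const)
  · simp only [hU, mem_ofPred_eq, Prod.fst_zero, Prod.snd_zero, abs_zero]
    exact ⟨hd0, mul_pos hb hd0⟩
  · ext p
    constructor
    · rintro ⟨⟨γ, h, rfl, hlim⟩, hpU⟩
      exact ⟨hpU, rho_eq_zero_of_unstable hb h hlim 0 le_rfl⟩
    · rintro ⟨hpU, h1⟩
      obtain ⟨γ, h, h0, hlim, -⟩ := exists_backward_orbit a α hb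
        ((hnear _ _ hpU.1 hpU.2).le.trans hδ'4)
      exact ⟨⟨γ, h, by rw [h0, ← h1], hlim⟩, hpU⟩
  · intro p hp
    have := hp.1
    linarith
  · intro ε ψ hε hψ hψ0 hψb hinv
    have hψd : HasDerivAt ψ b 0 := by
      have h1 := (hψ.contDiffAt (Ioo_mem_nhds (neg_neg_of_pos hε) hε)).differentiableAt one_ne_zero
      rw [← hψb]
      exact h1.hasDerivAt
    obtain ⟨ε₂, hε₂, hψε⟩ := eventually_abs_sub_le hb hψ0 hψd
    have hcont : Tendsto (fun x => 4 * |x| + 8 * (|ψ x| / b)) (𝓝 0) (𝓝 0) := by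
      have h1 : Tendsto ψ (𝓝 0) (𝓝 0) := by simpa [hψ0] using hψd.continuousAt.tendsto
      have h2 : Tendsto (fun x : ℝ => |x|) (𝓝 0) (𝓝 0) := by simpa using (continuous_abs.tendsto (0 : ℝ))
      simpa using (h2.const_mul 4).add (((h2.comp h1).div_const b).const_mul 8)
    have hsmall : 0 < min (min ε ε₂) (min (1 / 4) d) := by positivity
    have hcy : ∀ᶠ x in 𝓝 0, |ψ x| < b * d := by
      have h1 : ContinuousAt (fun x => |ψ x|) 0 := hψd.continuousAt.abs
      exact h1.eventually_lt_const (by simpa [hψ0] using mul_pos hb hd0)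
    filter_upwards [hcont.eventually (gt_mem_nhds hsmall), hcy] with x hx hxy
    have hx1 : 4 * |x| + 8 * (|ψ x| / b) < ε := hx.trans_le ((min_le_left _ _).trans (min_le_left _ _))
    have hx2 : 4 * |x| + 8 * (|ψ x| / b) < ε₂ :=
      hx.trans_le ((min_le_left _ _).trans (min_le_right _ _))
    have hx3 : 4 * |x| + 8 * (|ψ x| / b) < 1 / 4 :=
      hx.trans_le ((min_le_right _ _).trans (min_le_left _ _))
    have hx4 : 4 * |x| + 8 * (|ψ x| / b) < d :=
      hx.trans_le ((min_le_right _ _).trans (min_le_right _ _))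
    have hpos : 0 ≤ 8 * (|ψ x| / b) := by positivity
    have hpos' := abs_nonneg x
    obtain ⟨γ, h, h0, hlim, hs⟩ := exists_backward_orbit a α hb hx3.le
    -- Local invariance keeps the explicit backward orbit on the curve of ψ; tangency makes it
    -- strongly unstable, so its endpoint lies on the graph of φ.
    have hg : ∀ t ≤ 0, (γ t).2.2 = ψ (γ t).2.1 := by
      intro t ht
      refine (hinv γ t 0 (fun s hs' => ⟨⟨(h s hs'.2).1, (hs s hs'.2).2.trans_lt hx1⟩,
        (h s hs'.2).2.mono fun u hu => hu.2⟩) 0 ⟨ht, le_rfl⟩ ?_ t ⟨le_rfl, ht⟩).2.2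
      rw [h0]
      exact ⟨rfl, by simp only; linarith, rfl⟩
    have hmem := mem_kappa1Wuu_of_graph hb h hlim hg fun t ht =>
      ⟨(hs t ht).2.trans hx3.le, hψε _ ((hs t ht).2.trans_lt hx2)⟩
    rw [h0] at hmem
    have : ((0, x, ψ x) : ℝ × ℝ × ℝ) ∈ kappa1Wuu a b α ∩ U :=
      ⟨hmem, by simp only; linarith, hxy⟩
    rw [hgraph] at this
    exact this.2.2

/-- The part of the strong unstable manifold in `y₁ ≥ 0`. -/
theorem kappa1Wuu_inter_nonneg (a α : ℝ) (hb : 0 < b) {p : ℝ × ℝ × ℝ} (hp : p ∈ kappa1Wuu a b α)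
    (hy : 0 ≤ p.2.2) (hp0 : p ≠ 0) : ∃ w > 0, p = dawsonCurve b w := by
  obtain ⟨γ, h, rfl, hlim, ν, hν, hO⟩ := hp
  have hρ := rho_eq_zero_of_unstable hb h hlim
  have hxO : (fun t => (γ t).2.1) =O[atBot] fun t => Real.exp (ν * t) := by
    refine IsBigO.trans ?_ hO
    refine IsBigO.of_bound 1 (Eventually.of_forall fun t => ?_)
    rw [one_mul, sub_zero]
    exact (norm_fst_le _).trans (norm_snd_le _)
  -- On y = 0 the rate of x tends to b, so decay faster than e^{bt} leaves only the origin; for y >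
  -- 0 the explicit formula applies.
  rcases hy.eq_or_lt with h0 | h0
  · refine absurd ?_ hp0
    have hy0 : ∀ t ≤ 0, (γ t).2.2 = 0 := by
      intro t ht
      obtain ⟨A, hA⟩ := (h.mono le_rfl fun x (hx : x ∈ Icc t 0) => hx.2).exists_exp_y
      rw [hA 0 ⟨ht, le_rfl⟩ t ⟨le_rfl, ht⟩, ← h0, zero_mul]
    have hx0 : Tendsto (fun t => (γ t).2.1) atBot (𝓝 0) :=
      tendsto_comp_origin hlim (f := fun p => p.2.1) (by fun_prop)
    have hx := eq_zero_of_isBigO_atBot (f := fun t => (γ t).2.1)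
      (c := fun t => b * (1 - (γ t).2.1)) (c₀ := b) (by have := h.continuousOn; fun_prop)
      (fun t ht => (h.planar_x ht (hρ t ht)).congr_deriv (by rw [hy0 t ht]; ring))
      (by simpa using (hx0.const_sub 1).const_mul b) hν hxO
    exact Prod.ext (hρ 0 le_rfl) (Prod.ext (hx 0 le_rfl) (hy0 0 le_rfl))
  · obtain ⟨k, hk, hf⟩ := exists_dawsonTime_of_isBigO hb h hρ h0 hν hxO
    exact ⟨_, dawsonTime_pos hk 0, hf 0 le_rfl⟩

end Origin

/-! ### The connecting orbit on the center manifold -/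

section Matching

variable {a b α : ℝ}

/-- An invariant graph which contains the connecting orbit beyond the parameter `w₁`. -/
structure IsMatchedGraph (a b α w₁ : ℝ) (m : ℝ × ℝ → ℝ) : Prop where
  graph : IsInvariantGraph a b α (b * dawson w₁ ^ 2) m
  pos : 0 < w₁
  eq_slope : ∀ w, w₁ < w → m (0, b * dawson w ^ 2) = dawsonSlope b w

lemma mul_dawson_eq_slope (hb : 0 < b) {w : ℝ} (hw : 0 < w) :
    w * dawson w = 1 + b * dawson w ^ 2 * dawsonSlope b w := by
  have := (dawson_pos hw).ne'
  unfold dawsonSlope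
  generalize dawson w = d at *
  field_simp
  ring

/-- Large w satisfies everything, since b D² → 0 and the slope tends to 1/b. The condition 1 < w D
puts the point past the fold, where y decreases along the curve. -/
lemma exists_matching_parameter (a α : ℝ) (hb : 0 < b) :
    ∃ w > 0, 1 < w * dawson w ∧ (∀ v, w ≤ v → |b * dawsonSlope b v - 1| ≤ 1 / 4) ∧
      IsSmall a b α (b * dawson w ^ 2) := by
  have hy : Tendsto (fun w => b * dawson w ^ 2) atTop (𝓝 0) := by
    simpa using (tendsto_dawson.pow 2).const_mul b
  have h1 : ∀ᶠ w in atTop, 1 < w * dawson w := by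
    filter_upwards [tendsto_dawson_sq.eventually (lt_mem_nhds (zero_lt_one)),
      eventually_gt_atTop 0] with w hw hw0
    have := pos_of_mul_pos_right hw (sq_nonneg w)
    linarith
  have h2 : ∀ᶠ w in atTop, ∀ v, w ≤ v → |b * dawsonSlope b v - 1| < 1 / 4 := by
    refine eventually_forall_ge_atTop.2 ?_
    have h := (((tendsto_dawsonSlope hb).const_mul b).sub_const 1).abs
    rw [mul_inv_cancel₀ hb.ne', sub_self, abs_zero] at h
    exact h.eventually (gt_mem_nhds (by norm_num))
  have h3 : ∀ᶠ w in atTop, 4 * (b * dawson w ^ 2) * |a| < 1 / 2 := by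
    have h := (hy.const_mul 4).mul_const |a|
    rw [mul_zero, zero_mul] at h
    exact h.eventually (gt_mem_nhds (by norm_num))
  have h4 : ∀ᶠ w in atTop, 4 * (b * dawson w ^ 2) * |α| < 1 / 8 := by
    have h := (hy.const_mul 4).mul_const |α|
    rw [mul_zero, zero_mul] at h
    exact h.eventually (gt_mem_nhds (by norm_num))
  have h5 : ∀ᶠ w in atTop, 256 * (b * dawson w ^ 2) < b := by
    have h := hy.const_mul 256
    rw [mul_zero] at h
    exact h.eventually (gt_mem_nhds hb)
  obtain ⟨w, h0, h1, h2, h3, h4, h5⟩ :=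
    ((eventually_gt_atTop 0).and (h1.and (h2.and (h3.and (h4.and h5))))).exists
  exact ⟨w, h0, h1, fun v hv => (h2 v hv).le, hb, mul_pos hb (pow_pos (dawson_pos h0) 2), h3.le, h4.le, h5.le⟩

lemma dawson_sq_lt (hb : 0 < b) {v w : ℝ} (hv : 0 < v) (hvw : v < w) (h1 : 1 < v * dawson v) :
    b * dawson w ^ 2 < b * dawson v ^ 2 :=
  mul_lt_mul_of_pos_left (pow_lt_pow_left₀ (dawson_lt hv.le hvw h1)
    (dawson_pos (hv.trans hvw)).le two_ne_zero) hb

/-- The graph starts on y = b D(w₁)² with the slope of the Dawson curve at w₁. As functions of w,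
the graph and the slope solve the same scalar equation, so their difference solves a linear one with
nonpositive rate. Its modulus does not increase and tends to 0 at w₁. -/
theorem exists_matchedGraph (a α : ℝ) (hb : 0 < b) : ∃ w₁ m, IsMatchedGraph a b α w₁ m := by
  obtain ⟨w₁, h0, h1, h2, hs⟩ := exists_matching_parameter a α hb
  obtain ⟨m, hm, hbox, heq, hlim⟩ := exists_invariant_graph hs (h2 w₁ le_rfl)
  have hG : IsInvariantGraph a b α (b * dawson w₁ ^ 2) m := ⟨hs, hm, hbox, heq⟩
  refine ⟨w₁, m, hG, h0, fun w₂ hw₂ => ?_⟩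
  have hmem : ∀ w, w₁ < w → ((0 : ℝ), b * dawson w ^ 2) ∈
      Ioo (-2 : ℝ) 2 ×ˢ Ioo 0 (b * dawson w₁ ^ 2) := fun w hw =>
    ⟨by simp, mul_pos hb (pow_pos (dawson_pos (h0.trans hw)) 2), dawson_sq_lt hb h0 hw h1⟩
  set μ : ℝ → ℝ := fun w => m (0, b * dawson w ^ 2) with hμ
  set M : ℝ → ℝ := dawsonSlope b with hM
  have hM0 : ∀ w, w₁ < w → 0 < M w := fun w hw => by
    have := one_lt_mul_dawson h0.le hw.le h1
    have := dawson_pos (h0.trans hw)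
    exact div_pos (by linarith) (by positivity)
  set c : ℝ → ℝ := fun w => M w / (b * dawson w) * (-(μ w * M w)⁻¹ + b ^ 2 * dawson w ^ 2) with hc
  have hd : ∀ w, w₁ < w → HasDerivAt (fun w => μ w - M w) (c w * (μ w - M w)) w := by
    intro w hw
    have hw0 := h0.trans hw
    have hD := (dawson_pos hw0).ne'
    have hμ0 : μ w ≠ 0 := (box_bounds hb (hbox _ (hmem w hw))).1.ne'
    have hy : HasDerivAt (fun w => ((0 : ℝ), b * dawson w ^ 2))
        (0, b * (2 * dawson w * (1 - w * dawson w))) w :=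
      (hasDerivAt_const w (0 : ℝ)).prodMk (by
        refine (((hasDerivAt_dawson w).pow 2).const_mul b).congr_deriv ?_
        push_cast; ring)
    have hμd := (hG.hasFDerivAt (hmem w hw)).comp_hasDerivAt w hy
    have hfl := heq _ (hmem w hw)
    have e1 : reducedField a b (0, b * dawson w ^ 2) =
        (dawson w * M w)⁻¹ • ((0 : ℝ), b * (2 * dawson w * (1 - w * dawson w))) := by
      rw [mul_dawson_eq_slope hb hw0]
      have := (hM0 w hw).ne'
      simp only [reducedField, bracket, Prod.smul_mk, smul_eq_mul, mul_zero, Prod.mk.injEq]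
      change dawsonSlope b w ≠ 0 at this
      simp only [hM]
      generalize dawsonSlope b w = n at *
      generalize dawson w = d at *
      constructor
      · simp
      · field_simp
        ring
    rw [e1, map_smul, smul_eq_mul] at hfl
    refine (hμd.sub (hasDerivAt_dawsonSlope hb hw0)).congr_deriv ?_
    generalize fderiv ℝ m (0, b * dawson w ^ 2) (0, b * (2 * dawson w * (1 - w * dawson w))) = z at *
    have hMw := (hM0 w hw).ne'
    have e2 : z = M w / (b * dawson w) * flowRate a b α ((0:ℝ) ^ 2 * (b * dawson w ^ 2))
        (b * dawson w ^ 2) (μ w) := by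
      rw [← hfl]
      generalize M w = n at *
      generalize dawson w = d at *
      field_simp
    rw [e2]
    simp only [hc, flowRate, bracket]
    change _ - (1 - b * M w + b ^ 2 * dawson w ^ 2 * M w ^ 2) / (b * dawson w) = _
    generalize M w = n at *
    generalize μ w = l at *
    generalize dawson w = d at *
    simp only [ne_eq, OfNat.ofNat_ne_zero, not_false_eq_true, zero_pow, zero_mul, mul_zero,
      zero_div, add_zero, sub_zero]
    field_simp
    ring
  -- Both factors of 1/(μM) are at least 4b/5, whereas b² D² = b y is below b²/256.
  have hcneg : ∀ w, w₁ < w → c w ≤ 0 := by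
    intro w hw
    obtain ⟨h3, -, h4, -⟩ := box_bounds hb (h2 w hw.le)
    obtain ⟨h5, -, h6, -⟩ := box_bounds hb (hbox _ (hmem w hw))
    have h7 : (4 * b / 5) * (4 * b / 5) ≤ (μ w)⁻¹ * (M w)⁻¹ :=
      mul_le_mul h6 h4 (by positivity) (inv_pos.2 h5).le
    have h8 := (hmem w hw).2.2
    have h9 := hs.le_b
    have h10 : b * (b * dawson w ^ 2) ≤ b * (b / 256) := by
      refine mul_le_mul_of_nonneg_left ?_ hb.le
      simp only at h8
      linarith
    refine mul_nonpos_of_nonneg_of_nonpos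
      (div_nonneg (hM0 w hw).le (mul_pos hb (dawson_pos (h0.trans hw))).le) ?_
    rw [mul_inv]
    nlinarith
  have hanti : ∀ w ∈ Ioc w₁ w₂, |μ w₂ - M w₂| ≤ |μ w - M w| := by
    intro w hw
    have h := le_of_hasDerivWithinAt_nonneg (f := fun w => -(μ w - M w) ^ 2)
      (f' := fun w => -(2 * c w * (μ w - M w) ^ 2)) hw.2
      (fun x hx => ((((hd x (hw.1.trans_le hx.1)).pow 2).neg).congr_deriv
        (by push_cast; ring)).hasDerivWithinAt)
      fun x hx => by nlinarith [hcneg x (hw.1.trans_le hx.1), sq_nonneg (μ x - M x)]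
    exact sq_le_sq.1 (neg_le_neg_iff.1 h)
  have hMc : ContinuousAt M w₁ := (hasDerivAt_dawsonSlope hb h0).continuousAt
  have hlimμ : Tendsto μ (𝓝[>] w₁) (𝓝 (M w₁)) := by
    refine hlim.comp (tendsto_nhdsWithin_iff.2 ⟨?_, ?_⟩)
    · have : ContinuousAt (fun w => b * dawson w ^ 2) w₁ :=
        ((hasDerivAt_dawson w₁).continuousAt.pow 2).const_mul b
      exact this.tendsto.mono_left nhdsWithin_le_nhds
    · filter_upwards [self_mem_nhdsWithin] with w hw using (hmem w hw).2.2
  have hlim0 := (hlimμ.sub (hMc.tendsto.mono_left nhdsWithin_le_nhds)).abs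
  rw [sub_self, abs_zero] at hlim0
  have hle : |μ w₂ - M w₂| ≤ 0 := by
    refine ge_of_tendsto hlim0 ?_
    filter_upwards [Ioc_mem_nhdsGT hw₂] with w hw using hanti w hw
  exact sub_eq_zero.1 (abs_nonpos_iff.1 hle)

lemma exists_dawson_sq_eq {v y : ℝ} (hy : 0 < y) (hyv : y < b * dawson v ^ 2) :
    ∃ w > v, b * dawson w ^ 2 = y := by
  have hlim : Tendsto (fun w => b * dawson w ^ 2) atTop (𝓝 0) := by
    simpa using (tendsto_dawson.pow 2).const_mul b
  obtain ⟨w, hwy, hvw⟩ := ((hlim.eventually (gt_mem_nhds hy)).and (eventually_ge_atTop v)).exists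
  have hcont : Continuous fun w => b * dawson w ^ 2 :=
    continuous_iff_continuousAt.2 fun w =>
      ((hasDerivAt_dawson w).continuousAt.pow 2).const_mul b
  obtain ⟨w', hw', h⟩ := intermediate_value_Icc' hvw hcont.continuousOn ⟨hwy.le, hyv.le⟩
  refine ⟨w', lt_of_le_of_ne hw'.1 ?_, h⟩
  rintro rfl
  exact absurd h hyv.ne'

/-- In the half plane `y₁ ≤ 0` the strong unstable manifold satisfies `x₁ ≤ 0`. -/
lemma x_nonpos_of_y_nonpos (hb : 0 < b) {p : ℝ × ℝ × ℝ} (hp : p ∈ kappa1Wuu a b α)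
    (hy : p.2.2 ≤ 0) : p.2.1 ≤ 0 := by
  obtain ⟨γ, h, rfl, hlim, ν, hν, hO⟩ := hp
  have hρ := rho_eq_zero_of_unstable hb h hlim
  have hyt : ∀ t ≤ 0, (γ t).2.2 ≤ 0 := by
    intro t ht
    obtain ⟨A, hA⟩ := (h.mono le_rfl fun x (hx : x ∈ Icc t 0) => hx.2).exists_exp_y
    rw [hA 0 ⟨ht, le_rfl⟩ t ⟨le_rfl, ht⟩]
    exact mul_nonpos_of_nonpos_of_nonneg hy (Real.exp_pos _).le
  -- For y ≤ 0 the derivative (y - b x²) e^{-bt} of x e^{-bt} is nonpositive, and decay faster than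
  -- e^{bt} makes this function vanish at -∞.
  have hmono : ∀ t ≤ 0, (γ 0).2.1 ≤ (γ t).2.1 * Real.exp (-b * t) := by
    intro t ht
    have hsub : Icc t 0 ⊆ Iic 0 := fun x hx => hx.2
    have hE : ∀ s, HasDerivAt (fun t => Real.exp (-b * t)) (-b * Real.exp (-b * s)) s := fun s => by
      simpa using hasDerivAt_mul_exp (-b) 1 s
    have h1 := le_of_hasDerivWithinAt_nonneg (f := fun t => -((γ t).2.1 * Real.exp (-b * t)))
      (f' := fun t => -((γ t).2.2 - b * (γ t).2.1 ^ 2) * Real.exp (-b * t)) ht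
      (fun s hs => (((h.planar_x hs.2 (hρ s hs.2)).mono hsub).mul
        (hE s).hasDerivWithinAt).neg.congr_deriv (by ring))
      fun s hs => by
        have := hyt s hs.2
        refine mul_nonneg ?_ (Real.exp_pos _).le
        nlinarith [sq_nonneg (γ s).2.1]
    simpa using h1
  have hlim0 : Tendsto (fun t => (γ t).2.1 * Real.exp (-b * t)) atBot (𝓝 0) := by
    have hxO : (fun t => (γ t).2.1) =O[atBot] fun t => Real.exp (ν * t) := by
      refine IsBigO.trans ?_ hO
      refine IsBigO.of_bound 1 (Eventually.of_forall fun t => ?_)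
      rw [one_mul, sub_zero]
      exact (norm_fst_le _).trans (norm_snd_le _)
    refine (hxO.mul (isBigO_refl (fun t => Real.exp (-b * t)) atBot)).trans_tendsto ?_
    have h4 : Tendsto (fun t => Real.exp ((ν - b) * t)) atBot (𝓝 0) :=
      Real.tendsto_exp_atBot.comp (tendsto_id.const_mul_atBot (by linarith))
    refine h4.congr fun t => ?_
    rw [← Real.exp_add]
    ring_nf
  refine ge_of_tendsto hlim0 ?_
  filter_upwards [eventually_le_atBot 0] with t ht using hmono t ht

/-- Near `L₁` the strong unstable manifold of the origin is the planar part of the graph. -/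
theorem IsMatchedGraph.kappa1Wuu_inter {w₁ χ : ℝ} {m : ℝ × ℝ → ℝ} (h : IsMatchedGraph a b α w₁ m)
    (hχ : χ ≤ b * dawson w₁ ^ 2) (hχ' : χ ≤ 4 / 5 * (b / w₁ ^ 2)) :
    kappa1Wuu a b α ∩ boxL1 1 (1 / 10) χ =
      {p | p ∈ graphSurface (extendGraph b m) (boxL1 1 (1 / 10) χ) ∧ p.1 = 0 ∧ 0 < p.2.2} := by
  have hb := h.graph.small.b_pos
  have key : ∀ w, w₁ < w → w * dawson w = 1 + b * dawson w ^ 2 *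
      extendGraph b m (0, b * dawson w ^ 2) := fun w hw => by
    have hw0 := h.pos.trans hw
    rw [extendGraph_of_pos (mul_pos hb (pow_pos (dawson_pos hw0) 2)), h.eq_slope w hw,
      ← mul_dawson_eq_slope hb hw0]
  ext p
  constructor
  · rintro ⟨hp, hbox⟩
    have hx := abs_lt.1 hbox.2.1
    have hy : 0 < p.2.2 := by
      by_contra hy
      have := x_nonpos_of_y_nonpos hb hp (not_lt.1 hy)
      linarith
    obtain ⟨w, hw, rfl⟩ := kappa1Wuu_inter_nonneg a α hb hp hy.le (by
      rintro rfl
      exact lt_irrefl _ hy)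
    -- For w ≤ w₁ the bound w D ≥ 9/10 would give y = b D² ≥ (81/100) b/w₁², above the height
    -- 4b/(5w₁²) of the box.
    have hw₁ : w₁ < w := by
      by_contra hcon
      rw [not_lt] at hcon
      have h1 : 9 / 10 ≤ w * dawson w := by
        have := hx.1
        simp only [dawsonCurve] at this
        linarith
      have h2 : b * dawson w ^ 2 < 4 / 5 * (b / w₁ ^ 2) :=
        ((le_abs_self _).trans_lt hbox.2.2).trans_le hχ'
      have h3 : 9 / 10 ≤ w₁ * dawson w :=
        h1.trans (mul_le_mul_of_nonneg_right hcon (dawson_pos hw).le)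
      have h4 : (9 / 10) ^ 2 ≤ (w₁ * dawson w) ^ 2 := pow_le_pow_left₀ (by norm_num) h3 2
      rw [← mul_div_assoc, lt_div_iff₀ (pow_pos h.pos 2)] at h2
      nlinarith
    exact ⟨⟨hbox, le_rfl, hy.le, key w hw₁⟩, rfl, hy⟩
  · rintro ⟨⟨hbox, -, -, hx⟩, hρ, hy⟩
    refine ⟨?_, hbox⟩
    obtain ⟨w, hw, hwy⟩ := exists_dawson_sq_eq hy
      (((le_abs_self _).trans_lt hbox.2.2).trans_le hχ)
    have : p = dawsonCurve b w := by
      refine Prod.ext hρ (Prod.ext ?_ hwy.symm)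
      rw [hx, hρ, ← hwy]
      exact (key w hw).symm
    rw [this]
    exact dawsonCurve_mem_kappa1Wuu a α hb (h.pos.trans hw)

end Matching

/-! ### The center manifold of `L₁` -/

section CenterManifold

variable {a b α χ χ₀ : ℝ} {m : ℝ × ℝ → ℝ} {γ : ℝ → ℝ × ℝ × ℝ} {s t : ℝ}

lemma abs_le_mul_exp_of_linear {f c : ℝ → ℝ} {k : ℝ} (hst : s ≤ t)
    (hf : ∀ x ∈ Icc s t, HasDerivWithinAt f (c x * f x) (Icc s t) x)
    (hk : ∀ x ∈ Icc s t, c x ≤ -k) : |f t| ≤ Real.exp (-k * (t - s)) * |f s| := by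
  have hmaps : MapsTo (fun x : ℝ => -x) (Icc (-t) (-s)) (Icc s t) := fun x hx =>
    ⟨le_neg.1 hx.2, neg_le.1 hx.1⟩
  have h := abs_mul_exp_le_of_linear (f := fun x => f (-x)) (c := fun x => -c (-x)) (k := k)
    (neg_le_neg hst) (fun x hx => ((hf (-x) (hmaps hx)).comp x (hasDerivAt_neg x).hasDerivWithinAt
      hmaps).congr_deriv (by ring)) fun x hx => by linarith [hk (-x) (hmaps hx)]
  simp only [neg_neg] at h
  calc |f t| = Real.exp (-k * (t - s)) * (|f t| * Real.exp (k * (-s - -t))) := by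
        rw [mul_left_comm, ← Real.exp_add]; ring_nf; simp
    _ ≤ _ := mul_le_mul_of_nonneg_left h (Real.exp_pos _).le

/-- The vertical distance to the graph. -/
noncomputable def graphDefect (b : ℝ) (m : ℝ × ℝ → ℝ) (p : ℝ × ℝ × ℝ) : ℝ :=
  p.2.1 - (1 + p.2.2 * extendGraph b m (p.1, p.2.2))

/-- The rate of change of `graphDefect` along orbits. -/
noncomputable def defectRate (a b α : ℝ) (m : ℝ × ℝ → ℝ) (p : ℝ × ℝ × ℝ) : ℝ :=
  -((1 + α * (p.1 ^ 2 * p.2.2)) / extendGraph b m (p.1, p.2.2) +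
    (p.2.1 - 1) * (bracket a b (p.1 ^ 2 * p.2.2) - p.1 ^ 2 * p.2.2))

lemma IsInvariantGraph.one_add_pos (h : IsInvariantGraph a b α χ₀ m) (hχ : χ ≤ χ₀)
    {p : ℝ × ℝ × ℝ} (hp : p ∈ boxL1 1 (1 / 10) χ) : 0 < 1 + a * p.1 ^ 2 * p.2.2 := by
  have h1 : p.1 ^ 2 ≤ 1 := by
    rw [← sq_abs]; exact pow_le_one₀ (abs_nonneg _) hp.1.le
  have h2 : |a * p.1 ^ 2 * p.2.2| ≤ |a| * 1 * χ₀ := by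
    rw [abs_mul, abs_mul, abs_of_nonneg (sq_nonneg p.1)]
    gcongr
    exact hp.2.2.le.trans hχ
  have h3 := h.small.a_le
  have h4 := (abs_le.1 h2).1
  linarith

lemma sq_mul_mem (hχ : χ ≤ χ₀) {p : ℝ × ℝ × ℝ} (hp : p ∈ boxL1 1 (1 / 10) χ) (hy : 0 ≤ p.2.2) :
    0 ≤ p.1 ^ 2 * p.2.2 ∧ p.1 ^ 2 * p.2.2 ≤ 4 * χ₀ := by
  have h1 : p.1 ^ 2 ≤ 1 := by
    rw [← sq_abs]; exact pow_le_one₀ (abs_nonneg _) hp.1.le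
  have h2 : p.2.2 ≤ χ₀ := ((le_abs_self _).trans hp.2.2.le).trans hχ
  exact ⟨mul_nonneg (sq_nonneg _) hy, by nlinarith⟩

lemma box_mem (hχ : χ ≤ χ₀) {p : ℝ × ℝ × ℝ} (hp : p ∈ boxL1 1 (1 / 10) χ) (hy : 0 ≤ p.2.2) :
    (p.1, p.2.2) ∈ Ioo (-2 : ℝ) 2 ×ˢ Ico 0 χ₀ := by
  have h1 := abs_lt.1 hp.1
  refine ⟨⟨?_, ?_⟩, hy, ((le_abs_self _).trans_lt hp.2.2).trans_le hχ⟩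
  · simp only; linarith
  · simp only; linarith

lemma IsInvariantGraph.defectRate_mem (h : IsInvariantGraph a b α χ₀ m) (hχ : χ ≤ χ₀)
    {p : ℝ × ℝ × ℝ} (hp : p ∈ boxL1 1 (1 / 10) χ) (hy : 0 ≤ p.2.2) :
    -(2 * b) ≤ defectRate a b α m p ∧ defectRate a b α m p ≤ -(b / 2) := by
  have hb := h.small.b_pos
  obtain ⟨e1, e2⟩ := sq_mul_mem hχ hp hy
  obtain ⟨h1, h2, h3⟩ := h.small.bracket_mem e1 e2
  obtain ⟨h4, h5⟩ := h.small.α_mem e1 e2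
  obtain ⟨h6, -, h7, h8⟩ := box_bounds hb (h.extendGraph_box (box_mem hχ hp hy))
  unfold defectRate
  rw [div_eq_mul_inv]
  generalize (extendGraph b m (p.1, p.2.2))⁻¹ = n at *
  generalize p.1 ^ 2 * p.2.2 = ε at *
  generalize bracket a b ε = B at *
  have h9 : |(p.2.1 - 1) * (B - ε)| ≤ 1 / 10 * (65 / 64 * b) := by
    rw [abs_mul]
    exact mul_le_mul hp.2.1.le (abs_le.2 ⟨by linarith, by linarith⟩) (abs_nonneg _) (by norm_num)
  obtain ⟨h10, h11⟩ := abs_le.1 h9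
  have h12 : 7 / 8 * (4 * b / 5) ≤ (1 + α * ε) * n := mul_le_mul h4 h7 (by positivity) (by linarith)
  have h13 : (1 + α * ε) * n ≤ 9 / 8 * (4 * b / 3) := mul_le_mul h5 h8 (by linarith) (by norm_num)
  constructor <;> linarith

/-- The invariance equation makes the defect a factor of its own derivative. The upper bound of the
rate gives attraction and forward invariance, the lower bound gives backward invariance. -/
lemma IsInvariantGraph.graphDefect_deriv (h : IsInvariantGraph a b α χ₀ m) (hχ : χ ≤ χ₀)
    (hγ : IsSolutionOn (kappa1Field a b α) (kappa1SpacePos a ∩ boxL1 1 (1 / 10) χ) γ (Icc s t)) :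
    ∃ c : ℝ → ℝ, ∀ x ∈ Icc s t,
      HasDerivWithinAt (fun t => graphDefect b m (γ t)) (c x * graphDefect b m (γ x)) (Icc s t) x ∧
      -(2 * b) ≤ c x ∧ c x ≤ -(b / 2) := by
  have hb := h.small.b_pos
  rcases le_or_gt s t with hst | hst
  swap
  · exact ⟨0, fun x hx => absurd (hx.1.trans hx.2) (not_le.2 hst)⟩
  have hγ' : IsSolutionOn (kappa1Field a b α) (kappa1Space a) γ (Icc s t) :=
    hγ.mono (fun p hp => hp.1.1) subset_rfl
  have hmem := fun x hx => (hγ x hx).1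
  rcases (show 0 ≤ (γ s).2.2 from (hmem s ⟨le_rfl, hst⟩).1.2).eq_or_lt with h0 | h0
  -- The equation of m is available only for y > 0. On the invariant set y = 0 the defect is x - 1,
  -- with rate -b x.
  · have hy : ∀ x ∈ Icc s t, (γ x).2.2 = 0 := by
      intro x hx
      obtain ⟨A, hA⟩ := hγ'.exists_exp_y
      rw [hA s ⟨le_rfl, hst⟩ x hx, ← h0, zero_mul]
    refine ⟨fun x => -(b * (γ x).2.1), fun x hx => ⟨?_, ?_⟩⟩
    · have hd := ((hγ.deriv_x hx).sub_const 1).congr (f₁ := fun t => graphDefect b m (γ t))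
        (fun u hu => by simp [graphDefect, hy u hu]) (by simp [graphDefect, hy x hx])
      refine hd.congr_deriv ?_
      simp only [graphDefect, hy x hx, kappa1Bracket_of_y]
      ring
    · have h1 := abs_lt.1 (hmem x hx).2.2.1
      constructor <;> nlinarith
  · have hy := y_pos_of_pos ordConnected_Icc hγ' ⟨le_rfl, hst⟩ h0
    refine ⟨fun x => defectRate a b α m (γ x), fun x hx => ⟨?_,
      h.defectRate_mem hχ (hmem x hx).2 (hy x hx).le⟩⟩
    have hu := box_mem hχ (hmem x hx).2 (hy x hx).le
    have hu' : ((γ x).1, (γ x).2.2) ∈ Ioo (-2 : ℝ) 2 ×ˢ Ioo 0 χ₀ := ⟨hu.1, hy x hx, hu.2.2⟩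
    have hn0 := (box_bounds hb (h.box _ hu')).1.ne'
    have hfl := h.eq _ hu'
    have hmd := (h.hasFDerivAt hu').comp_hasDerivWithinAt x
      ((hγ.deriv_rho hx).prodMk (hγ.deriv_y hx))
    have hd := ((hγ.deriv_x hx).sub (((hγ.deriv_y hx).mul hmd).const_add 1)).congr
      (f₁ := fun t => graphDefect b m (γ t))
      (fun u hu => by
        simp [graphDefect, extendGraph_of_pos (u := ((γ u).1, (γ u).2.2)) (hy u hu)])
      (by simp [graphDefect, extendGraph_of_pos (u := ((γ x).1, (γ x).2.2)) (hy x hx)])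
    refine hd.congr_deriv ?_
    have e1 : (((γ x).2.1 - 1) * kappa1Bracket a b (γ x).1 (γ x).2.2 * (γ x).1,
        -(((γ x).2.1 - 1) * (2 * kappa1Bracket a b (γ x).1 (γ x).2.2 - (γ x).2.2 * (γ x).1 ^ 2)) *
          (γ x).2.2) = ((γ x).2.1 - 1) • reducedField a b ((γ x).1, (γ x).2.2) := by
      simp only [reducedField, kappa1Bracket_eq, Prod.smul_mk, smul_eq_mul, Prod.mk.injEq]
      constructor <;> ring
    rw [e1, map_smul, smul_eq_mul]
    simp only [graphDefect, defectRate, extendGraph_of_pos (b := b) (m := m)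
      (u := ((γ x).1, (γ x).2.2)) (hy x hx), kappa1Bracket_eq, Function.comp_apply]
    simp only [flowRate] at hfl
    generalize fderiv ℝ m ((γ x).1, (γ x).2.2) (reducedField a b ((γ x).1, (γ x).2.2)) = z at *
    generalize m ((γ x).1, (γ x).2.2) = n at *
    generalize bracket a b ((γ x).1 ^ 2 * (γ x).2.2) = B at *
    generalize (γ x).2.1 = X at *
    generalize (γ x).2.2 = Y at *
    generalize (γ x).1 = r at *
    have hfl' : Y * z * n = (1 + α * (r ^ 2 * Y)) - (B - r ^ 2 * Y) * n + B * Y * n * n := by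
      rw [hfl]; field_simp
    field_simp
    linear_combination (-(X - 1)) * hfl'

lemma mem_graphSurface_iff {V : Set (ℝ × ℝ × ℝ)} {p : ℝ × ℝ × ℝ} (hp : p ∈ kappa1SpacePos a ∩ V) :
    p ∈ graphSurface (extendGraph b m) V ↔ graphDefect b m p = 0 := by
  constructor
  · rintro ⟨-, -, -, h⟩
    exact sub_eq_zero.2 h
  · intro h
    exact ⟨hp.2, hp.1.1.1, hp.1.2, sub_eq_zero.1 h⟩

theorem IsInvariantGraph.isLocallyInvariant (h : IsInvariantGraph a b α χ₀ m) (hχ : χ ≤ χ₀) :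
    IsLocallyInvariant (kappa1Field a b α) (kappa1SpacePos a) (boxL1 1 (1 / 10) χ)
      (graphSurface (extendGraph b m) (boxL1 1 (1 / 10) χ)) := by
  intro γ t₀ t₁ hγ s hs hsM t ht
  rw [mem_graphSurface_iff (hγ s hs).1] at hsM
  rw [mem_graphSurface_iff (hγ t ht).1]
  rcases le_total s t with hst | hst
  · obtain ⟨c, hc⟩ := h.graphDefect_deriv hχ (hγ.mono subset_rfl (Icc_subset_Icc hs.1 ht.2))
    have h1 := abs_le_mul_exp_of_linear hst (fun x hx => (hc x hx).1) (fun x hx => (hc x hx).2.2)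
    rw [hsM, abs_zero, mul_zero] at h1
    exact abs_nonpos_iff.1 h1
  · obtain ⟨c, hc⟩ := h.graphDefect_deriv hχ (hγ.mono subset_rfl (Icc_subset_Icc ht.1 hs.2))
    have h1 := abs_mul_exp_le_of_linear hst (fun x hx => (hc x hx).1) (fun x hx => (hc x hx).2.1)
    rw [hsM, abs_zero] at h1
    exact abs_nonpos_iff.1 (nonpos_of_mul_nonpos_left h1 (Real.exp_pos _))

theorem IsInvariantGraph.attraction (h : IsInvariantGraph a b α χ₀ m) (hχ : χ ≤ χ₀) {τ : ℝ}
    (hτ : 0 ≤ τ)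
    (hγ : IsSolutionOn (kappa1Field a b α) (kappa1SpacePos a ∩ boxL1 1 (1 / 10) χ) γ (Icc 0 τ)) :
    |graphDefect b m (γ τ)| ≤ 1 * Real.exp (-(b / 2) * τ) * |graphDefect b m (γ 0)| := by
  obtain ⟨c, hc⟩ := h.graphDefect_deriv hχ hγ
  have h1 := abs_le_mul_exp_of_linear hτ (fun x hx => (hc x hx).1) (fun x hx => (hc x hx).2.2)
  rwa [sub_zero, ← one_mul (Real.exp _)] at h1

/-- The derivative of the parametrization of the center manifold at `L₁`. -/
noncomputable def graphTangent (b : ℝ) : ℝ × ℝ →L[ℝ] ℝ × ℝ × ℝ :=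
  (ContinuousLinearMap.fst ℝ ℝ ℝ).prod
    ((b⁻¹ • ContinuousLinearMap.snd ℝ ℝ ℝ).prod (ContinuousLinearMap.snd ℝ ℝ ℝ))

theorem IsInvariantGraph.hasFDerivWithinAt_graphMap (h : IsInvariantGraph a b α χ₀ m) :
    HasFDerivWithinAt (graphMap (extendGraph b m)) (graphTangent b) (Ici 0 ×ˢ Ici 0) 0 := by
  have hmem : (0 : ℝ × ℝ) ∈ Ico (0 : ℝ) 1 ×ˢ Ico 0 χ₀ := by simp [h.small.pos]
  have hd := (h.contDiffOn_extendGraph.differentiableOn (by simp) 0 hmem).mono_of_mem_nhdsWithin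
    (t := Ici 0 ×ˢ Ici 0) (by
      have : Iio (1 : ℝ) ×ˢ Iio χ₀ ∈ 𝓝 (0 : ℝ × ℝ) :=
        (isOpen_Iio.prod isOpen_Iio).mem_nhds (by simp [h.small.pos])
      filter_upwards [self_mem_nhdsWithin, mem_nhdsWithin_of_mem_nhds this] with u hu hu'
        using ⟨⟨hu.1, hu'.1⟩, hu.2, hu'.2⟩)
  have h1 := ((hasFDerivAt_snd (𝕜 := ℝ) (p := (0 : ℝ × ℝ))).hasFDerivWithinAt.mul
    hd.hasFDerivWithinAt).const_add 1
  have h2 := (hasFDerivAt_fst (𝕜 := ℝ) (p := (0 : ℝ × ℝ))).hasFDerivWithinAt (s := Ici 0 ×ˢ Ici 0)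
    |>.prodMk (h1.prodMk (hasFDerivAt_snd (𝕜 := ℝ) (p := (0 : ℝ × ℝ))).hasFDerivWithinAt)
  refine h2.congr_fderiv ?_
  rw [graphTangent, extendGraph_of_eq_zero (by rfl)]
  simp

lemma lineC1_inter_subset (b : ℝ) (m : ℝ × ℝ → ℝ) (V : Set (ℝ × ℝ × ℝ)) :
    lineC1 ∩ V ⊆ graphSurface (extendGraph b m) V := by
  rintro p ⟨⟨h1, h2, h3⟩, hV⟩
  exact ⟨hV, h1.le, h3.ge, by rw [h2, h3]; simp⟩

lemma kappa1Field_of_mem_lineC1 {p : ℝ × ℝ × ℝ} (hp : p ∈ lineC1) : kappa1Field a b α p = 0 := by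
  obtain ⟨-, h2, h3⟩ := hp
  simp [kappa1Field, h2, h3]

/-- The connecting orbit lies on every center manifold in the plane which it meets. -/
theorem IsMatchedGraph.eventually_eq {w₁ : ℝ} (h : IsMatchedGraph a b α w₁ m) {η : ℝ} {g : ℝ → ℝ}
    (hg : ContinuousOn g (Ico 0 η)) (hg0 : g 0 = 1)
    (hinv : IsLocallyInvariant (kappa1Field a b α) (kappa1SpacePos a) {p | p.2.2 < η}
      (planarCurve g η))
    (hex : ∃ y ∈ Ioo 0 η, ∃ γ : ℝ → ℝ × ℝ × ℝ,
      IsSolutionOn (kappa1Field a b α) (kappa1SpacePos a) γ (Iic 0) ∧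
      γ 0 = (0, g y, y) ∧ ApproachesAlong γ atBot 0 (0, 1, b)) :
    ∀ᶠ y in 𝓝[>] 0, g y = 1 + y * extendGraph b m (0, y) := by
  have hb := h.graph.small.b_pos
  obtain ⟨y₀, hy₀, γ, hγ, hγ0, hdir⟩ := hex
  obtain ⟨k, hk, hγk⟩ := exists_dawsonTime_of_approachesAlong hb
    (hγ.mono (fun p hp => hp.1) subset_rfl) (by rw [hγ0]; exact hy₀.1) hdir
  set W := dawsonTime b k with hW
  have hWpos : ∀ t, 0 < W t := dawsonTime_pos hk
  have hWmono : StrictMono W := invExpInt.strictMono.comp fun s t hst => by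
    have := Real.exp_lt_exp.2 (mul_lt_mul_of_pos_left hst hb)
    exact mul_lt_mul_of_pos_left this hk
  have h0 : dawsonCurve b (W 0) = (0, g y₀, y₀) := by rw [← hγk 0 le_rfl, hγ0]
  simp only [dawsonCurve, Prod.mk.injEq, true_and] at h0
  have hpos : ∀ w, 0 < w → 0 < b * dawson w ^ 2 := fun w hw =>
    mul_pos hb (pow_pos (dawson_pos hw) 2)
  have hsol : ∀ s t : ℝ, (∀ x ∈ Icc s t, b * dawson (W x) ^ 2 < η) →
      IsSolutionOn (kappa1Field a b α) (kappa1SpacePos a ∩ {p | p.2.2 < η})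
        (fun t => dawsonCurve b (W t)) (Icc s t) := fun s t hlt x hx =>
    ⟨⟨⟨planar_mem _ _, (hpos _ (hWpos x)).le⟩, hlt x hx⟩,
      (isSolutionOn_dawsonCurve a b α k (Icc s t) x hx).2⟩
  have h0mem : dawsonCurve b (W 0) ∈ planarCurve g η :=
    ⟨rfl, (hpos _ (hWpos 0)).le, by simp only [dawsonCurve]; rw [h0.2]; exact hy₀.2,
      by simp only [dawsonCurve]; rw [h0.1, h0.2]⟩
  rcases le_or_gt (W 0 * dawson (W 0)) 1 with hle | hgt
  -- Before the fold y decreases backwards in time, so the backward orbit stays below η and on the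
  -- curve. Then x → 0 and y → 0 contradict g(0) = 1.
  · exfalso
    have hmono : MonotoneOn dawson (Icc 0 (W 0)) := by
      refine monotoneOn_of_deriv_nonneg (convex_Icc _ _)
        (fun x _ => (hasDerivAt_dawson x).continuousAt.continuousWithinAt)
        (fun x _ => (hasDerivAt_dawson x).differentiableAt.differentiableWithinAt) fun x hx => ?_
      rw [(hasDerivAt_dawson x).deriv]
      have hx' := interior_subset hx
      linarith [mul_dawson_le_one hx'.1 hx'.2 hle]
    have hlt : ∀ t ≤ 0, b * dawson (W t) ^ 2 < η := by
      intro t ht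
      refine lt_of_le_of_lt ?_ (h0.2.trans_lt hy₀.2)
      have hWt := hWmono.monotone ht
      have := hmono ⟨(hWpos t).le, hWt⟩ ⟨(hWpos 0).le, le_rfl⟩ hWt
      have h1 := dawson_pos (hWpos t)
      gcongr
    have hcurve : ∀ t ≤ 0, W t * dawson (W t) = g (b * dawson (W t) ^ 2) := fun t ht =>
      (hinv _ t 0 (hsol t 0 fun x hx => hlt x hx.2) 0 ⟨ht, le_rfl⟩ h0mem t ⟨le_rfl, ht⟩).2.2.2
    have hW0 := tendsto_dawsonTime_atBot hb k
    have hlim := (tendsto_dawsonCurve_zero b).comp hW0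
    have hx : Tendsto (fun t => W t * dawson (W t)) atBot (𝓝 0) :=
      tendsto_comp_origin hlim (f := fun p => p.2.1) (by fun_prop)
    have hy : Tendsto (fun t => b * dawson (W t) ^ 2) atBot (𝓝 0) :=
      tendsto_comp_origin hlim (f := fun p => p.2.2) (by fun_prop)
    have hgy : Tendsto (fun t => g (b * dawson (W t) ^ 2)) atBot (𝓝 (g 0)) := by
      refine (hg 0 ⟨le_rfl, hy₀.1.trans hy₀.2⟩).tendsto.comp (tendsto_nhdsWithin_iff.2 ⟨hy, ?_⟩)
      filter_upwards [eventually_le_atBot 0] with t ht using ⟨(hpos _ (hWpos t)).le, hlt t ht⟩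
    have := tendsto_nhds_unique (hx.congr' (by
      filter_upwards [eventually_le_atBot 0] with t ht using hcurve t ht)) hgy
    rw [hg0] at this
    exact zero_ne_one this
  -- Past the fold y decreases forwards in time, so the forward orbit stays on the curve and covers
  -- all smaller y.
  · have hcurve : ∀ w, W 0 < w → w * dawson w = g (b * dawson w ^ 2) := by
      intro w hw
      obtain ⟨t, rfl⟩ := exists_dawsonTime_eq hb hk ((hWpos 0).trans hw)
      have ht : 0 ≤ t := (hWmono.lt_iff_lt.1 hw).le
      refine (hinv _ 0 t (hsol 0 t fun x hx => ?_) 0 ⟨le_rfl, ht⟩ h0mem t ⟨ht, le_rfl⟩).2.2.2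
      rcases hx.1.eq_or_lt with rfl | hx0
      · exact h0.2.trans_lt hy₀.2
      · exact (dawson_sq_lt hb (hWpos 0) (hWmono hx0) hgt).trans (h0.2.trans_lt hy₀.2)
    have hv : 0 < max (W 0) w₁ := lt_max_of_lt_left (hWpos 0)
    filter_upwards [Ioo_mem_nhdsGT (hpos _ hv)] with y hy
    obtain ⟨w, hw, rfl⟩ := exists_dawson_sq_eq hy.1 hy.2
    rw [← hcurve w ((le_max_left _ _).trans_lt hw), extendGraph_of_pos hy.1,
      h.eq_slope w ((le_max_right _ _).trans_lt hw), ← mul_dawson_eq_slope hb (hv.trans hw)]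

end CenterManifold

/-! ### The linearizations -/

section Linearization

variable {a b α : ℝ}

/-- The linear map with the rows `(c, 0, 0)`, `(0, β, 1)`, `(0, 0, κ)`. -/
noncomputable def triangularMap (c β κ : ℝ) : ℝ × ℝ × ℝ →L[ℝ] ℝ × ℝ × ℝ :=
  (c • ContinuousLinearMap.fst ℝ ℝ (ℝ × ℝ)).prod
    ((β • (ContinuousLinearMap.fst ℝ ℝ ℝ).comp (ContinuousLinearMap.snd ℝ ℝ (ℝ × ℝ)) +
      (ContinuousLinearMap.snd ℝ ℝ ℝ).comp (ContinuousLinearMap.snd ℝ ℝ (ℝ × ℝ))).prod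
    (κ • (ContinuousLinearMap.snd ℝ ℝ ℝ).comp (ContinuousLinearMap.snd ℝ ℝ (ℝ × ℝ))))

lemma triangularMap_apply (c β κ : ℝ) (p : ℝ × ℝ × ℝ) :
    triangularMap c β κ p = (c * p.1, β * p.2.1 + p.2.2, κ * p.2.2) := by
  simp [triangularMap]

/-- The condition on x covers the origin and L₁ together. The derivative of the bracket stays
abstract, because its factors ρ(x - 1), x(x - 1) and y(x - 1) vanish there. -/
lemma hasFDerivAt_kappa1Field {x : ℝ} (hx : x * (x - 1) = 0) :
    HasFDerivAt (kappa1Field a b α)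
      (triangularMap ((x - 1) * b) (-((2 * x - 1) * b)) (-(2 * b * (x - 1)))) (0, x, 0) := by
  have hB := DifferentiableAt.hasFDerivAt (𝕜 := ℝ)
    (f := fun p : ℝ × ℝ × ℝ => kappa1Bracket a b p.1 p.2.2) (x := (0, x, 0)) (by
      unfold kappa1Bracket
      exact (contDiffAt_const.add (ContDiffAt.div (n := 1) (by fun_prop) (by fun_prop)
        (by simp))).differentiableAt one_ne_zero)
  generalize fderiv ℝ (fun p : ℝ × ℝ × ℝ => kappa1Bracket a b p.1 p.2.2) (0, x, 0) = B' at hB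
  have h1 : HasFDerivAt (fun p : ℝ × ℝ × ℝ => p.1)
      (ContinuousLinearMap.fst ℝ ℝ (ℝ × ℝ)) (0, x, 0) := hasFDerivAt_fst
  have h2 : HasFDerivAt (fun p : ℝ × ℝ × ℝ => p.2.1)
      ((ContinuousLinearMap.fst ℝ ℝ ℝ).comp (ContinuousLinearMap.snd ℝ ℝ (ℝ × ℝ))) (0, x, 0) :=
    ((ContinuousLinearMap.fst ℝ ℝ ℝ).comp (ContinuousLinearMap.snd ℝ ℝ (ℝ × ℝ))).hasFDerivAt
  have h3 : HasFDerivAt (fun p : ℝ × ℝ × ℝ => p.2.2)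
      ((ContinuousLinearMap.snd ℝ ℝ ℝ).comp (ContinuousLinearMap.snd ℝ ℝ (ℝ × ℝ))) (0, x, 0) :=
    ((ContinuousLinearMap.snd ℝ ℝ ℝ).comp (ContinuousLinearMap.snd ℝ ℝ (ℝ × ℝ))).hasFDerivAt
  have e1 := (h1.mul (h2.sub_const 1)).mul hB
  have e2 := (h3.mul ((((h1.pow 2).const_mul α).mul h3).const_add 1 |>.add
    (((h1.pow 2).mul h2).mul (h2.sub_const 1)))).sub ((h2.mul (h2.sub_const 1)).mul hB)
  have e3 := ((h3.neg.mul (h2.sub_const 1))).mul ((hB.const_mul 2).sub (h3.mul (h1.pow 2)))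
  refine (e1.prodMk (e2.prodMk e3)).congr_fderiv ?_
  have hx' : x = 0 ∨ x = 1 := (mul_eq_zero.1 hx).imp_right sub_eq_zero.1
  rcases hx' with rfl | rfl <;> ext <;> simp [triangularMap, kappa1Bracket]
  ring

lemma charpoly_triangularMap (c β κ : ℝ) :
    (triangularMap c β κ : ℝ × ℝ × ℝ →ₗ[ℝ] ℝ × ℝ × ℝ).charpoly =
      (({c, β, κ} : Multiset ℝ).map fun d => Polynomial.X - Polynomial.C d).prod := by
  have h : (triangularMap c β κ : ℝ × ℝ × ℝ →ₗ[ℝ] ℝ × ℝ × ℝ) =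
      ((LinearEquiv.funUnique Unit ℝ ℝ).conj (Matrix.toLin' (Matrix.of fun _ _ => c))).prodMap
        ((LinearEquiv.finTwoArrow ℝ ℝ).conj (Matrix.toLin' !![β, 1; 0, κ])) := by
    ext <;> simp [triangularMap, Matrix.mulVec, dotProduct]
  rw [h, LinearMap.charpoly_prodMap, LinearEquiv.charpoly_conj, LinearEquiv.charpoly_conj,
    Matrix.charpoly_toLin', Matrix.charpoly_toLin', Matrix.charpoly_fin_two, Matrix.charpoly,
    Matrix.det_unique]
  simp only [Matrix.charmatrix_apply, Matrix.trace_fin_two, Matrix.det_fin_two, Multiset.insert_eq_cons,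
    Multiset.map_cons, Multiset.map_singleton, Multiset.prod_cons, Multiset.prod_singleton,
    Matrix.of_apply, Matrix.cons_val', Matrix.cons_val_zero, Matrix.cons_val_one,
    Matrix.diagonal_apply_eq, Matrix.cons_val_fin_one, mul_zero, sub_zero, map_add, map_mul]
  ring

lemma roots_charpoly_triangularMap (c β κ : ℝ) :
    (triangularMap c β κ : ℝ × ℝ × ℝ →ₗ[ℝ] ℝ × ℝ × ℝ).charpoly.roots = {c, β, κ} := by
  rw [charpoly_triangularMap, Polynomial.roots_multiset_prod_X_sub_C]

lemma re_ne_zero_of_isRoot {c β κ : ℝ} (hc : c ≠ 0) (hβ : β ≠ 0) (hκ : κ ≠ 0) {z : ℂ}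
    (hz : (((triangularMap c β κ : ℝ × ℝ × ℝ →ₗ[ℝ] ℝ × ℝ × ℝ).charpoly).map
      (algebraMap ℝ ℂ)).IsRoot z) : z.re ≠ 0 := by
  rw [charpoly_triangularMap] at hz
  simp only [Multiset.insert_eq_cons, Multiset.map_cons, Multiset.map_singleton,
    Multiset.prod_cons, Multiset.prod_singleton, Polynomial.map_mul, Polynomial.map_sub,
    Polynomial.map_X, Polynomial.map_C, Polynomial.IsRoot.def, Polynomial.eval_mul,
    Polynomial.eval_sub, Polynomial.eval_X, Polynomial.eval_C, mul_eq_zero, sub_eq_zero] at hz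
  rcases hz with rfl | rfl | rfl <;> simpa

lemma fderiv_kappa1Field_zero : fderiv ℝ (kappa1Field a b α) 0 = triangularMap (-b) b (2 * b) := by
  have h := (hasFDerivAt_kappa1Field (a := a) (b := b) (α := α) (x := 0) (by ring)).fderiv
  rw [show (0 : ℝ × ℝ × ℝ) = (0, 0, 0) from rfl, h]
  ring_nf

lemma fderiv_kappa1Field_pointL1 :
    fderiv ℝ (kappa1Field a b α) pointL1 = triangularMap 0 (-b) 0 := by
  have h := (hasFDerivAt_kappa1Field (a := a) (b := b) (α := α) (x := 1) (by ring)).fderiv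
  rw [pointL1, h]
  ring_nf

lemma isHyperbolicEquilibrium_zero (a α : ℝ) (hb : 0 < b) :
    IsHyperbolicEquilibrium (kappa1Field a b α) 0 := by
  refine ⟨by simp [kappa1Field],
    (hasFDerivAt_kappa1Field (x := 0) (by ring)).differentiableAt, fun z hz => ?_⟩
  rw [fderiv_kappa1Field_zero] at hz
  exact re_ne_zero_of_isRoot (by linarith) hb.ne' (by linarith) hz

lemma linearizationEigenvalues_zero (a b α : ℝ) :
    linearizationEigenvalues (kappa1Field a b α) 0 = {-b, b, 2 * b} := by
  rw [linearizationEigenvalues, fderiv_kappa1Field_zero, roots_charpoly_triangularMap]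

lemma hasEigenvector_zero (a b α : ℝ) : Module.End.HasEigenvector
    ((fderiv ℝ (kappa1Field a b α) 0 : (ℝ × ℝ × ℝ) →L[ℝ] (ℝ × ℝ × ℝ)) :
      (ℝ × ℝ × ℝ) →ₗ[ℝ] (ℝ × ℝ × ℝ)) (2 * b) (0, 1, b) := by
  refine ⟨Module.End.mem_eigenspace_iff.2 ?_, strongDirection_ne_zero b⟩
  rw [fderiv_kappa1Field_zero, ContinuousLinearMap.coe_coe, triangularMap_apply]
  simp only [Prod.smul_mk, smul_eq_mul, mul_zero, mul_one, Prod.mk.injEq, and_true, true_and]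
  ring

lemma linearizationEigenvalues_pointL1 (a b α : ℝ) :
    linearizationEigenvalues (kappa1Field a b α) pointL1 = {0, 0, -b} := by
  rw [linearizationEigenvalues, fderiv_kappa1Field_pointL1, roots_charpoly_triangularMap]
  simp only [Multiset.insert_eq_cons]
  rw [← Multiset.cons_zero, ← Multiset.cons_zero, Multiset.cons_swap (-b)]

lemma range_graphTangent (a α : ℝ) (hb : 0 < b) :
    LinearMap.range (graphTangent b : ℝ × ℝ →ₗ[ℝ] ℝ × ℝ × ℝ) =
      centerSubspace (fderiv ℝ (kappa1Field a b α) pointL1) := by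
  rw [fderiv_kappa1Field_pointL1]
  ext p
  rw [centerSubspace, Module.End.mem_maxGenEigenspace, zero_smul, sub_zero, LinearMap.mem_range]
  constructor
  · rintro ⟨u, rfl⟩
    refine ⟨1, ?_⟩
    rw [pow_one, ContinuousLinearMap.coe_coe, triangularMap_apply]
    have := hb.ne'
    simp only [graphTangent]
    ext <;> simp
    field_simp
    ring
  · rintro ⟨k, hk⟩
    -- The second coordinate of every positive power is a nonzero multiple of y - b x, so the
    -- generalized kernel is the plane y = b x.
    have hpow : ∀ k (p : ℝ × ℝ × ℝ),
        (((triangularMap 0 (-b) 0 : ℝ × ℝ × ℝ →ₗ[ℝ] ℝ × ℝ × ℝ) ^ (k + 1)) p).2.1 =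
          (-b) ^ k * (-b * p.2.1 + p.2.2) := by
      intro k
      induction k with
      | zero => intro p; simp [triangularMap_apply]
      | succ k ih =>
        intro p
        rw [pow_succ, Module.End.mul_apply, ih, ContinuousLinearMap.coe_coe, triangularMap_apply]
        simp only
        ring
    have h1 := hpow k p
    rw [pow_succ', Module.End.mul_apply, hk, map_zero] at h1
    have h2 : -b * p.2.1 + p.2.2 = 0 := by
      have := pow_ne_zero k (neg_ne_zero.2 hb.ne')
      exact (mul_eq_zero.1 h1.symm).resolve_left this
    refine ⟨(p.1, p.2.2), ?_⟩
    refine Prod.ext rfl (Prod.ext ?_ rfl)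
    change b⁻¹ * p.2.2 = p.2.1
    rw [inv_mul_eq_iff_eq_mul₀ hb.ne']
    linarith

end Linearization

theorem lemma4p4 (a b α : ℝ) (hb : 0 < b) :
    -- (1) the origin
    (IsHyperbolicEquilibrium (kappa1Field a b α) 0 ∧
      linearizationEigenvalues (kappa1Field a b α) 0 = {-b, b, 2 * b} ∧
      Module.End.HasEigenvector
        ((fderiv ℝ (kappa1Field a b α) 0 : (ℝ × ℝ × ℝ) →L[ℝ] (ℝ × ℝ × ℝ)) :
          (ℝ × ℝ × ℝ) →ₗ[ℝ] (ℝ × ℝ × ℝ)) (2 * b) (0, 1, b) ∧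
      unstableManifold (kappa1Field a b α) (kappa1Space a) 0 ⊆ {p | p.1 = 0} ∧
      ∃ U₁ : Set (ℝ × ℝ × ℝ), IsOpen U₁ ∧ 0 ∈ U₁ ∧
        stableManifold (kappa1Field a b α) (kappa1Space a) 0 ∩ U₁ =
          {p | p ∈ U₁ ∧ p.2.1 = 0 ∧ p.2.2 = 0 ∧ 0 ≤ p.1} ∧
        unstableManifold (kappa1Field a b α) (kappa1Space a) 0 ∩ U₁ =
          {p | p ∈ U₁ ∧ p.1 = 0} ∧
        ∃ (δ : ℝ) (φ : ℝ → ℝ), 0 < δ ∧ (∀ p ∈ U₁, |p.2.1| < δ) ∧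
          ContDiffOn ℝ ∞ φ (Ioo (-δ) δ) ∧
          (fun x => φ x - b * x) =O[𝓝 0] (fun x => x ^ 2) ∧
          kappa1Wuu a b α ∩ U₁ = {p | p ∈ U₁ ∧ p.1 = 0 ∧ p.2.2 = φ p.2.1} ∧
          -- uniqueness among invariant curves in the plane tangent to the strong eigenvector
          ∀ (ε : ℝ) (ψ : ℝ → ℝ), 0 < ε → ContDiffOn ℝ 1 ψ (Ioo (-ε) ε) →
            ψ 0 = 0 → deriv ψ 0 = b →
            IsLocallyInvariant (kappa1Field a b α) (kappa1Space a) {p | |p.2.1| < ε}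
              {p | p.1 = 0 ∧ |p.2.1| < ε ∧ p.2.2 = ψ p.2.1} →
            ∀ᶠ x in 𝓝 0, ψ x = φ x) ∧
    -- (2) the part of the strong unstable manifold in the half space y₁ ≥ 0 is, apart from the
    -- origin, a single orbit in the first quadrant going from the origin to the point L₁
    ((∀ p ∈ kappa1Wuu a b α, 0 ≤ p.2.2 → p ≠ 0 → p.1 = 0 ∧ 0 < p.2.1 ∧ 0 < p.2.2) ∧
      ∃ γ : ℝ → ℝ × ℝ × ℝ, IsSolutionOn (kappa1Field a b α) (kappa1Space a) γ univ ∧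
        range γ = {p | p ∈ kappa1Wuu a b α ∧ 0 ≤ p.2.2 ∧ p ≠ 0} ∧
        ApproachesAlong γ atBot 0 (0, 1, b) ∧
        ApproachesAlong γ atTop pointL1 (0, 1, b)) ∧
    -- (3) the point L₁ and its center manifold
    (kappa1Field a b α pointL1 = 0 ∧
      DifferentiableAt ℝ (kappa1Field a b α) pointL1 ∧
      linearizationEigenvalues (kappa1Field a b α) pointL1 = {0, 0, -b} ∧
      (∀ p ∈ lineC1, kappa1Field a b α p = 0) ∧
      ∃ (r δ χ : ℝ) (m : ℝ × ℝ → ℝ), 0 < r ∧ 0 < δ ∧ 0 < χ ∧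
        (∀ p ∈ boxL1 r δ χ, 0 < 1 + a * p.1 ^ 2 * p.2.2) ∧
        -- smoothness and expansion
        ContDiffOn ℝ ∞ m (Ico 0 r ×ˢ Ico 0 χ) ∧
        (∃ K : ℝ, ∀ u ∈ Ico 0 r ×ˢ Ico 0 χ, |m u - b⁻¹| ≤ K * u.2) ∧
        -- local invariance and tangency to the center subspace
        IsLocallyInvariant (kappa1Field a b α) (kappa1SpacePos a) (boxL1 r δ χ)
          (graphSurface m (boxL1 r δ χ)) ∧
        (∃ T : ℝ × ℝ →L[ℝ] ℝ × ℝ × ℝ,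
          HasFDerivWithinAt (graphMap m) T (Ici 0 ×ˢ Ici 0) 0 ∧
          LinearMap.range (T : ℝ × ℝ →ₗ[ℝ] ℝ × ℝ × ℝ) =
            centerSubspace (fderiv ℝ (kappa1Field a b α) pointL1)) ∧
        -- exponential attraction of orbits, as long as they stay in the box
        (∃ K c : ℝ, 0 < c ∧ ∀ (γ : ℝ → ℝ × ℝ × ℝ) (τ : ℝ), 0 ≤ τ →
          IsSolutionOn (kappa1Field a b α) (kappa1SpacePos a ∩ boxL1 r δ χ) γ (Icc 0 τ) →
          |(γ τ).2.1 - (1 + (γ τ).2.2 * m ((γ τ).1, (γ τ).2.2))| ≤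
            K * Real.exp (-c * τ) *
              |(γ 0).2.1 - (1 + (γ 0).2.2 * m ((γ 0).1, (γ 0).2.2))|) ∧
        -- the line of equilibria lies on the center manifold
        lineC1 ∩ boxL1 r δ χ ⊆ graphSurface m (boxL1 r δ χ) ∧
        -- the strong unstable manifold is the center submanifold in the invariant plane
        kappa1Wuu a b α ∩ boxL1 r δ χ =
          {p | p ∈ graphSurface m (boxL1 r δ χ) ∧ p.1 = 0 ∧ 0 < p.2.2} ∧
        -- it is the only center manifold in that plane which emanates from the origin
        -- along the strong eigenvector
        ∀ (η : ℝ) (g : ℝ → ℝ), 0 < η → ContDiffOn ℝ 1 g (Ico 0 η) → g 0 = 1 →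
          HasDerivWithinAt g b⁻¹ (Ici 0) 0 →
          IsLocallyInvariant (kappa1Field a b α) (kappa1SpacePos a) {p | p.2.2 < η}
            (planarCurve g η) →
          (∃ y ∈ Ioo 0 η, ∃ γ : ℝ → ℝ × ℝ × ℝ,
            IsSolutionOn (kappa1Field a b α) (kappa1SpacePos a) γ (Iic 0) ∧
            γ 0 = (0, g y, y) ∧ ApproachesAlong γ atBot 0 (0, 1, b)) →
          ∀ᶠ y in 𝓝[>] 0, g y = 1 + y * m (0, y)) := by
  obtain ⟨U, hUo, hU0, hWu, δ, φ, hδ, hUδ, hφ, hφO, hWuu, hψ⟩ := exists_origin_neighborhood a α hb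
  obtain ⟨w₁, m, hm⟩ := exists_matchedGraph a α hb
  have hG := hm.graph
  -- The first bound keeps the box within the domain of the graph; the second keeps the part of the
  -- Dawson curve before w₁ out of it.
  set χ := min (b * dawson w₁ ^ 2) (4 / 5 * (b / w₁ ^ 2)) with hχ
  have hχ1 : χ ≤ b * dawson w₁ ^ 2 := min_le_left _ _
  have hχ2 : χ ≤ 4 / 5 * (b / w₁ ^ 2) := min_le_right _ _
  have hw₁ := hm.pos
  have hχ0 : 0 < χ := lt_min hG.small.pos (by positivity)
  have hsub : Ico (0 : ℝ) 1 ×ˢ Ico 0 χ ⊆ Ico 0 1 ×ˢ Ico 0 (b * dawson w₁ ^ 2) :=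
    prod_mono subset_rfl (Ico_subset_Ico_right hχ1)
  -- Every k > 0 gives the connecting orbit up to a shift of time; here k = 1.
  refine ⟨⟨isHyperbolicEquilibrium_zero a α hb, linearizationEigenvalues_zero a b α,
    hasEigenvector_zero a b α, ?_, U, hUo, hU0, stableManifold_inter a α hb U, hWu, δ, φ, hδ, hUδ,
    hφ, hφO, hWuu, hψ⟩, ⟨?_, fun t => dawsonCurve b (dawsonTime b 1 t),
    isSolutionOn_dawsonCurve a b α 1 univ, ?_, approachesAlong_dawsonCurve_atBot hb one_pos,
    approachesAlong_dawsonCurve_atTop hb one_pos⟩, ?_,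
    (hasFDerivAt_kappa1Field (x := 1) (by ring)).differentiableAt,
    linearizationEigenvalues_pointL1 a b α, fun p hp => kappa1Field_of_mem_lineC1 hp,
    1, 1 / 10, χ, extendGraph b m, one_pos, by norm_num, hχ0, fun p hp => hG.one_add_pos hχ1 hp,
    hG.contDiffOn_extendGraph.mono hsub, ?_, hG.isLocallyInvariant hχ1,
    ⟨graphTangent b, hG.hasFDerivWithinAt_graphMap, range_graphTangent a α hb⟩,
    ⟨1, b / 2, by positivity, fun γ τ hτ hγ => hG.attraction hχ1 hτ hγ⟩,
    lineC1_inter_subset b m _, hm.kappa1Wuu_inter hχ1 hχ2,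
    fun η g _ hg hg0 _ hinv hex => hm.eventually_eq hg.continuousOn hg0 hinv hex⟩
  · rintro p ⟨γ, h, rfl, hlim⟩
    exact rho_eq_zero_of_unstable hb h hlim 0 le_rfl
  · intro p hp hy hp0
    obtain ⟨w, hw, rfl⟩ := kappa1Wuu_inter_nonneg a α hb hp hy hp0
    have := dawson_pos hw
    exact ⟨rfl, mul_pos hw this, mul_pos hb (pow_pos this 2)⟩
  · ext p
    constructor
    · rintro ⟨t, rfl⟩
      have hW := dawsonTime_pos (b := b) one_pos t
      have hpos : 0 < b * dawson (dawsonTime b 1 t) ^ 2 := mul_pos hb (pow_pos (dawson_pos hW) 2)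
      refine ⟨dawsonCurve_mem_kappa1Wuu a α hb hW, hpos.le, fun h => ?_⟩
      exact hpos.ne' (congrArg (fun p : ℝ × ℝ × ℝ => p.2.2) h)
    · rintro ⟨hp, hy, hp0⟩
      obtain ⟨w, hw, rfl⟩ := kappa1Wuu_inter_nonneg a α hb hp hy hp0
      obtain ⟨t, rfl⟩ := exists_dawsonTime_eq hb one_pos hw
      exact ⟨t, rfl⟩
  · simp [kappa1Field, pointL1]
  · obtain ⟨K, hK⟩ := hG.abs_extendGraph_sub_le
    refine ⟨K, fun u hu => hK u ⟨⟨?_, hu.1.2⟩, (hsub hu).2⟩⟩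
    linarith [hu.1.1]
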